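/- Let $\phi$ be the free real Klein–Gordon field of mass $m\ge 0$ on $(3+1)$-dimensional Minkowski space, $\hat\phi(t,\boldsymbol x)=\int d^3\boldsymbol k\,(\hat a_{\boldsymbol k}\phi_{\boldsymbol k}+\mathrm{h.c.})$ with $\phi_{\boldsymbol k}(t,\boldsymbol x)=(2(2\pi)^3\omega_{\boldsymbol k})^{-1/2}e^{-i\omega_{\boldsymbol k}t+i\boldsymbol k\cdot\boldsymbol x}$, $\omega_{\boldsymbol k}=\sqrt{|\boldsymbol k|^2+m^2}$, and let $|0\rangle$ be the Minkowski vacuum. A spatially extended Unruh–DeWitt detector with comoving coordinates $(\tau,\boldsymbol\zeta)$ ($\tau$ the proper time of its centre) and real spatial profile $f$ couples to the smeared field $\tilde\phi(\tau)=\int d^3\boldsymbol\zeta\,\sqrt{-g(\boldsymbol\zeta)}\,f(\boldsymbol\zeta)\,\hat\phi(\tau,\boldsymbol\zeta)$; we assume that $\sqrt{-g}\,f$ is a Schwartz function. To first order in perturbation theory its vacuum transition rate at energy gap $\Delta\in\mathbb R$ is $$\dot F_\tau(\Delta)=2\int_0^\infty ds\,\mathrm{Re}\big[e^{-i\Delta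 s}\,W(\tau,\tau-s)\big],\qquad W(\tau,\tau')=\langle 0|\tilde\phi(\tau)\tilde\phi(\tau')|0\rangle .$$ Let $\Theta(x)=1$ for $x\ge0$ and $\Theta(x)=0$ for $x<0$. (i) Inertial trajectory ($\tau=t$, $\boldsymbol\zeta=\boldsymbol x$, $\sqrt{-g}=1$). For every $t$ the vector $\tilde\phi(t)|0\rangle$ belongs to the Fock space, the integral for $\dot F_t(\Delta)$ converges absolutely, and $\dot F_t(\Delta)$ does not depend on $t$. If $\tilde f(\boldsymbol k)=\int d^3\boldsymbol x\,f(\boldsymbol x)e^{i\boldsymbol k\cdot\boldsymbol x}$ depends on $|\boldsymbol k|$ only, and $\tilde f(\omega)$ denotes its value at the momenta with $\omega_{\boldsymbol k}=\omega$, i.e. $|\boldsymbol k|=\sqrt{\omega^2-m^2}$, then for all $\Delta$ $$\dot F_t(\Delta)=\frac{1}{2\pi}\,\Theta(-\Delta-m)\,\sqrt{\Delta^2-m^2}\;|\tilde f(-\Delta)|^2 .$$ (ii) Uniformly accelerated trajectory with proper acceleration $a>0$: $t=a^{-1}e^{a\xi}\sinh(a\rho)$, $x=a^{-1}e^{a\xi}\cosh(a\rho)$,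 $\tau=\rho$, $\boldsymbol\zeta=(\xi,\boldsymbol x_\perp)$, $\sqrt{-g}=e^{2a\xi}$. Put $\kappa=\sqrt{|\boldsymbol k_\perp|^2+m^2}$, $$\tilde f(\Omega,\boldsymbol k_\perp)=\int d^3\boldsymbol\xi\,e^{2a\xi}f(\boldsymbol\xi)\,K_{i\Omega/a}\big(\tfrac{\kappa}{a}e^{a\xi}\big)e^{i\boldsymbol k_\perp\cdot\boldsymbol x_\perp},\qquad N_\Omega^2=\frac{\sinh(\pi\Omega/a)}{4\pi^4a},$$ where $N_\Omega$ ($\Omega>0$) normalises the Rindler modes, and $$\Xi(\Delta)=\int d^2\boldsymbol k_\perp\big[N_{\Delta}^2|\tilde f(\Delta,\boldsymbol k_\perp)|^2\Theta(\Delta)-N_{-\Delta}^2|\tilde f(-\Delta,\boldsymbol k_\perp)|^2\Theta(-\Delta)\big].$$ For every $\rho$ the vector $\tilde\phi(\rho)|0\rangle$ belongs to the Fock space, the integral for $\dot F_\rho(\Delta)$ converges absolutely, and so do the integrals for $\Xi(\Delta)$ and, when $\kappa>0$, for $\tilde f(\Omega,\boldsymbol k_\perp)$. The rate $\dot F_\rho(\Delta)$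 does not depend on $\rho$, and for all $\Delta\ne0$ $$\dot F_\rho(\Delta)=\frac{2\pi}{e^{2\pi\Delta/a}-1}\,\Xi(\Delta).$$ It satisfies the Kubo–Martin–Schwinger condition $\dot F_\rho(\Delta)=e^{-2\pi\Delta/a}\dot F_\rho(-\Delta)$ for all $\Delta$. (iii) Gaussian windows. Let $\sigma>0$. For $\boldsymbol\lambda\in\mathbb R^3$ the profile $f(\boldsymbol x)=(\sqrt{2\pi}\,\sigma)^{-3}e^{-|\boldsymbol x|^2/(2\sigma^2)}(e^{-i\boldsymbol\lambda\cdot\boldsymbol x}+e^{i\boldsymbol\lambda\cdot\boldsymbol x})$ has $$\int d^3\boldsymbol x\,f(\boldsymbol x)e^{i\boldsymbol k\cdot\boldsymbol x}=e^{-\frac12\sigma^2|\boldsymbol k-\boldsymbol\lambda|^2}+e^{-\frac12\sigma^2|\boldsymbol k+\boldsymbol\lambda|^2}.$$ For the accelerated detector in $1+1$ dimensions (massless field), $a>0$ and $\lambda\in\mathbb R$, the profile $f(\xi)=(\sqrt{2\pi}\,\sigma)^{-1}e^{-2a\xi}e^{-\xi^2/(2\sigma^2)}(e^{-i\lambda\xi}+e^{i\lambda\xi})$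 has $$\int d\xi\,e^{2a\xi}f(\xi)e^{i\Omega\xi}=e^{-\frac12\sigma^2(\lambda-\Omega)^2}+e^{-\frac12\sigma^2(\lambda+\Omega)^2}\qquad(\Omega\in\mathbb R).$$ -/

import Mathlib

open MeasureTheory Set
open scoped ComplexConjugate SchwartzMap

noncomputable section

namespace UDW

/-- Three-dimensional Euclidean space, used for positions `(x, y, z)` and momenta `(k_x, k_y, k_z)`.
The direction of acceleration is coordinate `0`. -/
abbrev Space := EuclideanSpace ℝ (Fin 3)

/-- Two-dimensional Euclidean space of transverse momenta `(k_y, k_z)`. -/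
abbrev Transverse := EuclideanSpace ℝ (Fin 2)

/-- The Heaviside function with `Θ(0) = 1`. -/
def theta (x : ℝ) : ℝ := if 0 ≤ x then 1 else 0

/-! ### The Klein-Gordon field on the Minkowski Fock space -/

/-- The frequency `ω_k = √(k·k + m²)`. -/
def omega (m : ℝ) (k : Space) : ℝ := √(‖k‖ ^ 2 + m ^ 2)

/-- The Minkowski mode `(2 (2π)³ ω_k)^(-1/2) exp(-i ω_k t + i k·x)` at the event `p = (t, x)`. -/
def planeWave (m : ℝ) (k : Space) (p : ℝ × Space) : ℂ :=
  ((1 / √(2 * (2 * Real.pi) ^ 3 * omega m k) : ℝ) : ℂ) *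
    Complex.exp (Complex.I * ((-(omega m k) * p.1 + inner ℝ k p.2 : ℝ) : ℂ))

/-- Sequences of `n`-particle momentum wave functions. The bosonic Fock space over `L²(ℝ³)` consists
of those that satisfy `IsFockState`. -/
abbrev FockVector := (n : ℕ) → (Fin n → Space) → ℂ

/-- Symmetric, square integrable in every sector, with finite total norm. -/
def IsFockState (Ψ : FockVector) : Prop :=
  (∀ (n : ℕ) (σ : Equiv.Perm (Fin n)) (k : Fin n → Space), Ψ n (k ∘ σ) = Ψ n k) ∧
  (∀ n, MemLp (Ψ n) 2 volume) ∧
  Summable fun n => ∫ k, ‖Ψ n k‖ ^ 2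

/-- The Fock space inner product, conjugate-linear in the first argument. -/
def fockInner (Ψ Φ : FockVector) : ℂ := ∑' n, ∫ k, conj (Ψ n k) * Φ n k

/-- The Minkowski vacuum `|0⟩`. -/
def vacuum : FockVector := fun n _ => if n = 0 then 1 else 0

/-- The smeared creation operator `a†(h) = ∫ d³k h(k) a†_k`. -/
def create (h : Space → ℂ) (Ψ : FockVector) : FockVector
  | 0, _ => 0
  | n + 1, k => ((1 / √((n : ℝ) + 1) : ℝ) : ℂ) *
      ∑ i : Fin (n + 1), h (k i) * Ψ n (fun j => k (i.succAbove j))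

/-- The smeared annihilation operator `a(h) = ∫ d³k conj(h(k)) a_k`. -/
def annihilate (h : Space → ℂ) (Ψ : FockVector) : FockVector := fun n k =>
  ((√((n : ℝ) + 1) : ℝ) : ℂ) * ∫ q, conj (h q) * Ψ (n + 1) (Fin.cons q k)

/-! ### The detector

A detector is described by comoving coordinates `X : (τ, ζ) ↦ (t, x)`, where `τ` is the proper time
of its centre, by the volume factor `w = √(-g)` of these coordinates, and by its spatial profile `f`. -/

/-- The coefficient of `a†_k` in `∫ d³ζ √(-g(ζ)) f(ζ) φ(X(τ, ζ))`, where
`φ = ∫ d³k (a_k φ_k + h.c.)` is the field and `φ_k` is `planeWave m k`. -/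
def amplitude (m : ℝ) (X : ℝ → Space → ℝ × Space) (w f : Space → ℝ) (τ : ℝ) (k : Space) : ℂ :=
  ∫ ζ, ((w ζ * f ζ : ℝ) : ℂ) * conj (planeWave m k (X τ ζ))

/-- The smeared field operator `∫ d³ζ √(-g(ζ)) f(ζ) φ(X(τ, ζ))`. -/
def smearedField (m : ℝ) (X : ℝ → Space → ℝ × Space) (w f : Space → ℝ) (τ : ℝ)
    (Ψ : FockVector) : FockVector := fun n k =>
  annihilate (amplitude m X w f τ) Ψ n k + create (amplitude m X w f τ) Ψ n k

/-- The vacuum Wightman function `W(τ, τ') = ⟨0| φ(τ) φ(τ') |0⟩` of the smeared field. -/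
def wightman (m : ℝ) (X : ℝ → Space → ℝ × Space) (w f : Space → ℝ) (τ τ' : ℝ) : ℂ :=
  fockInner vacuum (smearedField m X w f τ (smearedField m X w f τ' vacuum))

/-- The integrand `Re [exp(-i Δ s) W(τ, τ - s)]` of the transition rate. -/
def rateIntegrand (m : ℝ) (X : ℝ → Space → ℝ × Space) (w f : Space → ℝ) (τ Δ s : ℝ) : ℝ :=
  (Complex.exp (-Complex.I * Δ * s) * wightman m X w f τ (τ - s)).re

/-- The first-order transition rate `2 ∫₀^∞ ds Re [exp(-i Δ s) W(τ, τ - s)]` at proper time `τ` of a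
detector with energy gap `Δ` that was switched on in the distant past. -/
def transitionRate (m : ℝ) (X : ℝ → Space → ℝ × Space) (w f : Space → ℝ) (τ Δ : ℝ) : ℝ :=
  2 * ∫ s in Ioi (0 : ℝ), rateIntegrand m X w f τ Δ s

/-- The profiles considered: `√(-g) f` is a Schwartz function of the comoving coordinates. -/
def IsProfile (w f : Space → ℝ) : Prop := ∃ h : 𝓢(Space, ℝ), ∀ ζ, h ζ = w ζ * f ζ

/-! ### Inertial trajectory -/

/-- The comoving coordinates of a detector at rest are the Minkowski coordinates. -/
def inertialChart (τ : ℝ) (ζ : Space) : ℝ × Space := (τ, ζ)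

/-- The factor `√(-g) = 1` of Minkowski coordinates. -/
def inertialVol : Space → ℝ := fun _ => 1

/-- The frequency distribution `∫ d³x f(x) exp(+i k·x)`. -/
def minkowskiWindow (f : Space → ℝ) (k : Space) : ℂ :=
  ∫ x, (f x : ℂ) * Complex.exp (Complex.I * ((inner ℝ k x : ℝ) : ℂ))

/-- For a rotation-invariant frequency distribution: its value on the momenta of frequency `ω`, that
is, with `|k| = √(ω² - m²)`. -/
def windowAtFrequency (m : ℝ) (f : Space → ℝ) (ω : ℝ) : ℂ :=
  minkowskiWindow f (EuclideanSpace.single 0 (√(ω ^ 2 - m ^ 2)))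

/-! ### Uniformly accelerated trajectory -/

/-- The conformally flat Rindler coordinates `(ρ, (ξ, y, z))` of the right wedge:
`t = e^(aξ) sinh(aρ) / a`, `x = e^(aξ) cosh(aρ) / a`. -/
def rindlerChart (a : ℝ) (ρ : ℝ) (ζ : Space) : ℝ × Space :=
  (Real.exp (a * ζ 0) * Real.sinh (a * ρ) / a,
    !₂[Real.exp (a * ζ 0) * Real.cosh (a * ρ) / a, ζ 1, ζ 2])

/-- The factor `√(-g) = e^(2aξ)` of the metric
`e^(2aξ) (-dρ² + dξ²) + dy² + dz²`. -/
def rindlerVol (a : ℝ) (ζ : Space) : ℝ := Real.exp (2 * a * ζ 0)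

/-- The modified Bessel function of the second kind
`K_μ(z) = ∫₀^∞ exp(-z cosh t) cosh(μ t) dt`, for `z > 0` and complex order. -/
def besselK (μ : ℂ) (z : ℝ) : ℂ :=
  ∫ t in Ioi (0 : ℝ), ((Real.exp (-z * Real.cosh t) : ℝ) : ℂ) * Complex.cosh (μ * t)

/-- `κ = √(k⊥·k⊥ + m²)`. -/
def kappa (m : ℝ) (k : Transverse) : ℝ := √(‖k‖ ^ 2 + m ^ 2)

/-- The integrand of `rindlerWindow`. -/
def rindlerWindowIntegrand (m a : ℝ) (f : Space → ℝ) (Ω : ℝ) (k : Transverse) (ζ : Space) : ℂ :=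
  ((rindlerVol a ζ * f ζ : ℝ) : ℂ) *
    besselK (Complex.I * ((Ω / a : ℝ) : ℂ)) (kappa m k / a * Real.exp (a * ζ 0)) *
    Complex.exp (Complex.I * ((k 0 * ζ 1 + k 1 * ζ 2 : ℝ) : ℂ))

/-- The frequency distribution
`∫ d³ξ e^(2aξ) f(ξ) K_{iΩ/a}((κ/a) e^(aξ)) exp(+i k⊥·x⊥)` of the accelerated detector. -/
def rindlerWindow (m a : ℝ) (f : Space → ℝ) (Ω : ℝ) (k : Transverse) : ℂ :=
  ∫ ζ, rindlerWindowIntegrand m a f Ω k ζ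

/-- The constant that makes the Rindler modes
`N K_{iΩ/a}((κ/a) e^(aξ)) exp(-iΩρ + i k⊥·x⊥)`, `Ω > 0`, orthonormal for the Klein-Gordon product,
`(u_{Ω,k}, u_{Ω',k'}) = δ(Ω - Ω') δ²(k - k')`. -/
def rindlerNorm (a Ω : ℝ) : ℝ := √(Real.sinh (Real.pi * Ω / a) / (4 * Real.pi ^ 4 * a))

/-- The integrand of `rindlerXi`. -/
def rindlerXiIntegrand (m a : ℝ) (f : Space → ℝ) (Δ : ℝ) (k : Transverse) : ℝ :=
  rindlerNorm a Δ ^ 2 * ‖rindlerWindow m a f Δ k‖ ^ 2 * theta Δ -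
    rindlerNorm a (-Δ) ^ 2 * ‖rindlerWindow m a f (-Δ) k‖ ^ 2 * theta (-Δ)

/-- `Ξ(Δ) = ∫ d²k⊥ [N_Δ² |f̃(Δ, k⊥)|² Θ(Δ) - N_{-Δ}² |f̃(-Δ, k⊥)|² Θ(-Δ)]`. -/
def rindlerXi (m a : ℝ) (f : Space → ℝ) (Δ : ℝ) : ℝ := ∫ k, rindlerXiIntegrand m a f Δ k

/-- The frequency distribution `∫ dξ e^(2aξ) f(ξ) exp(iΩξ)` of an accelerated detector coupled to
the massless field in `1 + 1` dimensions. -/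
def rindlerWindowOne (a : ℝ) (f : ℝ → ℝ) (Ω : ℝ) : ℂ :=
  ∫ ξ : ℝ, ((Real.exp (2 * a * ξ) * f ξ : ℝ) : ℂ) * Complex.exp (Complex.I * Ω * ξ)

/-! ### Gaussian-modulated profiles

The real profiles are written with `2 cos u = e^(-iu) + e^(iu)`. -/

/-- `f(x) = n_σ exp(-x·x / (2σ²)) (exp(-iλ·x) + exp(iλ·x))` with `n_σ = (√(2π) σ)⁻³`. -/
def gaussianProfile (σ : ℝ) (l : Space) (x : Space) : ℝ :=
  (1 / (√(2 * Real.pi) * σ) ^ 3) * Real.exp (-(‖x‖ ^ 2 / (2 * σ ^ 2))) *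
    (2 * Real.cos (inner ℝ l x))

/-- `f(ξ) = N_σ e^(-2aξ) exp(-ξ² / (2σ²)) (exp(-iλξ) + exp(iλξ))` with `N_σ = (√(2π) σ)⁻¹`. -/
def gaussianRindlerProfile (a σ l : ℝ) (ξ : ℝ) : ℝ :=
  (1 / (√(2 * Real.pi) * σ)) * Real.exp (-(2 * a * ξ)) * Real.exp (-(ξ ^ 2 / (2 * σ ^ 2))) *
    (2 * Real.cos (l * ξ))

end UDW

end

open UDW

noncomputable section

namespace UDW

open Filter Topology LineDeriv

/-! ### Fock space -/

section Fock

variable (m : ℝ) (X : ℝ → Space → ℝ × Space) (w f : Space → ℝ)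

/-! The rate is a Fourier transform. Only `a a†` has a vacuum expectation value, so W(τ,τ') is the
L² pairing of two one-particle amplitudes (`wightman_eq`). On both trajectories it depends on s = τ
- τ' alone and W(-s) is the conjugate of W(s). Once W is integrable, the rate is the integral of
e^{-iΔs} W(s) over the whole line (`rate_of_wightman`). What remains is the integrability of W and
the evaluation of its transform.

Accelerated detector. With k_x = κ sinh θ the measure dk_x/ω becomes dθ, and proper time ρ
translates the rapidity: up to normalisation the amplitude is B(θ - aρ, k⊥), where B integrates the
profile against exp(-i(κ/a)e^{aξ} sinh θ - i k⊥·x⊥) (`amplitude_momentum`). Hence W is the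
autocorrelation of B in θ, and its transform is a multiple of ∫ |B̂(Δ/a, k⊥)|² d²k⊥
(`integral_exp_mul_stationaryWightman`). Shifting θ by -iπ/2 turns i sinh θ into cosh θ, so B̂ is
2e^{-πΔ/(2a)} times the Bessel window (`integral_rindlerTransform_eq`). The square of this factor is
the thermal weight e^{-πΔ/a}. As K_{iν} is even in ν, the KMS condition follows, and e^{2x} - 1 =
2e^x sinh x gives the Planck form. The analytic input is an integration by parts
(`norm_rindlerTransform_le_decay`) bounding B by (1 + log²(κ/a)) / ((1 + |k⊥|²)(1 + θ²)). It gives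
membership in Fock space and the integrability of W and Ξ, also for m = 0.

Inertial detector. W is a multiple of ∫ e^{-iωs} |f̃|²/ω d³k. In y = log|k|, two integrations by
parts (`norm_integral_radial_wave_le`) leave a factor 1/(1 + (s|k|²/ω)²). Integrating it over s
before y cancels ω, which proves W integrable for every m ≥ 0 (`integrable_waveIntegral`). For a
rotation-invariant f̃, W is up to a constant the Fourier transform of the continuous density
|k||f̃|² in ω, supported in ω ≥ m, and Fourier inversion evaluates the rate at ω = -Δ.

The Gaussian windows are Fourier transforms of Gaussians. -/

theorem annihilate_vacuum (h : Space → ℂ) (n : ℕ) (k : Fin n → Space) :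
    annihilate h vacuum n k = 0 := by
  simp [annihilate, vacuum]

theorem create_vacuum_one (h : Space → ℂ) (k : Fin 1 → Space) :
    create h vacuum 1 k = h (k 0) := by
  simp [create, vacuum]

theorem create_vacuum_add_two (h : Space → ℂ) (n : ℕ) (k : Fin (n + 2) → Space) :
    create h vacuum (n + 2) k = 0 := by
  simp [create, vacuum]

/-- Only the one-particle sector is nonzero and its wave function is the amplitude, so square
integrability of the amplitude is all that is at stake. -/
theorem isFockState_smearedField_vacuum (τ : ℝ) (hA : MemLp (amplitude m X w f τ) 2 volume) :
    IsFockState (smearedField m X w f τ vacuum) := by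
  set A := amplitude m X w f τ with hAdef
  have h0 : smearedField m X w f τ vacuum 0 = fun _ => 0 := by
    ext k; simp [smearedField, annihilate_vacuum, create]
  have h1 : smearedField m X w f τ vacuum 1 = fun k => A (k 0) := by
    ext k; simp [smearedField, annihilate_vacuum, create_vacuum_one, hAdef]
  have h2 : ∀ n, smearedField m X w f τ vacuum (n + 2) = fun _ => 0 := by
    intro n; ext k; simp [smearedField, annihilate_vacuum, create_vacuum_add_two]
  refine ⟨?_, ?_, ?_⟩
  · rintro (_ | _ | n) σ k
    · simp [h0]
    · have : σ (0 : Fin 1) = 0 := Subsingleton.elim (α := Fin 1) _ _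
      change smearedField m X w f τ vacuum 1 (k ∘ σ) = smearedField m X w f τ vacuum 1 k
      rw [h1]
      exact congrArg (fun i => A (k i)) this
    · simp [h2]
  · rintro (_ | _ | n)
    · rw [h0]; simp
    · rw [zero_add, h1]
      exact hA.comp_measurePreserving (volume_preserving_funUnique (Fin 1) Space)
    · rw [h2]; simp
  · refine summable_of_ne_finset_zero (s := {1}) ?_
    rintro (_ | _ | n) hn
    · simp [h0]
    · simp at hn
    · simp [h2]

theorem wightman_eq (τ τ' : ℝ) :
    wightman m X w f τ τ' =
      ∫ k, conj (amplitude m X w f τ k) * amplitude m X w f τ' k := by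
  unfold wightman fockInner
  rw [tsum_eq_single 0]
  -- `Fin 0 → Space` is a single point of mass one.
  · rw [integral_unique]
    simp [vacuum, smearedField, create, annihilate, volume_pi, measureReal_def]
  · intro n hn
    simp [vacuum, hn]

end Fock

/-! ### The transition rate as an integral over the real line -/

theorem two_mul_setIntegral_re_eq {u : ℝ → ℂ} (hsymm : ∀ s, u (-s) = conj (u s)) :
    2 * ∫ s in Ioi (0 : ℝ), (u s).re = ∫ s, (u s).re := by
  have habs : ∀ s, (u |s|).re = (u s).re := by
    intro s
    rcases abs_choice s with h | h <;> rw [h]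
    rw [hsymm, Complex.conj_re]
  rw [← integral_comp_abs (f := fun s => (u s).re)]
  simp_rw [habs]

/-- The conjugation symmetry makes the real part of the integrand even in s, so the half-line
integral doubles to one over the line. Integrability of `W` is what each trajectory has to supply.
-/
theorem rate_of_wightman {m : ℝ} {X : ℝ → Space → ℝ × Space} {w f : Space → ℝ} {τ : ℝ}
    {W : ℝ → ℂ} (hW : ∀ s, wightman m X w f τ (τ - s) = W s) (hint : Integrable W)
    (hsymm : ∀ s, W (-s) = conj (W s)) (Δ : ℝ) :
    IntegrableOn (rateIntegrand m X w f τ Δ) (Ioi 0) ∧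
      transitionRate m X w f τ Δ = (∫ s : ℝ, Complex.exp (-Complex.I * Δ * s) * W s).re := by
  have hu : Integrable fun s : ℝ => Complex.exp (-Complex.I * Δ * s) * W s := by
    refine hint.bdd_mul (c := 1) (by fun_prop) (Eventually.of_forall fun s => ?_)
    rw [Complex.norm_exp]; simp
  have heq : rateIntegrand m X w f τ Δ =
      fun s : ℝ => (Complex.exp (-Complex.I * Δ * s) * W s).re := by
    ext s; rw [rateIntegrand, hW]
  refine ⟨by rw [heq]; exact hu.re.integrableOn, ?_⟩
  rw [transitionRate, heq,
    two_mul_setIntegral_re_eq (u := fun s : ℝ => Complex.exp (-Complex.I * Δ * s) * W s)]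
  · exact integral_re hu
  · intro s
    rw [map_mul, ← Complex.exp_conj, hsymm]
    simp

/-! ### Elementary estimates -/

theorem one_add_sq_le_mul_exp (t : ℝ) (ht : 0 ≤ t) : 1 + t ^ 2 ≤ 2 * Real.exp t := by
  nlinarith [Real.quadratic_le_exp_of_nonneg ht]

/-- Once |θ| exceeds b = |log z|, exponential growth beats θ²; for |θ| ≤ b the right side exceeds
one. The scale z is paid for by a logarithm only, which stays square integrable in the transverse
plane as κ → 0. -/
theorem inv_sqrt_sinh_le {z : ℝ} (hz : 0 < z) (θ : ℝ) :
    (√(1 + (z * Real.sinh θ) ^ 2))⁻¹ ≤ 8 * (1 + Real.log z ^ 2) / (1 + θ ^ 2) := by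
  set b := |Real.log z| with hb
  have hb0 : 0 ≤ b := abs_nonneg _
  have hlog : Real.log z ^ 2 = b ^ 2 := (sq_abs _).symm
  have hzb : Real.exp (-b) ≤ z := by
    rw [← Real.le_log_iff_exp_le hz]; exact neg_abs_le _
  set S := √(1 + (z * Real.sinh θ) ^ 2) with hS
  have hS1 : 1 ≤ S := by
    rw [hS, Real.one_le_sqrt]; nlinarith [sq_nonneg (z * Real.sinh θ)]
  -- 1 + z² sinh²θ ≥ e^{-2b}(1 + sinh²θ), because e^{-b} is at most 1 and at most z.
  have hS2 : Real.exp (-b) * Real.cosh θ ≤ S := by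
    refine Real.le_sqrt_of_sq_le ?_
    have e1 : Real.exp (-b) ≤ 1 := Real.exp_le_one_iff.2 (by linarith)
    have e0 := Real.exp_pos (-b)
    have e2 : Real.exp (-b) ^ 2 ≤ 1 := by nlinarith
    have e3 : Real.exp (-b) ^ 2 ≤ z ^ 2 := by gcongr
    rw [mul_pow, mul_pow, Real.cosh_sq]
    nlinarith [mul_le_mul_of_nonneg_right e3 (sq_nonneg (Real.sinh θ))]
  have hθ : θ ^ 2 = |θ| ^ 2 := (sq_abs _).symm
  rw [inv_eq_one_div, div_le_div_iff₀ (by linarith) (by positivity), one_mul, hlog, hθ]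
  set t := |θ|
  have ht0 : 0 ≤ t := abs_nonneg _
  rcases le_total t b with h | h
  · have : t ^ 2 ≤ b ^ 2 := by gcongr
    nlinarith [sq_nonneg b]
  · have e1 : Real.exp (t - b) ≤ 2 * S := by
      have : Real.exp t ≤ 2 * Real.cosh θ := by
        rw [← Real.cosh_abs, Real.cosh_eq]; have := Real.exp_pos (-t); linarith
      calc Real.exp (t - b) = Real.exp (-b) * Real.exp t := by rw [← Real.exp_add]; ring_nf
        _ ≤ Real.exp (-b) * (2 * Real.cosh θ) := by gcongr
        _ ≤ 2 * S := by linarith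
    have e2 := one_add_sq_le_mul_exp (t - b) (by linarith)
    -- Peetre's inequality for t = b + (t - b).
    have e3 : 1 + t ^ 2 ≤ 2 * (1 + b ^ 2) * (1 + (t - b) ^ 2) := by
      nlinarith [sq_nonneg (t - 2 * b), mul_nonneg (sq_nonneg b) (sq_nonneg (t - b))]
    have e4 : 1 + (t - b) ^ 2 ≤ 4 * S := by linarith
    calc 1 + t ^ 2 ≤ 2 * (1 + b ^ 2) * (1 + (t - b) ^ 2) := e3
      _ ≤ 2 * (1 + b ^ 2) * (4 * S) := by gcongr
      _ = 8 * (1 + b ^ 2) * S := by ring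

theorem exp_neg_mul_cosh_le {z : ℝ} (hz : 0 < z) (θ : ℝ) :
    Real.exp (-(z * Real.cosh θ)) ≤ 8 * (1 + Real.log z ^ 2) / (1 + θ ^ 2) := by
  refine le_trans ?_ (inv_sqrt_sinh_le hz θ)
  rw [Real.exp_neg]
  refine inv_anti₀ (by positivity) ?_
  rw [Real.sqrt_le_left (Real.exp_pos _).le]
  have h1 := Real.add_one_le_exp (z * Real.cosh θ)
  have h2 : 0 < z * Real.cosh θ := mul_pos hz (Real.cosh_pos θ)
  have h3 := Real.cosh_sq θ
  have : (z * Real.sinh θ) ^ 2 = (z * Real.cosh θ) ^ 2 - z ^ 2 := by rw [mul_pow, mul_pow, h3]; ring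
  nlinarith [sq_nonneg z]

/-- With t = |log x|: (1 + t²)² ≤ 2(1 + t⁴) ≤ 2(1 + 24)e^t, and e^t is x or its inverse. -/
theorem one_add_sq_log_sq_le {x : ℝ} (hx : 0 < x) :
    (1 + Real.log x ^ 2) ^ 2 ≤ 50 * (x + x⁻¹) := by
  set t := |Real.log x| with ht
  have h0 : 0 ≤ t := abs_nonneg _
  have h1 : t ^ 4 / 24 ≤ Real.exp t := by
    simpa [Nat.factorial] using Real.pow_div_factorial_le_exp t h0 4
  have h2 : 1 ≤ Real.exp t := Real.one_le_exp h0
  have h3 : Real.exp t ≤ x + x⁻¹ := by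
    rcases abs_choice (Real.log x) with h | h <;> rw [ht, h]
    · rw [Real.exp_log hx]; have := inv_pos.2 hx; linarith
    · rw [Real.exp_neg, Real.exp_log hx]; linarith
  have h4 : Real.log x ^ 2 = t ^ 2 := (sq_abs _).symm
  rw [h4]
  nlinarith [sq_nonneg (t ^ 2 - 1)]

/-! ### Coordinates on momentum space -/

/-- Splitting off the coordinate `0`. -/
def splitEquiv : Space ≃ᵐ ℝ × Transverse :=
  (MeasurableEquiv.toLp 2 (Fin 3 → ℝ)).symm.trans
    ((MeasurableEquiv.piFinSuccAbove (fun _ : Fin 3 => ℝ) 0).trans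
      (MeasurableEquiv.prodCongr (MeasurableEquiv.refl ℝ) (MeasurableEquiv.toLp 2 (Fin 2 → ℝ))))

theorem measurePreserving_splitEquiv : MeasurePreserving splitEquiv volume volume := by
  have h1 := PiLp.volume_preserving_ofLp (Fin 3)
  have h2 := volume_preserving_piFinSuccAbove (fun _ : Fin 3 => ℝ) 0
  have h3 := (MeasurePreserving.id (volume : Measure ℝ)).prod (PiLp.volume_preserving_toLp (Fin 2))
  exact (h3.comp h2).comp h1

theorem splitEquiv_symm_apply (x : ℝ) (k : Transverse) :
    splitEquiv.symm (x, k) = !₂[x, k 0, k 1] := by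
  rw [MeasurableEquiv.symm_apply_eq]
  refine Prod.ext rfl ?_
  ext i
  fin_cases i <;> rfl

/-! ### Integration by parts against Schwartz functions -/

theorem integral_schwartz_mul_lineDeriv (h : 𝓢(Space, ℂ)) {g g' : Space → ℂ} {v : Space}
    (hg : ∀ x, HasLineDerivAt ℝ g (g' x) x v) (hgc : Continuous g) (hgc' : Continuous g')
    {M M' : ℝ} (hM : ∀ x, ‖g x‖ ≤ M) (hM' : ∀ x, ‖g' x‖ ≤ M') :
    ∫ x, h x * g' x = -∫ x, (∂_{v} h : 𝓢(Space, ℂ)) x * g x := by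
  have hb : ∀ (h : 𝓢(Space, ℂ)) {g : Space → ℂ} {M : ℝ}, Continuous g → (∀ x, ‖g x‖ ≤ M) →
      Integrable fun x => h x * g x := fun h g M hg hM =>
    h.integrable.mul_bdd (c := M) hg.aestronglyMeasurable (Eventually.of_forall hM)
  refine integral_bilinear_hasLineDerivAt_right_eq_neg_left_of_integrable (μ := volume)
    (B := ContinuousLinearMap.mul ℝ ℂ) (f := h) (f' := (∂_{v} h : 𝓢(Space, ℂ))) (g := g)
    (g' := g') (v := v) (hb _ hgc hM) (hb _ hgc' hM') (hb _ hgc hM) (fun x _ => ?_)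
    (fun x _ => hg x)
  exact (h.hasFDerivAt x).hasLineDerivAt v

theorem integrable_norm_mul_one_add_sq (h : 𝓢(Space, ℂ)) (a : ℝ) :
    Integrable fun ζ : Space => ‖h ζ‖ * (1 + (a * ζ 0) ^ 2) := by
  have h0 := h.integrable_pow_mul volume 0
  have h2 := (h.integrable_pow_mul volume 2).const_mul (a ^ 2)
  refine (h0.add h2).mono' (by fun_prop) (Eventually.of_forall fun ζ => ?_)
  rw [Real.norm_of_nonneg (by positivity)]
  have : (ζ 0) ^ 2 ≤ ‖ζ‖ ^ 2 := by
    rw [← sq_abs, ← Real.norm_eq_abs]; gcongr; exact PiLp.norm_apply_le ζ 0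
  have h3 : a ^ 2 * (ζ 0) ^ 2 ≤ a ^ 2 * ‖ζ‖ ^ 2 := by gcongr
  simp only [Pi.add_apply, pow_zero, one_mul]
  nlinarith [norm_nonneg (h ζ), mul_le_mul_of_nonneg_left h3 (norm_nonneg (h ζ))]

/-! ### The transform of a profile along the accelerated trajectory -/

/-- The wave `exp(-p e^(aξ)) exp(-i k⊥·x⊥)`. -/
def rindlerWave (a : ℝ) (p : ℂ) (k : Transverse) (ζ : Space) : ℂ :=
  Complex.exp (-(p * Real.exp (a * ζ 0))) *
    Complex.exp (-(Complex.I * ((k 0 * ζ 1 + k 1 * ζ 2 : ℝ) : ℂ)))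

/-- `∫ d³ζ h(ζ) exp(-p e^(aξ)) exp(-i k⊥·x⊥)`. -/
def rindlerTransform (a : ℝ) (h : Space → ℂ) (p : ℂ) (k : Transverse) : ℂ :=
  ∫ ζ, h ζ * rindlerWave a p k ζ

theorem continuous_rindlerWave (a : ℝ) :
    Continuous fun x : (ℂ × Transverse) × Space => rindlerWave a x.1.1 x.1.2 x.2 := by
  unfold rindlerWave; fun_prop

theorem norm_rindlerWave_le (a : ℝ) {p : ℂ} (hp : 0 ≤ p.re) (k : Transverse) (ζ : Space) :
    ‖rindlerWave a p k ζ‖ ≤ 1 := by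
  rw [rindlerWave, norm_mul, Complex.norm_exp, Complex.norm_exp]
  have h1 : (-(p * (Real.exp (a * ζ 0) : ℂ))).re ≤ 0 := by
    rw [Complex.neg_re, Complex.re_mul_ofReal]
    have := mul_nonneg hp (Real.exp_pos (a * ζ 0)).le
    linarith
  have h2 : (-(Complex.I * ((k 0 * ζ 1 + k 1 * ζ 2 : ℝ) : ℂ))).re = 0 := by simp
  rw [h2, Real.exp_zero, mul_one]
  exact Real.exp_le_one_iff.2 h1

theorem norm_one_add_ge {q : ℂ} (hq : 0 ≤ q.re) : √(1 + ‖q‖ ^ 2) ≤ ‖1 + q‖ := by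
  rw [Real.sqrt_le_left (norm_nonneg _), Complex.sq_norm, Complex.sq_norm, Complex.normSq_apply,
    Complex.normSq_apply]
  simp; nlinarith

theorem one_le_norm_one_add {q : ℂ} (hq : 0 ≤ q.re) : 1 ≤ ‖1 + q‖ :=
  le_trans (by rw [Real.one_le_sqrt]; nlinarith [sq_nonneg ‖q‖]) (norm_one_add_ge hq)

theorem one_add_ne_zero {q : ℂ} (hq : 0 ≤ q.re) : 1 + q ≠ 0 := by
  have := one_le_norm_one_add hq
  intro h; rw [h, norm_zero] at this; linarith

/-- With E = exp(-p e^{aξ}) and v = (1 + p e^{aξ})⁻¹ one has ∂_ξ(E v) = -a E (1 - v²), so parts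
expresses ∫ h E through terms that each carry a factor v. Unlike division by p e^{aξ}, this stays
bounded where p e^{aξ} is small. -/
theorem rindlerTransform_eq_by_parts {a : ℝ} (ha : 0 < a) (h : 𝓢(Space, ℂ)) {p : ℂ}
    (hp : 0 ≤ p.re) (k : Transverse) :
    rindlerTransform a h p k = ∫ ζ, (h ζ * ((1 + p * Real.exp (a * ζ 0))⁻¹) ^ 2 +
      (∂_{(EuclideanSpace.single 0 1 : Space)} h : 𝓢(Space, ℂ)) ζ / a *
        (1 + p * Real.exp (a * ζ 0))⁻¹) * rindlerWave a p k ζ := by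
  set e0 : Space := EuclideanSpace.single 0 1 with he0
  set v : Space → ℂ := fun ζ => (1 + p * Real.exp (a * ζ 0))⁻¹ with hv
  have hq : ∀ ζ : Space, 0 ≤ (p * Real.exp (a * ζ 0)).re := fun ζ => by
    rw [Complex.re_mul_ofReal]; exact mul_nonneg hp (Real.exp_pos _).le
  have hne : ∀ ζ : Space, 1 + p * (Real.exp (a * ζ 0) : ℂ) ≠ 0 := fun ζ => one_add_ne_zero (hq ζ)
  have hv1 : ∀ ζ, ‖v ζ‖ ≤ 1 := fun ζ => by
    rw [hv, norm_inv]; exact inv_le_one_of_one_le₀ (one_le_norm_one_add (hq ζ))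
  have hvc : Continuous v := by
    refine Continuous.inv₀ (by fun_prop) hne
  have hWc : Continuous (rindlerWave a p k) := by unfold rindlerWave; fun_prop
  have hW := norm_rindlerWave_le a hp k
  have hcoord : ∀ (x : Space) (t : ℝ), (x + t • e0) 0 = x 0 + t ∧ (x + t • e0) 1 = x 1 ∧
      (x + t • e0) 2 = x 2 := by
    intro x t; simp [he0]
  have hder : ∀ x, HasLineDerivAt ℝ (fun ζ => rindlerWave a p k ζ * v ζ)
      (-a * (rindlerWave a p k x * (1 - v x ^ 2))) x e0 := by
    intro x
    have hexp : HasDerivAt (fun t : ℝ => p * (Real.exp (a * (x 0 + t)) : ℂ))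
        (a * (p * (Real.exp (a * x 0) : ℂ))) 0 := by
      have h1 : HasDerivAt (fun t : ℝ => Real.exp (a * (x 0 + t))) (Real.exp (a * x 0) * a) 0 := by
        have := (((hasDerivAt_id (0 : ℝ)).const_add (x 0)).const_mul a).exp
        simpa using this
      have h2 := (h1.ofReal_comp.const_mul p)
      exact h2.congr_deriv (by push_cast; ring)
    have hE := hexp.neg.cexp
    have hI := (hexp.const_add 1).inv (by simpa using hne x)
    have hP := (hE.mul_const (Complex.exp (-(Complex.I * ((k 0 * x 1 + k 1 * x 2 : ℝ) : ℂ))))).mul hI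
    unfold HasLineDerivAt
    have hfun : (fun t : ℝ => rindlerWave a p k (x + t • e0) * v (x + t • e0)) =
        fun t : ℝ => (Complex.exp (-(p * (Real.exp (a * (x 0 + t)) : ℂ))) *
          Complex.exp (-(Complex.I * ((k 0 * x 1 + k 1 * x 2 : ℝ) : ℂ)))) *
          (1 + p * (Real.exp (a * (x 0 + t)) : ℂ))⁻¹ := by
      ext t
      obtain ⟨c0, c1, c2⟩ := hcoord x t
      simp only [rindlerWave, hv, c0, c1, c2]
    rw [hfun]
    refine hP.congr_deriv ?_
    simp only [rindlerWave, hv, Pi.neg_apply, Pi.inv_apply, add_zero]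
    have := hne x
    field_simp
    ring
  have hb := integral_schwartz_mul_lineDeriv h hder (hWc.mul hvc) (by fun_prop) (M := 1)
    (M' := a * 2) (fun x => ?_) (fun x => ?_)
  rotate_left
  · rw [norm_mul]; exact mul_le_one₀ (hW x) (norm_nonneg _) (hv1 x)
  · rw [norm_mul, norm_mul, norm_neg, Complex.norm_real, Real.norm_of_nonneg ha.le]
    have h1 : ‖1 - v x ^ 2‖ ≤ 2 := by
      refine (norm_sub_le _ _).trans ?_
      rw [norm_one, norm_pow]
      have := pow_le_one₀ (n := 2) (norm_nonneg _) (hv1 x)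
      linarith
    have : ‖rindlerWave a p k x‖ * ‖1 - v x ^ 2‖ ≤ 1 * 2 :=
      mul_le_mul (hW x) h1 (norm_nonneg _) zero_le_one
    nlinarith
  have hi1 : Integrable fun ζ => h ζ * rindlerWave a p k ζ :=
    h.integrable.mul_bdd (c := 1) hWc.aestronglyMeasurable (Eventually.of_forall hW)
  have hi2 : Integrable fun ζ => h ζ * (v ζ ^ 2 * rindlerWave a p k ζ) := by
    refine h.integrable.mul_bdd (c := 1) (by fun_prop) (Eventually.of_forall fun ζ => ?_)
    rw [norm_mul, norm_pow]
    exact mul_le_one₀ (pow_le_one₀ (norm_nonneg _) (hv1 ζ)) (norm_nonneg _) (hW ζ)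
  have hi3 : Integrable fun ζ => (∂_{e0} h : 𝓢(Space, ℂ)) ζ * (rindlerWave a p k ζ * v ζ) := by
    refine (∂_{e0} h : 𝓢(Space, ℂ)).integrable.mul_bdd (c := 1) (by fun_prop)
      (Eventually.of_forall fun ζ => ?_)
    rw [norm_mul]; exact mul_le_one₀ (hW ζ) (norm_nonneg _) (hv1 ζ)
  have ha' : (a : ℂ) ≠ 0 := by exact_mod_cast ha.ne'
  have e1 : ∫ ζ, h ζ * (-a * (rindlerWave a p k ζ * (1 - v ζ ^ 2))) =
      -a * ((∫ ζ, h ζ * rindlerWave a p k ζ) - ∫ ζ, h ζ * (v ζ ^ 2 * rindlerWave a p k ζ)) := by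
    rw [← integral_sub hi1 hi2, ← integral_const_mul]
    congr 1; ext ζ; ring
  have e2 : ∫ ζ, (h ζ * v ζ ^ 2 + (∂_{e0} h : 𝓢(Space, ℂ)) ζ / a * v ζ) * rindlerWave a p k ζ =
      (∫ ζ, h ζ * (v ζ ^ 2 * rindlerWave a p k ζ)) +
        (a : ℂ)⁻¹ * ∫ ζ, (∂_{e0} h : 𝓢(Space, ℂ)) ζ * (rindlerWave a p k ζ * v ζ) := by
    rw [← integral_const_mul, ← integral_add hi2 (hi3.const_mul _)]
    congr 1; ext ζ; ring
  rw [e1] at hb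
  rw [e2, rindlerTransform]
  have := congrArg (fun x => -(a : ℂ)⁻¹ * x) hb
  rw [← mul_assoc, neg_mul_neg, inv_mul_cancel₀ ha', one_mul] at this
  linear_combination this

theorem rindlerTransform_lineDeriv {a : ℝ} (h : 𝓢(Space, ℂ)) {p : ℂ}
    (hp : 0 ≤ p.re) (k : Transverse) (j : Fin 2) :
    rindlerTransform a (∂_{(EuclideanSpace.single j.succ 1 : Space)} h : 𝓢(Space, ℂ)) p k =
      Complex.I * k j * rindlerTransform a h p k := by
  set e : Space := EuclideanSpace.single j.succ 1 with he
  have hWc : Continuous (rindlerWave a p k) := by unfold rindlerWave; fun_prop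
  have hW := norm_rindlerWave_le a hp k
  have hder : ∀ x, HasLineDerivAt ℝ (rindlerWave a p k)
      (-(Complex.I * k j) * rindlerWave a p k x) x e := by
    intro x
    have h1 : HasDerivAt (fun t : ℝ => ((k 0 * x 1 + k 1 * x 2 + k j * t : ℝ) : ℂ)) (k j : ℂ) 0 := by
      have := (((hasDerivAt_id (0 : ℝ)).const_mul (k j)).const_add (k 0 * x 1 + k 1 * x 2))
      simpa using this.ofReal_comp
    have h2 := ((h1.const_mul Complex.I).neg.cexp).const_mul
      (Complex.exp (-(p * (Real.exp (a * x 0) : ℂ))))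
    unfold HasLineDerivAt
    have hfun : (fun t : ℝ => rindlerWave a p k (x + t • e)) = fun t : ℝ =>
        Complex.exp (-(p * (Real.exp (a * x 0) : ℂ))) *
          Complex.exp (-(Complex.I * ((k 0 * x 1 + k 1 * x 2 + k j * t : ℝ) : ℂ))) := by
      ext t
      fin_cases j <;> simp [rindlerWave, he] <;> ring_nf
    rw [hfun]
    refine h2.congr_deriv ?_
    simp only [rindlerWave, Pi.neg_apply, mul_zero, add_zero]
    ring
  have hb := integral_schwartz_mul_lineDeriv h hder hWc (by fun_prop) (M := 1)
    (M' := ‖-(Complex.I * (k j : ℂ))‖) hW (fun x => ?_)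
  rotate_left
  · rw [norm_mul]; exact mul_le_of_le_one_right (norm_nonneg _) (hW x)
  unfold rindlerTransform
  rw [← neg_eq_iff_eq_neg] at hb
  rw [← hb, ← integral_const_mul, ← integral_neg]
  congr 1; ext ζ; ring

/-- `h - ∂_y² h - ∂_z² h`. -/
def transverseResolvent (h : 𝓢(Space, ℂ)) : 𝓢(Space, ℂ) :=
  h - ∂_{(EuclideanSpace.single (Fin.succ 0) 1 : Space)}
      (∂_{(EuclideanSpace.single (Fin.succ 0) 1 : Space)} h) -
    ∂_{(EuclideanSpace.single (Fin.succ 1) 1 : Space)}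
      (∂_{(EuclideanSpace.single (Fin.succ 1) 1 : Space)} h)

/-- Each transverse derivative produces a factor i k_j. This is the source of decay in k⊥: the bound
for the resolvent of `h` is divided by 1 + |k|². -/
theorem rindlerTransform_transverseResolvent {a : ℝ} (h : 𝓢(Space, ℂ)) {p : ℂ}
    (hp : 0 ≤ p.re) (k : Transverse) :
    rindlerTransform a (transverseResolvent h) p k =
      ((1 + ‖k‖ ^ 2 : ℝ) : ℂ) * rindlerTransform a h p k := by
  have hWc : Continuous (rindlerWave a p k) := by unfold rindlerWave; fun_prop
  have hi : ∀ h : 𝓢(Space, ℂ), Integrable fun ζ => h ζ * rindlerWave a p k ζ := fun h =>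
    h.integrable.mul_bdd (c := 1) hWc.aestronglyMeasurable
      (Eventually.of_forall (norm_rindlerWave_le a hp k))
  have hsub : ∀ h g : 𝓢(Space, ℂ), rindlerTransform a (h - g : 𝓢(Space, ℂ)) p k =
      rindlerTransform a h p k - rindlerTransform a g p k := by
    intro h g
    unfold rindlerTransform
    rw [← integral_sub (hi h) (hi g)]
    congr 1; ext ζ; simp [sub_mul]
  rw [transverseResolvent, hsub, hsub, rindlerTransform_lineDeriv _ hp,
    rindlerTransform_lineDeriv _ hp, rindlerTransform_lineDeriv _ hp,
    rindlerTransform_lineDeriv _ hp, EuclideanSpace.norm_sq_eq, Fin.sum_univ_two]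
  simp only [Real.norm_eq_abs, sq_abs]
  push_cast
  linear_combination ((k 0 : ℂ) ^ 2 + (k 1 : ℂ) ^ 2) * rindlerTransform a h p k * -Complex.I_sq

/-- A bound for `rindlerTransform`, see `norm_rindlerTransform_le`. -/
def rindlerBound (a : ℝ) (h : 𝓢(Space, ℂ)) : ℝ :=
  16 * ∫ ζ, (‖h ζ‖ * (1 + (a * ζ 0) ^ 2) +
    a⁻¹ * (‖(∂_{(EuclideanSpace.single 0 1 : Space)} h : 𝓢(Space, ℂ)) ζ‖ * (1 + (a * ζ 0) ^ 2)))

theorem log_mul_exp_bound {x : ℝ} (hx : 0 < x) (y : ℝ) :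
    1 + Real.log (x * Real.exp y) ^ 2 ≤ 2 * ((1 + Real.log x ^ 2) * (1 + y ^ 2)) := by
  rw [Real.log_mul hx.ne' (Real.exp_pos _).ne', Real.log_exp]
  nlinarith [sq_nonneg (Real.log x - y), mul_nonneg (sq_nonneg (Real.log x)) (sq_nonneg y)]

/-- The bound is uniform over Re p ≥ 0 with |p| ≥ x|sinh θ|, so it serves all contours of the later
shift at once, including the imaginary axis, where the wave merely oscillates. -/
theorem norm_rindlerTransform_le {a : ℝ} (ha : 0 < a) (h : 𝓢(Space, ℂ)) {p : ℂ}
    (hp : 0 ≤ p.re) {x θ : ℝ} (hx : 0 < x) (hpx : x * |Real.sinh θ| ≤ ‖p‖) (k : Transverse) :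
    ‖rindlerTransform a h p k‖ ≤ rindlerBound a h * (1 + Real.log x ^ 2) / (1 + θ ^ 2) := by
  rw [rindlerTransform_eq_by_parts ha h hp k]
  set dh : 𝓢(Space, ℂ) := ∂_{(EuclideanSpace.single 0 1 : Space)} h
  have hmaj : Integrable fun ζ : Space => ‖h ζ‖ * (1 + (a * ζ 0) ^ 2) +
      a⁻¹ * (‖dh ζ‖ * (1 + (a * ζ 0) ^ 2)) :=
    (integrable_norm_mul_one_add_sq h a).add ((integrable_norm_mul_one_add_sq dh a).const_mul _)
  have hpt : ∀ ζ : Space, ‖(h ζ * ((1 + p * Real.exp (a * ζ 0))⁻¹) ^ 2 +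
      dh ζ / a * (1 + p * Real.exp (a * ζ 0))⁻¹) * rindlerWave a p k ζ‖ ≤
      16 * (1 + Real.log x ^ 2) / (1 + θ ^ 2) * (‖h ζ‖ * (1 + (a * ζ 0) ^ 2) +
      a⁻¹ * (‖dh ζ‖ * (1 + (a * ζ 0) ^ 2))) := by
    intro ζ
    have hq : 0 ≤ (p * (Real.exp (a * ζ 0) : ℂ)).re := by
      rw [Complex.re_mul_ofReal]; exact mul_nonneg hp (Real.exp_pos _).le
    set v := (1 + p * (Real.exp (a * ζ 0) : ℂ))⁻¹ with hv
    have hv1 : ‖v‖ ≤ 1 := by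
      rw [hv, norm_inv]; exact inv_le_one_of_one_le₀ (one_le_norm_one_add hq)
    -- The sinh bound is used at scale x e^{aξ}, and its logarithm is then split between x and ξ;
    -- the split doubles 8 to 16.
    have hv2 : ‖v‖ ≤ 16 * (1 + Real.log x ^ 2) / (1 + θ ^ 2) * (1 + (a * ζ 0) ^ 2) := by
      have hz : 0 < x * Real.exp (a * ζ 0) := mul_pos hx (Real.exp_pos _)
      calc ‖v‖ ≤ (√(1 + ‖p * (Real.exp (a * ζ 0) : ℂ)‖ ^ 2))⁻¹ := by
            rw [hv, norm_inv]; exact inv_anti₀ (by positivity) (norm_one_add_ge hq)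
        _ ≤ (√(1 + (x * Real.exp (a * ζ 0) * Real.sinh θ) ^ 2))⁻¹ := by
            refine inv_anti₀ (by positivity) (Real.sqrt_le_sqrt ?_)
            rw [← sq_abs (x * Real.exp (a * ζ 0) * Real.sinh θ), norm_mul, Complex.norm_real,
              Real.norm_of_nonneg (Real.exp_pos _).le, abs_mul, abs_of_pos hz]
            have : x * Real.exp (a * ζ 0) * |Real.sinh θ| ≤ ‖p‖ * Real.exp (a * ζ 0) := by
              calc _ = x * |Real.sinh θ| * Real.exp (a * ζ 0) := by ring
                _ ≤ _ := by gcongr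
            gcongr
        _ ≤ 8 * (1 + Real.log (x * Real.exp (a * ζ 0)) ^ 2) / (1 + θ ^ 2) := inv_sqrt_sinh_le hz θ
        _ ≤ 8 * (2 * ((1 + Real.log x ^ 2) * (1 + (a * ζ 0) ^ 2))) / (1 + θ ^ 2) := by
            gcongr; exact log_mul_exp_bound hx _
        _ = _ := by ring
    calc _ ≤ ‖h ζ * v ^ 2 + dh ζ / a * v‖ * 1 := by
          rw [norm_mul]; gcongr; exact norm_rindlerWave_le a hp k ζ
      _ ≤ ‖h ζ‖ * ‖v‖ + a⁻¹ * (‖dh ζ‖ * ‖v‖) := by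
          rw [mul_one]
          refine (norm_add_le _ _).trans (add_le_add ?_ ?_)
          · rw [norm_mul, norm_pow]
            gcongr
            nlinarith [norm_nonneg v]
          · rw [norm_mul, norm_div, Complex.norm_real, Real.norm_of_nonneg ha.le]
            exact le_of_eq (by ring)
      _ ≤ ‖h ζ‖ * (16 * (1 + Real.log x ^ 2) / (1 + θ ^ 2) * (1 + (a * ζ 0) ^ 2)) +
          a⁻¹ * (‖dh ζ‖ * (16 * (1 + Real.log x ^ 2) / (1 + θ ^ 2) * (1 + (a * ζ 0) ^ 2))) := by
          gcongr
      _ = _ := by ring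
  refine (norm_integral_le_of_norm_le (hmaj.const_mul _) (Eventually.of_forall hpt)).trans
    (le_of_eq ?_)
  rw [integral_const_mul, rindlerBound]
  ring

theorem norm_rindlerTransform_le_decay {a : ℝ} (ha : 0 < a) (h : 𝓢(Space, ℂ)) {p : ℂ}
    (hp : 0 ≤ p.re) {x θ : ℝ} (hx : 0 < x) (hpx : x * |Real.sinh θ| ≤ ‖p‖) (k : Transverse) :
    ‖rindlerTransform a h p k‖ ≤ rindlerBound a (transverseResolvent h) *
      ((1 + Real.log x ^ 2) / (1 + ‖k‖ ^ 2)) / (1 + θ ^ 2) := by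
  have h1 := norm_rindlerTransform_le ha (transverseResolvent h) hp hx hpx k
  rw [rindlerTransform_transverseResolvent h hp k, norm_mul, Complex.norm_real,
    Real.norm_of_nonneg (by positivity)] at h1
  rw [mul_div_assoc', div_right_comm, le_div_iff₀ (by positivity), mul_comm]
  exact h1

/-! ### Shifting the contour -/

/-- Cauchy's theorem on the rectangles [-T, T] × [y₀, y₁]: the common majorant `g` makes the
horizontal sides converge and the vertical sides vanish. -/
theorem integral_horizontal_eq {f : ℂ → ℂ} (hf : Differentiable ℂ f) {y₀ y₁ : ℝ} (hy : y₀ ≤ y₁)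
    {g : ℝ → ℝ} (hg : Integrable g) (hfg : ∀ x : ℝ, ∀ y ∈ Icc y₀ y₁, ‖f (x + y * Complex.I)‖ ≤ g x)
    (htop : Tendsto g atTop (𝓝 0)) (hbot : Tendsto g atBot (𝓝 0)) :
    ∫ x : ℝ, f (x + y₀ * Complex.I) = ∫ x : ℝ, f (x + y₁ * Complex.I) := by
  have hfc := hf.continuous
  have hint : ∀ y ∈ Icc y₀ y₁, Integrable fun x : ℝ => f (x + y * Complex.I) := fun y hy' =>
    hg.mono' (by fun_prop) (Eventually.of_forall fun x => hfg x y hy')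
  have hlim : ∀ y ∈ Icc y₀ y₁, Tendsto (fun T : ℝ => ∫ x in -T..T, f (x + y * Complex.I)) atTop
      (𝓝 (∫ x : ℝ, f (x + y * Complex.I))) := fun y hy' =>
    intervalIntegral_tendsto_integral (hint y hy') tendsto_neg_atTop_atBot tendsto_id
  have hside : ∀ u : ℝ → ℝ, Tendsto (fun T => g (u T)) atTop (𝓝 0) →
      Tendsto (fun T : ℝ => ∫ y in y₀..y₁, f (u T + y * Complex.I)) atTop (𝓝 0) := by
    intro u hu
    refine squeeze_zero_norm (a := fun T => g (u T) * |y₁ - y₀|) (fun T => ?_) ?_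
    · refine intervalIntegral.norm_integral_le_of_norm_le_const fun y hy' => hfg _ _ ?_
      rw [uIoc_of_le hy] at hy'
      exact Ioc_subset_Icc_self hy'
    · simpa using hu.mul_const |y₁ - y₀|
  have hr := (hside (fun T => T) htop).const_smul Complex.I
  have hl := (hside (fun T => -T) (hbot.comp tendsto_neg_atTop_atBot)).const_smul Complex.I
  have hsum := (((hlim y₀ ⟨le_rfl, hy⟩).sub (hlim y₁ ⟨hy, le_rfl⟩)).add hr).sub hl
  have hzero : ∀ T : ℝ, ((((∫ x in -T..T, f (x + y₀ * Complex.I)) -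
      ∫ x in -T..T, f (x + y₁ * Complex.I)) +
      Complex.I • ∫ y in y₀..y₁, f ((T : ℝ) + y * Complex.I)) -
      Complex.I • ∫ y in y₀..y₁, f ((-T : ℝ) + y * Complex.I)) = 0 := by
    intro T
    have := Complex.integral_boundary_rect_eq_zero_of_differentiableOn f ⟨-T, y₀⟩ ⟨T, y₁⟩
      hf.differentiableOn
    simpa using this
  have := tendsto_nhds_unique (hsum.congr hzero) tendsto_const_nhds
  simpa [sub_eq_zero] using this

/-! ### The Macdonald function -/

theorem integrable_inv_one_add_sq_mul (C : ℝ) : Integrable fun θ : ℝ => C / (1 + θ ^ 2) := by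
  simpa [div_eq_mul_inv] using integrable_inv_one_add_sq.const_mul C

theorem tendsto_div_one_add_sq (C : ℝ) {l : Filter ℝ}
    (hl : Tendsto (fun θ : ℝ => θ ^ 2) l atTop) :
    Tendsto (fun θ : ℝ => C / (1 + θ ^ 2)) l (𝓝 0) :=
  tendsto_const_nhds.div_atTop (tendsto_atTop_add_const_left _ _ hl)

/-- `i x sinh(θ - iε)`. -/
def rapidityPhase (x ε θ : ℝ) : ℂ :=
  ((x * (Real.cosh θ * Real.sin ε) : ℝ) : ℂ) +
    Complex.I * ((x * (Real.sinh θ * Real.cos ε) : ℝ) : ℂ)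

theorem rapidityPhase_eq (x ε θ : ℝ) :
    rapidityPhase x ε θ = Complex.I * x * Complex.sinh (θ + (-ε : ℝ) * Complex.I) := by
  rw [Complex.sinh_add, Complex.sinh_mul_I, Complex.cosh_mul_I, rapidityPhase]
  push_cast
  rw [Complex.sin_neg, Complex.cos_neg]
  linear_combination (-(x * (Complex.cosh θ * Complex.sin ε)) : ℂ) * -Complex.I_sq

theorem rapidityPhase_re (x ε θ : ℝ) : (rapidityPhase x ε θ).re = x * (Real.cosh θ * Real.sin ε) := by
  simp [rapidityPhase, Complex.add_re, Complex.mul_re, -Complex.ofReal_mul]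

theorem rapidityPhase_im (x ε θ : ℝ) : (rapidityPhase x ε θ).im = x * (Real.sinh θ * Real.cos ε) := by
  simp [rapidityPhase, Complex.add_im, Complex.mul_im, -Complex.ofReal_mul]

theorem rapidityPhase_re_nonneg {x ε : ℝ} (hx : 0 < x) (h0 : 0 ≤ ε) (h1 : ε ≤ Real.pi / 2) (θ : ℝ) :
    0 ≤ (rapidityPhase x ε θ).re := by
  rw [rapidityPhase_re]
  have := Real.sin_nonneg_of_nonneg_of_le_pi h0 (by linarith [Real.pi_pos])
  have := Real.cosh_pos θ
  positivity

/-- |sinh(θ - iε)|² = sinh²θ + sin²ε. -/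
theorem mul_abs_sinh_le_norm_rapidityPhase (x ε θ : ℝ) :
    x * |Real.sinh θ| ≤ ‖rapidityPhase x ε θ‖ := by
  refine le_of_sq_le_sq ?_ (norm_nonneg _)
  rw [Complex.sq_norm, Complex.normSq_apply, rapidityPhase_re, rapidityPhase_im, mul_pow, sq_abs]
  have h1 := Real.cosh_sq θ
  have h2 := Real.sin_sq_add_cos_sq ε
  have : x * (Real.cosh θ * Real.sin ε) * (x * (Real.cosh θ * Real.sin ε)) +
      x * (Real.sinh θ * Real.cos ε) * (x * (Real.sinh θ * Real.cos ε)) =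
      x ^ 2 * Real.sinh θ ^ 2 + x ^ 2 * Real.sin ε ^ 2 := by
    linear_combination x ^ 2 * Real.sin ε ^ 2 * h1 + x ^ 2 * Real.sinh θ ^ 2 * h2
  rw [this]
  nlinarith [sq_nonneg (x * Real.sin ε)]

theorem norm_exp_neg_rapidityPhase (z ε θ : ℝ) :
    ‖Complex.exp (-rapidityPhase z ε θ)‖ = Real.exp (-(z * Real.sin ε * Real.cosh θ)) := by
  rw [Complex.norm_exp, Complex.neg_re, rapidityPhase_re]
  ring_nf

theorem norm_exp_mellin (ν ε θ : ℝ) :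
    ‖Complex.exp (-(Complex.I * ν * (θ + (-ε : ℝ) * Complex.I)))‖ = Real.exp (-(ν * ε)) := by
  rw [Complex.norm_exp]
  simp

/-- At Im θ = -π/2 the phase is z cosh θ and the exponential contributes e^{-πν/2}; what is left is
twice the half-line integral of K_{iν}. For Im θ = -ε the integrand decays like exp(-z sin ε cosh
θ), hence the restriction to ε > 0. -/
theorem integral_exp_rapidityPhase_eq {z : ℝ} (hz : 0 < z) (ν : ℝ) {ε : ℝ} (h0 : 0 < ε)
    (h1 : ε ≤ Real.pi / 2) :
    ∫ θ : ℝ, Complex.exp (-(Complex.I * ν * (θ + (-ε : ℝ) * Complex.I))) *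
        Complex.exp (-rapidityPhase z ε θ) =
      2 * Real.exp (-(Real.pi * ν / 2)) * besselK (Complex.I * ν) z := by
  have hsin : 0 < Real.sin ε := Real.sin_pos_of_pos_of_lt_pi h0 (by linarith [Real.pi_pos])
  set f : ℂ → ℂ := fun w =>
    Complex.exp (-(Complex.I * ν * w)) * Complex.exp (-(Complex.I * z * Complex.sinh w)) with hf
  set C : ℝ := Real.exp (|ν| * Real.pi) * (8 * (1 + Real.log (z * Real.sin ε) ^ 2)) with hC
  have hshift := integral_horizontal_eq (f := f) (y₀ := -(Real.pi / 2)) (y₁ := -ε)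
    (g := fun θ => C / (1 + θ ^ 2)) (by fun_prop) (by linarith) (integrable_inv_one_add_sq_mul C)
    ?_ (tendsto_div_one_add_sq C (tendsto_pow_atTop two_ne_zero))
    (tendsto_div_one_add_sq C (by simpa [Function.comp_def] using (tendsto_pow_atTop (α := ℝ) two_ne_zero).comp tendsto_abs_atBot_atTop))
  · have e1 : ∀ θ : ℝ, f (θ + (-ε : ℝ) * Complex.I) =
        Complex.exp (-(Complex.I * ν * (θ + (-ε : ℝ) * Complex.I))) *
        Complex.exp (-rapidityPhase z ε θ) := fun θ => by rw [rapidityPhase_eq]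
    have e2 : ∀ θ : ℝ, f (θ + (-(Real.pi / 2) : ℝ) * Complex.I) =
        Real.exp (-(Real.pi * ν / 2)) * (Complex.exp (-(Complex.I * ν * θ)) *
          (Real.exp (-(z * Real.cosh θ)) : ℂ)) := fun θ => by
      rw [hf]
      simp only
      rw [← rapidityPhase_eq, rapidityPhase]
      simp only [Real.sin_pi_div_two, Real.cos_pi_div_two, mul_one, mul_zero, Complex.ofReal_zero,
        add_zero]
      rw [Complex.ofReal_exp, Complex.ofReal_exp, ← Complex.exp_add, ← Complex.exp_add,
        ← Complex.exp_add]
      congr 1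
      push_cast
      linear_combination (ν * (Real.pi / 2) : ℂ) * Complex.I_sq
    simp_rw [e1, e2] at hshift
    rw [← hshift, integral_const_mul]
    have hF : Integrable fun θ : ℝ => Complex.exp (-(Complex.I * ν * θ)) *
        (Real.exp (-(z * Real.cosh θ)) : ℂ) := by
      refine (integrable_inv_one_add_sq_mul (8 * (1 + Real.log z ^ 2))).mono' (by fun_prop)
        (Eventually.of_forall fun θ => ?_)
      rw [norm_mul, Complex.norm_exp, Complex.norm_real, Real.norm_of_nonneg (Real.exp_pos _).le]
      simpa using exp_neg_mul_cosh_le hz θ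
    have hK : ∫ θ : ℝ, Complex.exp (-(Complex.I * ν * θ)) * (Real.exp (-(z * Real.cosh θ)) : ℂ) =
        2 * besselK (Complex.I * ν) z := by
      have hF' : Integrable fun θ : ℝ => Complex.exp (Complex.I * ν * θ) *
          (Real.exp (-(z * Real.cosh θ)) : ℂ) := by
        have := hF.comp_neg
        simpa using this
      -- Folding the line at 0 combines the two exponentials into a hyperbolic cosine.
      rw [← intervalIntegral.integral_Iic_add_Ioi (b := 0) hF.integrableOn hF.integrableOn,
        ← neg_zero, ← integral_comp_neg_Ioi, neg_zero, besselK, ← integral_const_mul,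
        ← integral_add]
      · refine setIntegral_congr_fun measurableSet_Ioi fun t _ => ?_
        simp only [Real.cosh_neg, Complex.ofReal_neg, mul_neg, neg_neg, neg_mul, Complex.cosh]
        ring
      · simpa [IntegrableOn] using hF'.integrableOn (s := Ioi 0)
      · exact hF.integrableOn
    rw [hK]
    ring
  · intro θ y hy
    have hre : f (θ + y * Complex.I) = Complex.exp (-(Complex.I * ν * (θ + (-(-y) : ℝ) * Complex.I))) *
        Complex.exp (-rapidityPhase z (-y) θ) := by rw [rapidityPhase_eq, neg_neg]
    rw [hre, norm_mul, norm_exp_mellin, norm_exp_neg_rapidityPhase, hC, mul_div_assoc]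
    have hs : Real.sin ε ≤ Real.sin (-y) :=
      Real.sin_le_sin_of_le_of_le_pi_div_two (by linarith [Real.pi_pos]) (by linarith [hy.1])
        (by linarith [hy.2])
    refine mul_le_mul ?_ ((Real.exp_le_exp.2 ?_).trans
      (exp_neg_mul_cosh_le (mul_pos hz hsin) θ)) (Real.exp_pos _).le (Real.exp_pos _).le
    · refine Real.exp_le_exp.2 ?_
      have h3 : |y| ≤ Real.pi := by
        rw [abs_le]; constructor <;> linarith [hy.1, hy.2, Real.pi_pos]
      calc -(ν * -y) = ν * y := by ring
        _ ≤ |ν * y| := le_abs_self _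
        _ = |ν| * |y| := abs_mul _ _
        _ ≤ _ := by gcongr
    · have := Real.cosh_pos θ
      gcongr

/-! ### The Fourier transform in the rapidity -/

/-- Continuity holds up to the boundary Re p = 0, which is where the limit ε → 0 ends. -/
theorem continuousOn_rindlerTransform (a : ℝ) (h : 𝓢(Space, ℂ)) :
    ContinuousOn (fun x : ℂ × Transverse => rindlerTransform a h x.1 x.2) {x | 0 ≤ x.1.re} := by
  refine continuousOn_of_dominated (bound := fun ζ => ‖h ζ‖) (fun x hx => ?_) (fun x hx => ?_)
    h.integrable.norm (Eventually.of_forall fun ζ => ?_)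
  · have : Continuous (rindlerWave a x.1 x.2) := by unfold rindlerWave; fun_prop
    exact (h.continuous.mul this).aestronglyMeasurable
  · refine Eventually.of_forall fun ζ => ?_
    rw [norm_mul]
    exact mul_le_of_le_one_right (norm_nonneg _) (norm_rindlerWave_le a hx _ ζ)
  · have : Continuous fun x : ℂ × Transverse => rindlerWave a x.1 x.2 ζ := by
      unfold rindlerWave; fun_prop
    exact (continuous_const.mul this).continuousOn

theorem continuousOn_rindlerTransform_comp {α : Type*} [TopologicalSpace α] (a : ℝ)
    (h : 𝓢(Space, ℂ)) {p : α → ℂ} {k : α → Transverse} {s : Set α} (hp : Continuous p)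
    (hk : Continuous k) (hre : ∀ y ∈ s, 0 ≤ (p y).re) :
    ContinuousOn (fun y => rindlerTransform a h (p y) (k y)) s := by
  have h1 := continuousOn_rindlerTransform a h
  have h2 : ContinuousOn (fun y => (p y, k y)) s := (hp.prodMk hk).continuousOn
  have hmaps : MapsTo (fun y => (p y, k y)) s {x : ℂ × Transverse | 0 ≤ x.1.re} := hre
  have := h1.comp h2 hmaps
  exact this

/-- The integrand of `rindlerWindow`, with conjugate transverse phase. -/
def besselWave (a x ν : ℝ) (k : Transverse) (ζ : Space) : ℂ :=
  besselK (Complex.I * ν) (x * Real.exp (a * ζ 0)) *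
    Complex.exp (-(Complex.I * ((k 0 * ζ 1 + k 1 * ζ 2 : ℝ) : ℂ)))

theorem continuous_rapidityPhase (x : ℝ) :
    Continuous fun y : ℝ × ℝ => rapidityPhase x y.1 y.2 := by
  unfold rapidityPhase
  have := Real.continuous_sinh
  have := Real.continuous_cosh
  fun_prop

theorem rindlerWave_rapidityPhase (a x ε θ : ℝ) (k : Transverse) (ζ : Space) :
    rindlerWave a (rapidityPhase x ε θ) k ζ =
      Complex.exp (-rapidityPhase (x * Real.exp (a * ζ 0)) ε θ) *
        Complex.exp (-(Complex.I * ((k 0 * ζ 1 + k 1 * ζ 2 : ℝ) : ℂ))) := by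
  rw [rindlerWave]
  congr 2
  rw [rapidityPhase, rapidityPhase]
  push_cast
  ring

theorem norm_rindlerWave_rapidityPhase (a x ε θ : ℝ) (k : Transverse) (ζ : Space) :
    ‖rindlerWave a (rapidityPhase x ε θ) k ζ‖ =
      Real.exp (-(x * Real.exp (a * ζ 0) * Real.sin ε * Real.cosh θ)) := by
  rw [rindlerWave_rapidityPhase, norm_mul, norm_exp_neg_rapidityPhase, Complex.norm_exp]
  simp

/-- For ε > 0 the wave decays in θ at scale x e^{aξ} sin ε; the resulting quadratic growth in ξ is
absorbed by the Schwartz function. -/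
theorem integrable_rapidity_prod {a : ℝ} (h : 𝓢(Space, ℂ)) {x : ℝ} (hx : 0 < x)
    (ν : ℝ) (k : Transverse) {ε : ℝ} (h0 : 0 < ε) (h1 : ε ≤ Real.pi / 2) :
    Integrable (fun y : ℝ × Space =>
      Complex.exp (-(Complex.I * ν * (y.1 + (-ε : ℝ) * Complex.I))) *
        (h y.2 * rindlerWave a (rapidityPhase x ε y.1) k y.2)) (volume.prod volume) := by
  have hsin : 0 < Real.sin ε := Real.sin_pos_of_pos_of_lt_pi h0 (by linarith [Real.pi_pos])
  set C : ℝ := Real.exp (-(ν * ε)) * (16 * (1 + Real.log (x * Real.sin ε) ^ 2)) with hC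
  refine ((integrable_inv_one_add_sq_mul C).mul_prod
    (integrable_norm_mul_one_add_sq h a)).mono' ?_ (Eventually.of_forall fun y => ?_)
  · have hw : Continuous fun y : ℝ × Space => rindlerWave a (rapidityPhase x ε y.1) k y.2 := by
      have := continuous_rapidityPhase x
      have h2 : Continuous fun y : ℝ × Space => rapidityPhase x ε y.1 :=
        this.comp (continuous_const.prodMk continuous_fst)
      exact (continuous_rindlerWave a).comp ((h2.prodMk continuous_const).prodMk continuous_snd)
    have hh := h.continuous
    exact Continuous.aestronglyMeasurable (by fun_prop)
  · obtain ⟨θ, ζ⟩ := y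
    have hz : 0 < x * Real.exp (a * ζ 0) * Real.sin ε := by positivity
    have e1 := exp_neg_mul_cosh_le hz θ
    have e2 := log_mul_exp_bound (mul_pos hx hsin) (a * ζ 0)
    rw [show x * Real.sin ε * Real.exp (a * ζ 0) = x * Real.exp (a * ζ 0) * Real.sin ε by ring]
      at e2
    rw [norm_mul, norm_mul, norm_exp_mellin, norm_rindlerWave_rapidityPhase]
    calc _ ≤ Real.exp (-(ν * ε)) * (‖h ζ‖ * (8 * (2 * ((1 + Real.log (x * Real.sin ε) ^ 2) *
          (1 + (a * ζ 0) ^ 2))) / (1 + θ ^ 2))) := by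
          gcongr
          exact e1.trans (by gcongr)
      _ = _ := by rw [hC]; ring

theorem integral_rapidity_prod {a : ℝ} (h : 𝓢(Space, ℂ)) {x : ℝ} (hx : 0 < x)
    (ν : ℝ) (k : Transverse) {ε : ℝ} (h0 : 0 < ε) (h1 : ε ≤ Real.pi / 2) (ζ : Space) :
    ∫ θ : ℝ, Complex.exp (-(Complex.I * ν * (θ + (-ε : ℝ) * Complex.I))) *
        (h ζ * rindlerWave a (rapidityPhase x ε θ) k ζ) =
      2 * Real.exp (-(Real.pi * ν / 2)) * (h ζ * besselWave a x ν k ζ) := by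
  have hz : 0 < x * Real.exp (a * ζ 0) := by positivity
  have := integral_exp_rapidityPhase_eq hz ν h0 h1
  simp_rw [rindlerWave_rapidityPhase]
  rw [besselWave, mul_left_comm, ← mul_assoc (2 * _ : ℂ), ← this, ← integral_mul_const,
    ← integral_const_mul]
  congr 1; ext θ; ring

/-- A marginal of the product integrability at ε = π/2, divided by the nonzero prefactor; no
estimate of K itself is needed. -/
theorem integrable_mul_besselWave {a : ℝ} (h : 𝓢(Space, ℂ)) {x : ℝ} (hx : 0 < x)
    (ν : ℝ) (k : Transverse) : Integrable fun ζ => h ζ * besselWave a x ν k ζ := by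
  have h1 := (integrable_rapidity_prod (a := a) h hx ν k (ε := Real.pi / 2)
    (by linarith [Real.pi_pos]) le_rfl).integral_prod_right
  simp only [integral_rapidity_prod h hx ν k (ε := Real.pi / 2)
    (by linarith [Real.pi_pos]) le_rfl] at h1
  have h2 := h1.const_mul (2 * Real.exp (-(Real.pi * ν / 2)) : ℂ)⁻¹
  refine h2.congr (Eventually.of_forall fun ζ => ?_)
  have : (2 * Real.exp (-(Real.pi * ν / 2)) : ℂ) ≠ 0 := by
    refine mul_ne_zero two_ne_zero ?_
    exact_mod_cast (Real.exp_pos _).ne'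
  simp only
  rw [inv_mul_cancel_left₀ this]

theorem integral_rindlerTransform_shift {a : ℝ} (h : 𝓢(Space, ℂ)) {x : ℝ} (hx : 0 < x)
    (ν : ℝ) (k : Transverse) {ε : ℝ} (h0 : 0 < ε) (h1 : ε ≤ Real.pi / 2) :
    ∫ θ : ℝ, Complex.exp (-(Complex.I * ν * (θ + (-ε : ℝ) * Complex.I))) *
        rindlerTransform a h (rapidityPhase x ε θ) k =
      2 * Real.exp (-(Real.pi * ν / 2)) * ∫ ζ, h ζ * besselWave a x ν k ζ := by
  unfold rindlerTransform
  simp_rw [← integral_const_mul]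
  rw [integral_integral_swap (integrable_rapidity_prod (a := a) h hx ν k h0 h1)]
  simp_rw [integral_rapidity_prod h hx ν k h0 h1]

/-- At ε = 0 the wave has modulus one and the θ and ζ integrals cannot be exchanged absolutely. For
ε > 0 they can, with a value that does not depend on ε, and the bound from integration by parts
dominates the limit ε → 0. -/
theorem integral_rindlerTransform_eq {a : ℝ} (ha : 0 < a) (h : 𝓢(Space, ℂ)) {x : ℝ} (hx : 0 < x)
    (ν : ℝ) (k : Transverse) :
    ∫ θ : ℝ, Complex.exp (-(Complex.I * ν * θ)) *
        rindlerTransform a h (rapidityPhase x 0 θ) k =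
      2 * Real.exp (-(Real.pi * ν / 2)) * ∫ ζ, h ζ * besselWave a x ν k ζ := by
  set F : ℝ → ℝ → ℂ := fun ε θ => Complex.exp (-(Complex.I * ν * (θ + (-ε : ℝ) * Complex.I))) *
        rindlerTransform a h (rapidityPhase x ε θ) k with hF
  have hmem : ∀ ε ∈ Ioc 0 (Real.pi / 2), ∀ θ, 0 ≤ (rapidityPhase x ε θ).re := fun ε hε θ =>
    rapidityPhase_re_nonneg hx hε.1.le hε.2 θ
  have hcont : ∀ θ, ContinuousOn (fun ε => F ε θ) (Icc 0 (Real.pi / 2)) := by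
    intro θ
    refine ContinuousOn.mul (by fun_prop) ?_
    exact continuousOn_rindlerTransform_comp a h
      ((continuous_rapidityPhase x).comp (continuous_id.prodMk continuous_const)) continuous_const
      fun ε hε => rapidityPhase_re_nonneg hx hε.1 hε.2 θ
  have hev : ∀ᶠ ε in 𝓝[>] (0 : ℝ), ε ∈ Ioc 0 (Real.pi / 2) :=
    Ioc_mem_nhdsGT (by linarith [Real.pi_pos])
  have hmeas : ∀ ε ∈ Ioc 0 (Real.pi / 2), Continuous (F ε) := by
    intro ε hε
    refine Continuous.mul (by fun_prop) ?_
    rw [← continuousOn_univ]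
    exact continuousOn_rindlerTransform_comp a h
      ((continuous_rapidityPhase x).comp (continuous_const.prodMk continuous_id)) continuous_const
      fun θ _ => hmem ε hε θ
  set C : ℝ := Real.exp (|ν| * Real.pi) * (rindlerBound a h * (1 + Real.log x ^ 2)) with hC
  have hlim : Tendsto (fun ε => ∫ θ, F ε θ) (𝓝[>] 0) (𝓝 (∫ θ, F 0 θ)) := by
    refine tendsto_integral_filter_of_dominated_convergence (fun θ => C / (1 + θ ^ 2)) ?_ ?_
      (integrable_inv_one_add_sq_mul C) (Eventually.of_forall fun θ => ?_)
    · filter_upwards [hev] with ε hε using (hmeas ε hε).aestronglyMeasurable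
    · filter_upwards [hev] with ε hε
      refine Eventually.of_forall fun θ => ?_
      rw [hF, norm_mul, norm_exp_mellin, hC, mul_div_assoc]
      refine mul_le_mul (Real.exp_le_exp.2 ?_) (norm_rindlerTransform_le ha h (hmem ε hε θ) hx
        (mul_abs_sinh_le_norm_rapidityPhase x ε θ) k) (norm_nonneg _) (Real.exp_pos _).le
      have h3 : ε ≤ Real.pi := by linarith [hε.2, Real.pi_pos]
      calc -(ν * ε) ≤ |ν| * ε := by nlinarith [neg_abs_le ν, hε.1]
        _ ≤ _ := by gcongr
    · have := (hcont θ) 0 ⟨le_rfl, by linarith [Real.pi_pos]⟩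
      refine this.tendsto.mono_left ?_
      rw [← nhdsWithin_Ioc_eq_nhdsGT (show (0 : ℝ) < Real.pi / 2 by linarith [Real.pi_pos])]
      exact nhdsWithin_mono _ Ioc_subset_Icc_self
  have hconst : Tendsto (fun ε => ∫ θ, F ε θ) (𝓝[>] 0)
      (𝓝 (2 * Real.exp (-(Real.pi * ν / 2)) * ∫ ζ, h ζ * besselWave a x ν k ζ)) := by
    refine Tendsto.congr' ?_ tendsto_const_nhds
    filter_upwards [hev] with ε hε
    exact (integral_rindlerTransform_shift h hx ν k hε.1 hε.2).symm
  rw [← tendsto_nhds_unique hlim hconst, hF]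
  simp

/-! ### Measurability of the amplitude -/

theorem continuous_omega (m : ℝ) : Continuous (omega m) := by unfold omega; fun_prop

theorem continuous_kappa (m : ℝ) : Continuous (kappa m) := by unfold kappa; fun_prop

theorem amplitude_eq (m : ℝ) (X : ℝ → Space → ℝ × Space) (w f : Space → ℝ) (τ : ℝ) (k : Space) :
    amplitude m X w f τ k = ((1 / √(2 * (2 * Real.pi) ^ 3 * omega m k) : ℝ) : ℂ) *
      ∫ ζ, ((w ζ * f ζ : ℝ) : ℂ) * Complex.exp (-(Complex.I *
        ((-(omega m k) * (X τ ζ).1 + inner ℝ k (X τ ζ).2 : ℝ) : ℂ))) := by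
  rw [amplitude, ← integral_const_mul]
  congr 1; ext ζ
  rw [planeWave, map_mul, Complex.conj_ofReal, ← Complex.exp_conj, map_mul, Complex.conj_I,
    Complex.conj_ofReal, neg_mul]
  ring

theorem aestronglyMeasurable_amplitude (m : ℝ) {X : ℝ → Space → ℝ × Space} {w f : Space → ℝ}
    {τ : ℝ} (hX : Continuous (X τ)) (hf : Integrable fun ζ => w ζ * f ζ) :
    AEStronglyMeasurable (amplitude m X w f τ) volume := by
  have hω := continuous_omega m
  rw [show amplitude m X w f τ = _ from funext (amplitude_eq m X w f τ)]
  refine AEStronglyMeasurable.mul ?_ (Continuous.aestronglyMeasurable ?_)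
  · have : Measurable fun k => (1 / √(2 * (2 * Real.pi) ^ 3 * omega m k) : ℝ) := by
      have := hω.measurable
      fun_prop
    exact (Complex.measurable_ofReal.comp this).aestronglyMeasurable
  · refine continuous_of_dominated (bound := fun ζ => ‖w ζ * f ζ‖) (fun k => ?_) (fun k => ?_)
      hf.norm (Eventually.of_forall fun ζ => by fun_prop)
    · refine AEStronglyMeasurable.mul ?_ (Continuous.aestronglyMeasurable (by fun_prop))
      exact Complex.continuous_ofReal.comp_aestronglyMeasurable hf.aestronglyMeasurable
    · refine Eventually.of_forall fun ζ => ?_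
      rw [norm_mul, Complex.norm_real, Complex.norm_exp]
      simp

theorem conj_wightman (m : ℝ) (X : ℝ → Space → ℝ × Space) (w f : Space → ℝ) (τ τ' : ℝ) :
    conj (wightman m X w f τ τ') = wightman m X w f τ' τ := by
  rw [wightman_eq, wightman_eq, ← integral_conj]
  congr 1; ext k
  rw [map_mul, Complex.conj_conj, mul_comm]

/-! ### Rapidity coordinates on momentum space -/

theorem kappa_pos_ae (m : ℝ) : ∀ᵐ k : Transverse, 0 < kappa m k := by
  have : ∀ᵐ k : Transverse, k ≠ 0 := by simp [ae_iff]
  filter_upwards [this] with k hk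
  have := norm_pos_iff.2 hk
  exact Real.sqrt_pos.2 (by positivity)

theorem integral_rapidity {κ : ℝ} (hκ : 0 < κ) (g : ℝ → ℂ) :
    (Integrable g ↔ Integrable fun θ : ℝ => ((κ * Real.cosh θ : ℝ) : ℂ) * g (κ * Real.sinh θ)) ∧
      ∫ x, g x = ∫ θ : ℝ, ((κ * Real.cosh θ : ℝ) : ℂ) * g (κ * Real.sinh θ) := by
  have hd : ∀ θ ∈ (univ : Set ℝ), HasDerivWithinAt (fun θ => κ * Real.sinh θ) (κ * Real.cosh θ)
      univ θ := fun θ _ => ((Real.hasDerivAt_sinh θ).const_mul κ).hasDerivWithinAt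
  have hinj : InjOn (fun θ => κ * Real.sinh θ) univ := fun x _ y _ hxy =>
    Real.sinh_injective (mul_left_cancel₀ hκ.ne' hxy)
  have himg : (fun θ => κ * Real.sinh θ) '' univ = univ := by
    rw [image_univ, range_eq_univ]
    intro y
    obtain ⟨x, hx⟩ := Real.sinh_surjective (y / κ)
    exact ⟨x, by simp only [hx]; field_simp⟩
  have h1 := integrableOn_image_iff_integrableOn_abs_deriv_smul MeasurableSet.univ hd hinj g
  have h2 := integral_image_eq_integral_abs_deriv_smul MeasurableSet.univ hd hinj g
  have habs : ∀ θ, |κ * Real.cosh θ| = κ * Real.cosh θ := fun θ =>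
    abs_of_pos (mul_pos hκ (Real.cosh_pos θ))
  simp only [himg, integrableOn_univ, setIntegral_univ, habs, Complex.real_smul] at h1 h2
  exact ⟨h1, h2⟩

/-- The momentum with transverse part `k` and rapidity `θ`. -/
def momentum (m : ℝ) (k : Transverse) (θ : ℝ) : Space :=
  splitEquiv.symm (kappa m k * Real.sinh θ, k)

/-- The substitution k_x = κ sinh θ on each fibre with κ > 0, assembled by Fubini. Integrability is
deduced from the rapidity side, where the bounds are available. -/
theorem integral_momentum (m : ℝ) {Φ : Space → ℂ} (hΦ : AEStronglyMeasurable Φ volume)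
    (hΨ : Integrable fun y : Transverse × ℝ =>
      ((kappa m y.1 * Real.cosh y.2 : ℝ) : ℂ) * Φ (momentum m y.1 y.2)) :
    Integrable Φ ∧ ∫ k, Φ k = ∫ y : Transverse × ℝ,
      ((kappa m y.1 * Real.cosh y.2 : ℝ) : ℂ) * Φ (momentum m y.1 y.2) := by
  have hmp := measurePreserving_splitEquiv.symm
  have hm : AEStronglyMeasurable (fun y : ℝ × Transverse => Φ (splitEquiv.symm y))
      (volume.prod volume) := hΦ.comp_measurePreserving hmp
  rw [Measure.volume_eq_prod] at hΨ
  have hΨ' := (integrable_prod_iff hΨ.aestronglyMeasurable).1 hΨ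
  have hprod : Integrable (fun y : ℝ × Transverse => Φ (splitEquiv.symm y))
      (volume.prod volume) := by
    rw [integrable_prod_iff' hm]
    refine ⟨?_, hΨ'.2.congr ?_⟩
    · filter_upwards [kappa_pos_ae m, hΨ'.1] with k hk hi
      exact (integral_rapidity hk fun x => Φ (splitEquiv.symm (x, k))).1.2 hi
    · filter_upwards [kappa_pos_ae m] with k hk
      -- The same substitution for |Φ| identifies the fibre norms whose integrability over k⊥ is
      -- required.
      have h1 := (integral_rapidity hk fun x => (‖Φ (splitEquiv.symm (x, k))‖ : ℂ)).2
      have h2 : ∀ θ : ℝ, ((kappa m k * Real.cosh θ : ℝ) : ℂ) *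
          (‖Φ (splitEquiv.symm (kappa m k * Real.sinh θ, k))‖ : ℂ) =
          ((‖((kappa m k * Real.cosh θ : ℝ) : ℂ) * Φ (momentum m k θ)‖ : ℝ) : ℂ) := by
        intro θ
        rw [norm_mul, Complex.norm_real,
          Real.norm_of_nonneg (mul_pos hk (Real.cosh_pos θ)).le, momentum, ← Complex.ofReal_mul]
      simp_rw [h2] at h1
      rw [integral_complex_ofReal, integral_complex_ofReal] at h1
      exact_mod_cast h1.symm
  refine ⟨(hmp.integrable_comp_emb splitEquiv.symm.measurableEmbedding).1 hprod, ?_⟩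
  rw [← hmp.integral_comp splitEquiv.symm.measurableEmbedding, Measure.volume_eq_prod,
    integral_prod_symm _ hprod, Measure.volume_eq_prod, integral_prod _ hΨ]
  refine integral_congr_ae ?_
  filter_upwards [kappa_pos_ae m] with k hk
  exact (integral_rapidity hk fun x => Φ (splitEquiv.symm (x, k))).2

theorem omega_momentum (m : ℝ) (k : Transverse) (θ : ℝ) :
    omega m (momentum m k θ) = kappa m k * Real.cosh θ := by
  have hκ : kappa m k ^ 2 = ‖k‖ ^ 2 + m ^ 2 := Real.sq_sqrt (by positivity)
  have hκ0 : 0 ≤ kappa m k := Real.sqrt_nonneg _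
  rw [omega, momentum, splitEquiv_symm_apply, Real.sqrt_eq_iff_mul_self_eq (by positivity)
    (mul_nonneg hκ0 (Real.cosh_pos θ).le)]
  rw [EuclideanSpace.norm_sq_eq] at hκ ⊢
  rw [Fin.sum_univ_two] at hκ
  rw [Fin.sum_univ_three]
  simp only [Real.norm_eq_abs, sq_abs] at hκ ⊢
  simp
  have := Real.cosh_sq θ
  linear_combination -kappa m k ^ 2 * this - hκ

/-! ### The amplitude along the accelerated trajectory -/

/-- The amplitude as a function of the transverse momentum and the rapidity. -/
def rapidityAmplitude (m a : ℝ) (h : Space → ℂ) (k : Transverse) (θ : ℝ) : ℂ :=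
  rindlerTransform a h (rapidityPhase (kappa m k / a) 0 θ) k

/-- The plane-wave phase contains sinh θ cosh aρ - cosh θ sinh aρ = sinh(θ - aρ): the boost by
proper time ρ translates the rapidity. -/
theorem amplitude_momentum (m : ℝ) {a : ℝ} (ha : 0 < a) {f : Space → ℝ} {h : Space → ℂ}
    (hf : ∀ ζ, h ζ = (rindlerVol a ζ * f ζ : ℝ)) (ρ : ℝ) (k : Transverse) (θ : ℝ) :
    amplitude m (rindlerChart a) (rindlerVol a) f ρ (momentum m k θ) =
      ((1 / √(2 * (2 * Real.pi) ^ 3 * (kappa m k * Real.cosh θ)) : ℝ) : ℂ) *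
        rapidityAmplitude m a h k (θ - a * ρ) := by
  rw [amplitude_eq, omega_momentum, rapidityAmplitude, rindlerTransform]
  congr 2
  ext ζ
  rw [hf, rindlerWave, ← Complex.exp_add]
  congr 2
  rw [rapidityPhase, momentum, splitEquiv_symm_apply, rindlerChart]
  simp only [PiLp.inner_apply, Fin.sum_univ_three]
  simp [Real.sinh_sub]
  have ha' : (a : ℂ) ≠ 0 := by exact_mod_cast ha.ne'
  field_simp
  ring

theorem continuous_rapidityAmplitude (m : ℝ) {a : ℝ} (h : 𝓢(Space, ℂ)) :
    Continuous fun y : Transverse × ℝ => rapidityAmplitude m a h y.1 y.2 := by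
  rw [← continuousOn_univ]
  refine continuousOn_rindlerTransform_comp a h ?_ continuous_fst fun y _ => ?_
  · have := continuous_kappa m
    have := Real.continuous_sinh
    have := Real.continuous_cosh
    unfold rapidityPhase
    fun_prop
  · rw [rapidityPhase_re]; simp

/-- The decay of `rapidityAmplitude` in the transverse momentum. -/
def transverseDecay (m a : ℝ) (k : Transverse) : ℝ :=
  (1 + Real.log (kappa m k / a) ^ 2) / (1 + ‖k‖ ^ 2)

theorem norm_rapidityAmplitude_le {m a : ℝ} (ha : 0 < a) (h : 𝓢(Space, ℂ)) {k : Transverse}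
    (hk : 0 < kappa m k) (θ : ℝ) :
    ‖rapidityAmplitude m a h k θ‖ ≤
      rindlerBound a (transverseResolvent h) * transverseDecay m a k / (1 + θ ^ 2) :=
  norm_rindlerTransform_le_decay ha h (rapidityPhase_re_nonneg (div_pos hk ha) le_rfl
    (by linarith [Real.pi_pos]) θ) (div_pos hk ha) (mul_abs_sinh_le_norm_rapidityPhase _ _ _) k

theorem measurable_transverseDecay (m a : ℝ) : Measurable (transverseDecay m a) := by
  have := (continuous_kappa m).measurable
  unfold transverseDecay; fun_prop

theorem integrable_radial_transverse :
    Integrable fun k : Transverse => (‖k‖⁻¹ + 1 + ‖k‖) / (1 + ‖k‖ ^ 2) ^ 2 := by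
  have h := integrable_fun_norm_addHaar (volume : Measure Transverse)
    (f := fun r : ℝ => (r⁻¹ + 1 + r) / (1 + r ^ 2) ^ 2)
  rw [h]
  refine (integrable_inv_one_add_sq_mul 3).integrableOn.mono' ?_ ?_
  · exact Measurable.aestronglyMeasurable (by fun_prop)
  · filter_upwards [ae_restrict_mem measurableSet_Ioi] with r hr
    have hr : 0 < r := hr
    rw [Real.norm_of_nonneg (by positivity)]
    simp only [finrank_euclideanSpace, Fintype.card_fin, smul_eq_mul]
    rw [mul_div_assoc', div_le_div_iff₀ (by positivity) (by positivity)]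
    have : r ^ (2 - 1) * (r⁻¹ + 1 + r) = 1 + r + r ^ 2 := by
      rw [show 2 - 1 = 1 from rfl, pow_one]
      field_simp
    rw [this]
    nlinarith [sq_nonneg (r - 1), sq_nonneg r, mul_nonneg (sq_nonneg r) (sq_nonneg r)]

/-- For m = 0 the logarithm diverges at k⊥ = 0. Its fourth power is controlled by κ/a + a/κ, and
|k⊥|⁻¹ is locally integrable in the plane. -/
theorem integrable_transverseDecay_sq (m : ℝ) {a : ℝ} (ha : 0 < a) :
    Integrable fun k => transverseDecay m a k ^ 2 := by
  refine (integrable_radial_transverse.const_mul (50 * (a⁻¹ * (1 + |m|) + a))).mono'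
    ((measurable_transverseDecay m a).pow_const 2).aestronglyMeasurable ?_
  have : ∀ᵐ k : Transverse, k ≠ 0 := by simp [ae_iff]
  filter_upwards [kappa_pos_ae m, this] with k hk hk0
  have hk0 : 0 < ‖k‖ := norm_pos_iff.2 hk0
  have h1 := one_add_sq_log_sq_le (div_pos hk ha)
  have h2 : kappa m k ≤ ‖k‖ + |m| := by
    refine Real.sqrt_le_iff.2 ⟨by positivity, ?_⟩
    nlinarith [sq_abs m, abs_nonneg m]
  have h3 : (kappa m k)⁻¹ ≤ ‖k‖⁻¹ := by
    refine inv_anti₀ hk0 (Real.le_sqrt_of_sq_le ?_)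
    nlinarith [sq_nonneg m]
  rw [Real.norm_of_nonneg (sq_nonneg _), transverseDecay, div_pow, mul_div_assoc']
  gcongr
  refine h1.trans ?_
  rw [mul_assoc]
  have hm := abs_nonneg m
  have ha' := inv_pos.2 ha
  have hki := inv_pos.2 hk0
  gcongr 50 * ?_
  calc kappa m k / a + (kappa m k / a)⁻¹ = a⁻¹ * kappa m k + a * (kappa m k)⁻¹ := by
        rw [inv_div]; ring
    _ ≤ a⁻¹ * (‖k‖ + |m|) + a * ‖k‖⁻¹ := by gcongr
    _ ≤ a⁻¹ * ((1 + |m|) * (‖k‖⁻¹ + 1 + ‖k‖)) + a * (‖k‖⁻¹ + 1 + ‖k‖) := by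
        gcongr
        · nlinarith [mul_nonneg hm hki.le, mul_nonneg hm hk0.le]
        · linarith
    _ = _ := by ring

/-! ### The Wightman function along the accelerated trajectory -/

theorem kappa_pos_ae_prod (m : ℝ) : ∀ᵐ y : Transverse × ℝ, 0 < kappa m y.1 :=
  Measure.quasiMeasurePreserving_fst.ae (kappa_pos_ae m)

/-- The correlation `conj B(θ, k) B(θ + as, k)` of the amplitudes. -/
def rapidityCorrelation (m a : ℝ) (h : Space → ℂ) (s : ℝ) (y : Transverse × ℝ) : ℂ :=
  conj (rapidityAmplitude m a h y.1 y.2) * rapidityAmplitude m a h y.1 (y.2 + a * s)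

theorem continuous_rapidityCorrelation (m : ℝ) {a : ℝ} (h : 𝓢(Space, ℂ)) :
    Continuous fun x : (Transverse × ℝ) × ℝ => rapidityCorrelation m a h x.2 x.1 := by
  have hB := continuous_rapidityAmplitude m (a := a) h
  unfold rapidityCorrelation
  refine Continuous.mul (Complex.continuous_conj.comp (hB.comp continuous_fst)) ?_
  have hs : Continuous fun x : (Transverse × ℝ) × ℝ => (x.1.1, x.1.2 + a * x.2) := by fun_prop
  have := hB.comp hs
  exact this

/-- The constant in the decay of `rapidityCorrelation`. -/
def correlationBound (a : ℝ) (h : 𝓢(Space, ℂ)) : ℝ := rindlerBound a (transverseResolvent h) ^ 2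

theorem norm_rapidityCorrelation_le {m a : ℝ} (ha : 0 < a) (h : 𝓢(Space, ℂ)) (s : ℝ)
    {y : Transverse × ℝ} (hy : 0 < kappa m y.1) :
    ‖rapidityCorrelation m a h s y‖ ≤ correlationBound a h * transverseDecay m a y.1 ^ 2 *
      ((1 + y.2 ^ 2)⁻¹ * (1 + (y.2 + a * s) ^ 2)⁻¹) := by
  rw [rapidityCorrelation, norm_mul, RCLike.norm_conj]
  have h1 := norm_rapidityAmplitude_le ha h hy y.2
  have h2 := norm_rapidityAmplitude_le ha h hy (y.2 + a * s)
  refine (mul_le_mul h1 h2 (norm_nonneg _) ((norm_nonneg _).trans h1)).trans (le_of_eq ?_)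
  rw [correlationBound]
  ring

theorem integrable_rapidityCorrelation {m a : ℝ} (ha : 0 < a) (h : 𝓢(Space, ℂ)) (s : ℝ) :
    Integrable (rapidityCorrelation m a h s) := by
  have hmaj : Integrable (fun y : Transverse × ℝ =>
      (correlationBound a h * transverseDecay m a y.1 ^ 2) * (1 + y.2 ^ 2)⁻¹)
      (volume.prod volume) :=
    ((integrable_transverseDecay_sq m ha).const_mul _).mul_prod integrable_inv_one_add_sq
  rw [Measure.volume_eq_prod]
  refine hmaj.mono' ?_ ?_
  · exact ((continuous_rapidityCorrelation m h).comp
      (continuous_id.prodMk continuous_const)).aestronglyMeasurable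
  · rw [← Measure.volume_eq_prod]
    filter_upwards [kappa_pos_ae_prod m] with y hy
    refine (norm_rapidityCorrelation_le ha h s hy).trans ?_
    have h1 : (1 + (y.2 + a * s) ^ 2)⁻¹ ≤ 1 := inv_le_one_of_one_le₀ (by nlinarith [sq_nonneg (y.2 + a * s)])
    have h2 : 0 ≤ correlationBound a h * transverseDecay m a y.1 ^ 2 := by
      unfold correlationBound; positivity
    refine mul_le_mul_of_nonneg_left ?_ h2
    exact mul_le_of_le_one_right (by positivity) h1

/-- The s-integral of (1 + (θ + as)²)⁻¹ does not depend on θ, so the majorant integrates to a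
product. Integrability of W in s is a marginal of this statement. -/
theorem integrable_rapidityCorrelation_prod {m a : ℝ} (ha : 0 < a) (h : 𝓢(Space, ℂ)) :
    Integrable (fun x : (Transverse × ℝ) × ℝ => rapidityCorrelation m a h x.2 x.1)
      (volume.prod volume) := by
  set u : ℝ → ℝ := fun x => (1 + x ^ 2)⁻¹ with hu
  have hui : Integrable u := integrable_inv_one_add_sq
  set G : Transverse → ℝ := fun k => correlationBound a h * transverseDecay m a k ^ 2 with hG
  have hGi : Integrable G := (integrable_transverseDecay_sq m ha).const_mul _
  have hG0 : ∀ k, 0 ≤ G k := fun k => by rw [hG]; unfold correlationBound; positivity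
  have hGm : Measurable G := ((measurable_transverseDecay m a).pow_const 2).const_mul _
  have hmaj : Integrable (fun x : (Transverse × ℝ) × ℝ =>
      G x.1.1 * (u x.1.2 * u (x.1.2 + a * x.2))) (volume.prod volume) := by
    rw [integrable_prod_iff]
    · refine ⟨Eventually.of_forall fun y => ?_, ?_⟩
      · exact (((hui.comp_add_left y.2).comp_mul_left' ha.ne').const_mul (u y.2)).const_mul (G y.1)
      · have hint : ∀ y : Transverse × ℝ, ∫ s, ‖G y.1 * (u y.2 * u (y.2 + a * s))‖ =
            G y.1 * (u y.2 * (a⁻¹ * ∫ x, u x)) := by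
          intro y
          have hnn : ∀ s, ‖G y.1 * (u y.2 * u (y.2 + a * s))‖ =
              G y.1 * (u y.2 * u (y.2 + a * s)) := fun s =>
            Real.norm_of_nonneg (mul_nonneg (hG0 _) (by rw [hu]; positivity))
          simp_rw [hnn]
          rw [integral_const_mul, integral_const_mul,
            Measure.integral_comp_mul_left (fun x => u (y.2 + x)) a, integral_add_left_eq_self,
            abs_of_pos (inv_pos.2 ha), smul_eq_mul]
        simp_rw [hint]
        rw [Measure.volume_eq_prod]
        exact hGi.mul_prod (hui.mul_const _)
    · have : Measurable u := by rw [hu]; fun_prop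
      exact Measurable.aestronglyMeasurable (by fun_prop)
  refine hmaj.mono' (continuous_rapidityCorrelation m h).aestronglyMeasurable ?_
  have hae : ∀ᵐ x ∂((volume : Measure (Transverse × ℝ)).prod (volume : Measure ℝ)),
      0 < kappa m x.1.1 :=
    Measure.quasiMeasurePreserving_fst.ae (kappa_pos_ae_prod m)
  filter_upwards [hae] with x hx
  exact norm_rapidityCorrelation_le ha h x.2 hx

/-- The vacuum Wightman function as a function of the proper time difference. -/
def stationaryWightman (m a : ℝ) (h : Space → ℂ) (s : ℝ) : ℂ :=
  ((1 / (2 * (2 * Real.pi) ^ 3) : ℝ) : ℂ) * ∫ y, rapidityCorrelation m a h s y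

theorem continuous_rindlerChart {a : ℝ} (ρ : ℝ) : Continuous (rindlerChart a ρ) := by
  unfold rindlerChart
  fun_prop

theorem mode_normalization {ω : ℝ} (hω : 0 < ω) :
    ω * (1 / √(2 * (2 * Real.pi) ^ 3 * ω)) ^ 2 = 1 / (2 * (2 * Real.pi) ^ 3) := by
  have := Real.pi_pos
  rw [div_pow, Real.sq_sqrt (by positivity)]
  field_simp

section

variable {m a : ℝ} (ha : 0 < a) {f : Space → ℝ} {h : 𝓢(Space, ℂ)}
  (hf : ∀ ζ, h ζ = (rindlerVol a ζ * f ζ : ℝ))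

include hf in
theorem integrable_profile : Integrable fun ζ => rindlerVol a ζ * f ζ := by
  have := (h.integrable (μ := volume)).re
  refine this.congr (Eventually.of_forall fun ζ => ?_)
  simp [hf]

-- The Jacobian κ cosh θ is ω, which cancels the factors ω^{-1/2} of the two modes.
include ha hf in
theorem jacobian_mul_conj_amplitude (ρ ρ' : ℝ) {k : Transverse} (hk : 0 < kappa m k) (θ : ℝ) :
    ((kappa m k * Real.cosh θ : ℝ) : ℂ) *
      (conj (amplitude m (rindlerChart a) (rindlerVol a) f ρ (momentum m k θ)) *
        amplitude m (rindlerChart a) (rindlerVol a) f ρ' (momentum m k θ)) =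
    ((1 / (2 * (2 * Real.pi) ^ 3) : ℝ) : ℂ) *
      rapidityCorrelation m a h (ρ - ρ') (k, θ - a * ρ) := by
  rw [amplitude_momentum m ha hf, amplitude_momentum m ha hf, map_mul, Complex.conj_ofReal,
    rapidityCorrelation, ← mode_normalization (mul_pos hk (Real.cosh_pos θ))]
  rw [show θ - a * ρ + a * (ρ - ρ') = θ - a * ρ' by ring]
  push_cast
  ring

-- Stationarity: translating θ by aρ removes everything but ρ - ρ'.
include ha hf in
theorem integral_conj_amplitude_mul (ρ ρ' : ℝ) :
    Integrable (fun k => conj (amplitude m (rindlerChart a) (rindlerVol a) f ρ k) *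
      amplitude m (rindlerChart a) (rindlerVol a) f ρ' k) ∧
    ∫ k, conj (amplitude m (rindlerChart a) (rindlerVol a) f ρ k) *
      amplitude m (rindlerChart a) (rindlerVol a) f ρ' k =
      stationaryWightman m a h (ρ - ρ') := by
  have hA := fun ρ => aestronglyMeasurable_amplitude m (continuous_rindlerChart (a := a) ρ)
    (integrable_profile hf)
  have hΦ : AEStronglyMeasurable (fun k =>
      conj (amplitude m (rindlerChart a) (rindlerVol a) f ρ k) *
      amplitude m (rindlerChart a) (rindlerVol a) f ρ' k) volume :=
    (Complex.continuous_conj.comp_aestronglyMeasurable (hA ρ)).mul (hA ρ')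
  have : (volume : Measure (Transverse × ℝ)).IsAddRightInvariant := by
    rw [Measure.volume_eq_prod]; infer_instance
  have heq : (fun y : Transverse × ℝ => ((1 / (2 * (2 * Real.pi) ^ 3) : ℝ) : ℂ) *
      rapidityCorrelation m a h (ρ - ρ') (y + (0, -(a * ρ)))) =ᵐ[volume] fun y =>
      ((kappa m y.1 * Real.cosh y.2 : ℝ) : ℂ) *
      (conj (amplitude m (rindlerChart a) (rindlerVol a) f ρ (momentum m y.1 y.2)) *
        amplitude m (rindlerChart a) (rindlerVol a) f ρ' (momentum m y.1 y.2)) := by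
    filter_upwards [kappa_pos_ae_prod m] with y hy
    rw [jacobian_mul_conj_amplitude ha hf ρ ρ' hy]
    simp [Prod.add_def, sub_eq_add_neg]
  have hint := ((integrable_rapidityCorrelation (m := m) ha h (ρ - ρ')).comp_add_right
    (0, -(a * ρ))).const_mul ((1 / (2 * (2 * Real.pi) ^ 3) : ℝ) : ℂ)
  obtain ⟨h1, h2⟩ := integral_momentum m hΦ (hint.congr heq)
  refine ⟨h1, ?_⟩
  rw [h2, ← integral_congr_ae heq, integral_const_mul, integral_add_right_eq_self,
    stationaryWightman]

include ha hf in
theorem memLp_rindler_amplitude (ρ : ℝ) :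
    MemLp (amplitude m (rindlerChart a) (rindlerVol a) f ρ) 2 volume := by
  rw [memLp_two_iff_integrable_sq_norm (aestronglyMeasurable_amplitude m
    (continuous_rindlerChart (a := a) ρ) (integrable_profile hf))]
  refine (integral_conj_amplitude_mul (m := m) ha hf ρ ρ).1.norm.congr
    (Eventually.of_forall fun k => ?_)
  simp only [norm_mul, RCLike.norm_conj]
  ring

include ha hf in
theorem wightman_rindler (ρ ρ' : ℝ) :
    wightman m (rindlerChart a) (rindlerVol a) f ρ ρ' = stationaryWightman m a h (ρ - ρ') := by
  rw [wightman_eq]; exact (integral_conj_amplitude_mul ha hf ρ ρ').2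

include ha hf in
theorem stationaryWightman_neg (s : ℝ) :
    stationaryWightman m a h (-s) = conj (stationaryWightman m a h s) := by
  rw [← sub_zero s, ← wightman_rindler ha hf s 0, conj_wightman, wightman_rindler ha hf 0 s]
  simp

end

/-- The Fourier transform of `rapidityAmplitude` in the rapidity. -/
def rapidityFourier (m a : ℝ) (h : Space → ℂ) (ν : ℝ) (k : Transverse) : ℂ :=
  ∫ θ : ℝ, Complex.exp (-(Complex.I * ν * θ)) * rapidityAmplitude m a h k θ

/-! ### Power spectrum of the accelerated Wightman function -/

theorem integrable_stationaryWightman {m a : ℝ} (ha : 0 < a) (h : 𝓢(Space, ℂ)) :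
    Integrable (stationaryWightman m a h) :=
  (integrable_rapidityCorrelation_prod (m := m) ha h).integral_prod_right.const_mul _

/-- Wiener–Khinchin: the transform of an autocorrelation is a squared modulus. Substituting x = θ +
as turns the frequency Δ into Δ/a and costs a⁻¹. -/
theorem integral_exp_mul_stationaryWightman {m a : ℝ} (ha : 0 < a) (h : 𝓢(Space, ℂ)) (Δ : ℝ) :
    ∫ s : ℝ, Complex.exp (-Complex.I * Δ * s) * stationaryWightman m a h s =
      ((1 / (2 * (2 * Real.pi) ^ 3) * a⁻¹ * ∫ k, ‖rapidityFourier m a h (Δ / a) k‖ ^ 2 : ℝ) : ℂ) := by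
  have hP : Integrable (fun x : (Transverse × ℝ) × ℝ =>
      Complex.exp (-Complex.I * Δ * x.2) * rapidityCorrelation m a h x.2 x.1)
      (volume.prod volume) := by
    refine (integrable_rapidityCorrelation_prod (m := m) ha h).bdd_mul (c := 1)
      (Continuous.aestronglyMeasurable (by fun_prop)) (Eventually.of_forall fun x => ?_)
    rw [Complex.norm_exp]; simp
  have ha' : (a : ℂ) ≠ 0 := by exact_mod_cast ha.ne'
  have hinner : ∀ y : Transverse × ℝ, ∫ s : ℝ, Complex.exp (-Complex.I * Δ * s) *
      rapidityCorrelation m a h s y = (a : ℂ)⁻¹ * (rapidityFourier m a h (Δ / a) y.1 *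
        conj (Complex.exp (-(Complex.I * (Δ / a : ℝ) * y.2)) * rapidityAmplitude m a h y.1 y.2)) := by
    intro y
    set F : ℝ → ℂ := fun x => Complex.exp (-(Complex.I * (Δ / a : ℝ) * x)) *
      rapidityAmplitude m a h y.1 x with hF
    -- The phase e^{-iΔs} is distributed over the points θ + as and θ, the latter conjugated, at
    -- frequency Δ/a.
    have e1 : ∀ s : ℝ, Complex.exp (-Complex.I * Δ * s) * rapidityCorrelation m a h s y =
        conj (F y.2) * F (y.2 + a * s) := by
      intro s
      rw [hF, rapidityCorrelation]
      simp only
      rw [map_mul, ← Complex.exp_conj]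
      simp only [map_neg, map_mul, Complex.conj_I, Complex.conj_ofReal]
      rw [mul_mul_mul_comm, ← Complex.exp_add]
      congr 2
      push_cast
      field_simp
      ring
    simp_rw [e1]
    rw [integral_const_mul, Measure.integral_comp_mul_left (fun x => F (y.2 + x)) a,
      integral_add_left_eq_self, abs_of_pos (inv_pos.2 ha), Complex.real_smul, rapidityFourier,
      Complex.ofReal_inv]
    simp only [hF]
    ring
  have hPi := hP.integral_prod_left
  simp only [hinner] at hPi
  unfold stationaryWightman
  simp_rw [mul_left_comm _ ((1 / (2 * (2 * Real.pi) ^ 3) : ℝ) : ℂ)]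
  rw [integral_const_mul]
  have hin : ∀ s : ℝ, Complex.exp (-Complex.I * Δ * s) * ∫ y, rapidityCorrelation m a h s y =
      ∫ y, Complex.exp (-Complex.I * Δ * s) * rapidityCorrelation m a h s y :=
    fun s => (integral_const_mul _ _).symm
  simp_rw [hin]
  rw [integral_integral_swap (f := fun (s : ℝ) (y : Transverse × ℝ) =>
    Complex.exp (-Complex.I * Δ * s) * rapidityCorrelation m a h s y) hP.swap]
  simp_rw [hinner]
  rw [Measure.volume_eq_prod, integral_prod _ hPi]
  simp_rw [integral_const_mul, integral_conj]
  have : ∀ k, rapidityFourier m a h (Δ / a) k * conj (∫ θ : ℝ,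
      Complex.exp (-(Complex.I * (Δ / a : ℝ) * θ)) * rapidityAmplitude m a h k θ) =
      ((‖rapidityFourier m a h (Δ / a) k‖ ^ 2 : ℝ) : ℂ) := by
    intro k
    rw [← rapidityFourier, Complex.mul_conj, Complex.normSq_eq_norm_sq]
  simp_rw [this]
  rw [integral_complex_ofReal]
  push_cast
  ring

/-! ### The frequency window of the accelerated detector -/

section

variable {m a : ℝ} (ha : 0 < a) {f : Space → ℝ} {h : 𝓢(Space, ℂ)}
  (hf : ∀ ζ, h ζ = (rindlerVol a ζ * f ζ : ℝ))

-- The window carries e^{+ik⊥·x⊥} and the amplitude its conjugate, hence the reflection to -k.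
include hf in
theorem rindlerWindowIntegrand_eq (Ω : ℝ) (k : Transverse) (ζ : Space) :
    rindlerWindowIntegrand m a f Ω k ζ = h ζ * besselWave a (kappa m k / a) (Ω / a) (-k) ζ := by
  rw [rindlerWindowIntegrand, besselWave, hf, mul_assoc]
  congr 3
  simp only [PiLp.neg_apply]
  push_cast
  ring

include ha hf in
theorem integrable_rindlerWindowIntegrand (Ω : ℝ) {k : Transverse} (hk : 0 < kappa m k) :
    Integrable (rindlerWindowIntegrand m a f Ω k) :=
  (integrable_mul_besselWave h (div_pos hk ha) (Ω / a) (-k)).congr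
    (Eventually.of_forall fun ζ => (rindlerWindowIntegrand_eq hf Ω k ζ).symm)

theorem kappa_neg (k : Transverse) : kappa m (-k) = kappa m k := by simp [kappa]

include ha hf in
theorem rapidityFourier_neg (Ω : ℝ) {k : Transverse} (hk : 0 < kappa m k) :
    rapidityFourier m a h (Ω / a) (-k) =
      2 * Real.exp (-(Real.pi * (Ω / a) / 2)) * rindlerWindow m a f Ω k := by
  unfold rapidityFourier rapidityAmplitude rindlerWindow
  rw [kappa_neg, integral_rindlerTransform_eq ha h (div_pos hk ha)]
  simp_rw [rindlerWindowIntegrand_eq hf]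

include ha hf in
theorem norm_rindlerWindow_sq (Ω : ℝ) {k : Transverse} (hk : 0 < kappa m k) :
    ‖rapidityFourier m a h (Ω / a) (-k)‖ ^ 2 =
      4 * Real.exp (-(Real.pi * Ω / a)) * ‖rindlerWindow m a f Ω k‖ ^ 2 := by
  rw [rapidityFourier_neg ha hf Ω hk, norm_mul, norm_mul, Complex.norm_real,
    Real.norm_of_nonneg (Real.exp_pos _).le, mul_pow, mul_pow, ← Real.exp_nat_mul]
  norm_num
  ring_nf
  simp

include ha in
theorem integrable_rapidityFourier_sq (ν : ℝ) :
    Integrable fun k => ‖rapidityFourier m a h ν k‖ ^ 2 := by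
  have hm : AEStronglyMeasurable (rapidityFourier m a h ν) volume := by
    have hc : Continuous fun y : Transverse × ℝ =>
        Complex.exp (-(Complex.I * ν * y.2)) * rapidityAmplitude m a h y.1 y.2 :=
      Continuous.mul (by fun_prop) (continuous_rapidityAmplitude m h)
    exact (hc.stronglyMeasurable.integral_prod_right).aestronglyMeasurable
  refine ((integrable_transverseDecay_sq m ha).const_mul
    ((rindlerBound a (transverseResolvent h) * Real.pi) ^ 2)).mono' (hm.norm.pow 2) ?_
  filter_upwards [kappa_pos_ae m] with k hk
  rw [Real.norm_of_nonneg (sq_nonneg _), ← mul_pow]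
  refine pow_le_pow_left₀ (norm_nonneg _) ?_ 2
  refine (norm_integral_le_of_norm_le (integrable_inv_one_add_sq_mul
    (rindlerBound a (transverseResolvent h) * transverseDecay m a k))
    (Eventually.of_forall fun θ => ?_)).trans (le_of_eq ?_)
  · rw [norm_mul, Complex.norm_exp]
    simpa using norm_rapidityAmplitude_le ha h hk θ
  · simp_rw [div_eq_mul_inv]
    rw [integral_const_mul, integral_univ_inv_one_add_sq]
    ring

include ha hf in
theorem integrable_norm_rindlerWindow_sq (Ω : ℝ) :
    Integrable fun k => ‖rindlerWindow m a f Ω k‖ ^ 2 := by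
  refine (((integrable_rapidityFourier_sq (m := m) (h := h) ha (Ω / a)).comp_neg).const_mul
    (4 * Real.exp (-(Real.pi * Ω / a)))⁻¹).congr ?_
  filter_upwards [kappa_pos_ae m] with k hk
  rw [norm_rindlerWindow_sq ha hf Ω hk, inv_mul_cancel_left₀]
  positivity

theorem besselK_neg (μ : ℂ) (z : ℝ) : besselK (-μ) z = besselK μ z := by
  simp [besselK]

theorem rindlerWindow_neg (Ω : ℝ) (k : Transverse) :
    rindlerWindow m a f (-Ω) k = rindlerWindow m a f Ω k := by
  have : Complex.I * ((-Ω / a : ℝ) : ℂ) = -(Complex.I * ((Ω / a : ℝ) : ℂ)) := by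
    push_cast; ring
  simp only [rindlerWindow, rindlerWindowIntegrand, this, besselK_neg]

-- The reflection k ↦ -k disappears in the k-integral, and the constants combine as 4/(2(2π)³) =
-- 1/(4π³).
include ha hf in
theorem rindler_rate (ρ Δ : ℝ) :
    IntegrableOn (rateIntegrand m (rindlerChart a) (rindlerVol a) f ρ Δ) (Ioi 0) ∧
    transitionRate m (rindlerChart a) (rindlerVol a) f ρ Δ =
      Real.exp (-(Real.pi * Δ / a)) / (4 * Real.pi ^ 3 * a) *
        ∫ k, ‖rindlerWindow m a f Δ k‖ ^ 2 := by
  obtain ⟨h1, h2⟩ := rate_of_wightman (m := m) (X := rindlerChart a) (w := rindlerVol a) (f := f)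
    (τ := ρ) (W := stationaryWightman m a h)
    (fun s => by rw [wightman_rindler ha hf]; congr 1; ring)
    (integrable_stationaryWightman ha h) (stationaryWightman_neg ha hf) Δ
  refine ⟨h1, ?_⟩
  rw [h2, integral_exp_mul_stationaryWightman ha h, Complex.ofReal_re,
    ← integral_neg_eq_self (fun k => ‖rapidityFourier m a h (Δ / a) k‖ ^ 2)]
  have : ∫ k, ‖rapidityFourier m a h (Δ / a) (-k)‖ ^ 2 =
      4 * Real.exp (-(Real.pi * Δ / a)) * ∫ k, ‖rindlerWindow m a f Δ k‖ ^ 2 := by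
    rw [← integral_const_mul]
    refine integral_congr_ae ?_
    filter_upwards [kappa_pos_ae m] with k hk using norm_rindlerWindow_sq ha hf Δ hk
  rw [this]
  have := Real.pi_pos
  field_simp
  norm_num

/-- Both signs of Δ give one formula because sinh is odd and the window is even in the frequency. -/
theorem rindlerXiIntegrand_eq (Δ : ℝ) (hΔ : Δ ≠ 0) (ha : 0 < a) (k : Transverse) :
    rindlerXiIntegrand m a f Δ k =
      Real.sinh (Real.pi * Δ / a) / (4 * Real.pi ^ 4 * a) * ‖rindlerWindow m a f Δ k‖ ^ 2 := by
  have hpi := Real.pi_pos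
  rw [rindlerXiIntegrand, rindlerWindow_neg, rindlerNorm, rindlerNorm]
  rcases lt_or_gt_of_ne hΔ with hlt | hgt
  · have hs : 0 ≤ Real.sinh (Real.pi * -Δ / a) :=
      Real.sinh_nonneg_iff.2 (div_nonneg (mul_nonneg hpi.le (by linarith)) ha.le)
    rw [theta, theta, if_neg (by linarith), if_pos (by linarith),
      Real.sq_sqrt (div_nonneg hs (by positivity)),
      show Real.pi * -Δ / a = -(Real.pi * Δ / a) by ring, Real.sinh_neg]
    ring
  · have hs : 0 ≤ Real.sinh (Real.pi * Δ / a) := Real.sinh_nonneg_iff.2 (by positivity)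
    rw [theta, theta, if_pos hgt.le, if_neg (by linarith), Real.sq_sqrt (by positivity)]
    ring

include ha hf in
theorem integrable_rindlerXiIntegrand (Δ : ℝ) : Integrable (rindlerXiIntegrand m a f Δ) := by
  have h1 := integrable_norm_rindlerWindow_sq (m := m) ha hf
  exact (((h1 Δ).const_mul _).mul_const _).sub (((h1 (-Δ)).const_mul _).mul_const _)

-- e^{2πΔ/a} - 1 = 2e^{πΔ/a} sinh(πΔ/a), so the sinh of the normalisation cancels and e^{-πΔ/a} is
-- left.
include ha hf in
theorem rindler_rate_eq_xi (ρ Δ : ℝ) (hΔ : Δ ≠ 0) :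
    transitionRate m (rindlerChart a) (rindlerVol a) f ρ Δ =
      2 * Real.pi * (1 / (Real.exp (2 * Real.pi * Δ / a) - 1)) * rindlerXi m a f Δ := by
  rw [(rindler_rate ha hf ρ Δ).2, rindlerXi]
  simp_rw [rindlerXiIntegrand_eq Δ hΔ ha]
  rw [integral_const_mul, ← mul_assoc]
  congr 1
  have hpi := Real.pi_pos
  set x := Real.exp (Real.pi * Δ / a) with hx
  have hx0 : 0 < x := Real.exp_pos _
  have h2 : Real.exp (2 * Real.pi * Δ / a) = x ^ 2 := by
    rw [hx, ← Real.exp_nat_mul]; congr 1; push_cast; ring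
  have hne : x ^ 2 - 1 ≠ 0 := by
    rw [← h2, sub_ne_zero, Ne, Real.exp_eq_one_iff]
    positivity
  rw [h2, Real.sinh_eq, Real.exp_neg, ← hx]
  field_simp

-- The window is even in Δ; the only asymmetry is the factor e^{-πΔ/a}, whose ratio at Δ and -Δ is
-- the Boltzmann factor.
include ha hf in
theorem rindler_kms (ρ Δ : ℝ) :
    transitionRate m (rindlerChart a) (rindlerVol a) f ρ Δ =
      Real.exp (-(2 * Real.pi / a) * Δ) *
        transitionRate m (rindlerChart a) (rindlerVol a) f ρ (-Δ) := by
  rw [(rindler_rate ha hf ρ Δ).2, (rindler_rate ha hf ρ (-Δ)).2]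
  simp_rw [rindlerWindow_neg]
  rw [← mul_assoc, ← mul_div_assoc, ← Real.exp_add]
  congr 3
  ring_nf

end

/-! ### Gaussian windows -/

theorem integrable_gaussian_wave {V : Type*} [NormedAddCommGroup V] [InnerProductSpace ℝ V]
    [FiniteDimensional ℝ V] [MeasurableSpace V] [BorelSpace V] {σ : ℝ} (hσ : 0 < σ) (w : V) :
    Integrable fun x : V => (Real.exp (-(‖x‖ ^ 2 / (2 * σ ^ 2))) : ℂ) *
      Complex.exp (Complex.I * (inner ℝ w x : ℝ)) := by
  have hb : 0 < ((1 / (2 * σ ^ 2) : ℝ) : ℂ).re := by rw [Complex.ofReal_re]; positivity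
  refine (GaussianFourier.integrable_cexp_neg_mul_sq_norm_add hb Complex.I w).congr
    (Eventually.of_forall fun x => ?_)
  simp only
  rw [Complex.ofReal_exp, ← Complex.exp_add]
  congr 1
  push_cast
  ring

theorem integral_gaussian_wave {V : Type*} [NormedAddCommGroup V] [InnerProductSpace ℝ V]
    [FiniteDimensional ℝ V] [MeasurableSpace V] [BorelSpace V] {σ : ℝ} (hσ : 0 < σ) (w : V) :
    ∫ x : V, (Real.exp (-(‖x‖ ^ 2 / (2 * σ ^ 2))) : ℂ) *
      Complex.exp (Complex.I * (inner ℝ w x : ℝ)) =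
      (((√(2 * Real.pi) * σ) ^ Module.finrank ℝ V * Real.exp (-(σ ^ 2 * ‖w‖ ^ 2 / 2)) : ℝ) : ℂ) := by
  have hpi := Real.pi_pos
  have hb : 0 < ((1 / (2 * σ ^ 2) : ℝ) : ℂ).re := by rw [Complex.ofReal_re]; positivity
  have h := GaussianFourier.integral_cexp_neg_mul_sq_norm_add hb Complex.I w
  have hs : (Real.pi : ℂ) / ((1 / (2 * σ ^ 2) : ℝ) : ℂ) = (((√(2 * Real.pi) * σ) ^ 2 : ℝ) : ℂ) := by
    rw [mul_pow, Real.sq_sqrt (by positivity)]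
    push_cast
    field_simp
  -- The Gaussian integral comes with a complex power of exponent dim/2; its base is a square of a
  -- positive real.
  have hp : (((√(2 * Real.pi) * σ) ^ 2 : ℝ) : ℂ) ^ ((Module.finrank ℝ V : ℂ) / 2) =
      (((√(2 * Real.pi) * σ) ^ Module.finrank ℝ V : ℝ) : ℂ) := by
    have e : ((Module.finrank ℝ V : ℂ) / 2) = ((Module.finrank ℝ V / 2 : ℝ) : ℂ) := by push_cast; rfl
    rw [e, ← Complex.ofReal_cpow (by positivity), ← Real.rpow_natCast _ 2,
      ← Real.rpow_mul (by positivity), ← Real.rpow_natCast _ (Module.finrank ℝ V)]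
    congr 2
    push_cast
    ring
  rw [hs, hp] at h
  rw [Complex.ofReal_mul, Complex.ofReal_exp]
  convert h using 1
  · congr 1; ext x
    rw [Complex.ofReal_exp, ← Complex.exp_add]
    congr 1
    push_cast
    ring
  · congr 2
    have : (σ : ℂ) ≠ 0 := by exact_mod_cast hσ.ne'
    rw [Complex.I_sq]
    push_cast
    field_simp
    ring

/-- The cosine splits the profile into plane waves, which shift the wave vector by ∓l. Dimensions
three and one are both instances. -/
theorem integral_gaussian_mul_cos_wave {V : Type*} [NormedAddCommGroup V] [InnerProductSpace ℝ V]
    [FiniteDimensional ℝ V] [MeasurableSpace V] [BorelSpace V] {σ : ℝ} (hσ : 0 < σ) (l k : V) :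
    ∫ x : V, ((1 / (√(2 * Real.pi) * σ) ^ Module.finrank ℝ V *
        Real.exp (-(‖x‖ ^ 2 / (2 * σ ^ 2))) * (2 * Real.cos (inner ℝ l x)) : ℝ) : ℂ) *
        Complex.exp (Complex.I * (inner ℝ k x : ℝ)) =
      ((Real.exp (-(σ ^ 2 * ‖k - l‖ ^ 2 / 2)) + Real.exp (-(σ ^ 2 * ‖k + l‖ ^ 2 / 2)) : ℝ) : ℂ) := by
  have hpi := Real.pi_pos
  set c : ℝ := (√(2 * Real.pi) * σ) ^ Module.finrank ℝ V with hc
  have hc0 : c ≠ 0 := by rw [hc]; positivity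
  have hpt : ∀ x : V, ((1 / c * Real.exp (-(‖x‖ ^ 2 / (2 * σ ^ 2))) *
      (2 * Real.cos (inner ℝ l x)) : ℝ) : ℂ) * Complex.exp (Complex.I * (inner ℝ k x : ℝ)) =
      (c : ℂ)⁻¹ * ((Real.exp (-(‖x‖ ^ 2 / (2 * σ ^ 2))) : ℂ) *
        Complex.exp (Complex.I * (inner ℝ (k - l) x : ℝ)) +
        (Real.exp (-(‖x‖ ^ 2 / (2 * σ ^ 2))) : ℂ) *
        Complex.exp (Complex.I * (inner ℝ (k + l) x : ℝ))) := by
    intro x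
    rw [inner_sub_left, inner_add_left]
    push_cast
    rw [Complex.cos, show Complex.I * (((inner ℝ k x : ℝ) : ℂ) - ((inner ℝ l x : ℝ) : ℂ)) =
      Complex.I * ((inner ℝ k x : ℝ) : ℂ) + -((inner ℝ l x : ℝ) : ℂ) * Complex.I by ring,
      show Complex.I * (((inner ℝ k x : ℝ) : ℂ) + ((inner ℝ l x : ℝ) : ℂ)) =
      Complex.I * ((inner ℝ k x : ℝ) : ℂ) + ((inner ℝ l x : ℝ) : ℂ) * Complex.I by ring,
      Complex.exp_add, Complex.exp_add]
    ring
  simp_rw [hpt]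
  rw [integral_const_mul, integral_add (integrable_gaussian_wave hσ _)
    (integrable_gaussian_wave hσ _), integral_gaussian_wave hσ, integral_gaussian_wave hσ, ← hc]
  have : (c : ℂ) ≠ 0 := by exact_mod_cast hc0
  push_cast
  field_simp

theorem minkowskiWindow_gaussianProfile {σ : ℝ} (l : Space) (hσ : 0 < σ) (k : Space) :
    minkowskiWindow (gaussianProfile σ l) k =
      ((Real.exp (-(σ ^ 2 * ‖k - l‖ ^ 2 / 2)) + Real.exp (-(σ ^ 2 * ‖k + l‖ ^ 2 / 2)) : ℝ) : ℂ) := by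
  have := integral_gaussian_mul_cos_wave hσ l k
  rw [finrank_euclideanSpace_fin] at this
  exact this

theorem rindlerWindowOne_gaussianRindlerProfile (a : ℝ) {σ : ℝ} (l : ℝ) (hσ : 0 < σ) (Ω : ℝ) :
    rindlerWindowOne a (gaussianRindlerProfile a σ l) Ω =
      ((Real.exp (-(σ ^ 2 * (l - Ω) ^ 2 / 2)) + Real.exp (-(σ ^ 2 * (l + Ω) ^ 2 / 2)) : ℝ) : ℂ) := by
  have h := integral_gaussian_mul_cos_wave hσ l Ω
  simp only [Module.finrank_self, pow_one, Real.norm_eq_abs, sq_abs] at h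
  rw [show (l - Ω) ^ 2 = (Ω - l) ^ 2 by ring, show l + Ω = Ω + l by ring, ← h, rindlerWindowOne]
  congr 1; ext ξ
  have e1 : Real.exp (2 * a * ξ) * gaussianRindlerProfile a σ l ξ =
      1 / (√(2 * Real.pi) * σ) * Real.exp (-(ξ ^ 2 / (2 * σ ^ 2))) * (2 * Real.cos (inner ℝ l ξ)) := by
    have : inner ℝ l ξ = l * ξ := by simp [mul_comm]
    rw [gaussianRindlerProfile, this]
    have : Real.exp (2 * a * ξ) * Real.exp (-(2 * a * ξ)) = 1 := by rw [← Real.exp_add]; simp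
    linear_combination (1 / (√(2 * Real.pi) * σ) * Real.exp (-(ξ ^ 2 / (2 * σ ^ 2))) *
      (2 * Real.cos (l * ξ))) * this
  rw [e1]
  congr 2
  simp
  ring

/-! ### An oscillatory integral -/

theorem continuous_of_hasDerivAt {u u' : ℝ → ℂ} (hu : ∀ y, HasDerivAt u (u' y) y) :
    Continuous u :=
  continuous_iff_continuousAt.2 fun y => (hu y).continuousAt

theorem norm_one_sub_mul_le {b v : ℂ} (hb : ‖b‖ ≤ 2) (hv : ‖v‖ ≤ 1) : ‖1 - b * (1 - v)‖ ≤ 5 := by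
  have h1 : ‖1 - v‖ ≤ 2 := (norm_sub_le _ _).trans (by rw [norm_one]; linarith)
  refine (norm_sub_le _ _).trans ?_
  rw [norm_mul, norm_one]
  nlinarith [norm_nonneg (1 - v), norm_nonneg b]

/-- Since (1 + q)v = 1 and E' = -qE, ∫ uE = ∫ uvE - ∫ uvE', and parts in the last term yields a
factor v that is harmless where q is small. The equation v' = -β(1 - v)v keeps v as a factor of the
new integrand, so the step can be iterated. -/
theorem integral_mul_oscillation {u u' E v q β : ℝ → ℂ} (hu : ∀ y, HasDerivAt u (u' y) y)
    (hE : ∀ y, HasDerivAt E (-(q y * E y)) y)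
    (hv : ∀ y, HasDerivAt v (-(β y * (1 - v y) * v y)) y) (hqv : ∀ y, q y * v y = 1 - v y)
    (hE1 : ∀ y, ‖E y‖ ≤ 1) (hv1 : ∀ y, ‖v y‖ ≤ 1) (hβ : ∀ y, ‖β y‖ ≤ 2) (hβc : Continuous β)
    (hui : Integrable u) (hui' : Integrable u') :
    ∫ y, u y * E y = ∫ y, v y * (u' y + u y * (1 - β y * (1 - v y))) * E y := by
  have hvc := continuous_of_hasDerivAt hv
  have hEc := continuous_of_hasDerivAt hE
  have hI : ∀ {w g : ℝ → ℂ} (M : ℝ), Integrable w → Continuous g → (∀ y, ‖g y‖ ≤ M) →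
      Integrable fun y => w y * g y := fun M hw hg hM =>
    hw.mul_bdd (c := M) hg.aestronglyMeasurable (Eventually.of_forall hM)
  have hvE : ∀ y, ‖v y * E y‖ ≤ 1 := fun y => by
    rw [norm_mul]; exact mul_le_one₀ (hv1 y) (norm_nonneg _) (hE1 y)
  have i1 : Integrable fun y => u y * E y := hI 1 hui hEc hE1
  have i2 : Integrable fun y => v y * (u' y + u y * (1 - β y * (1 - v y))) * E y := by
    have j1 := hI 1 hui' (hvc.mul hEc) hvE
    have j2 := hI (5 * 1) hui (by fun_prop : Continuous fun y =>
      (1 - β y * (1 - v y)) * (v y * E y)) (fun y => by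
        rw [norm_mul]
        exact mul_le_mul (norm_one_sub_mul_le (hβ y) (hv1 y)) (hvE y) (norm_nonneg _) (by norm_num))
    refine (j1.add j2).congr (Eventually.of_forall fun y => ?_)
    simp only [Pi.add_apply, Pi.mul_apply]
    ring
  have hd : ∀ y, HasDerivAt (fun y => u y * v y * E y)
      (v y * (u' y + u y * (1 - β y * (1 - v y))) * E y - u y * E y) y := by
    intro y
    refine (((hu y).mul (hv y)).mul (hE y)).congr_deriv ?_
    simp only [Pi.mul_apply]
    linear_combination (-(u y * E y)) * hqv y
  have i3 : Integrable fun y => u y * v y * E y :=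
    (hI 1 hui (hvc.mul hEc) hvE).congr (Eventually.of_forall fun y => by
      simp only [Pi.mul_apply]; ring)
  have := integral_eq_zero_of_hasDerivAt_of_integrable hd (i2.sub i1) i3
  rw [integral_sub i2 i1, sub_eq_zero] at this
  exact this.symm

/-- The preceding identity applied twice, the second time to vA. The factor |v|² gives quadratic
decay in q, enough for integrability in s. -/
theorem norm_integral_mul_oscillation_le {u u₁ u₂ E v q β β' : ℝ → ℂ}
    (hu : ∀ y, HasDerivAt u (u₁ y) y) (hu₁ : ∀ y, HasDerivAt u₁ (u₂ y) y)
    (hE : ∀ y, HasDerivAt E (-(q y * E y)) y)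
    (hv : ∀ y, HasDerivAt v (-(β y * (1 - v y) * v y)) y) (hqv : ∀ y, q y * v y = 1 - v y)
    (hE1 : ∀ y, ‖E y‖ ≤ 1) (hv1 : ∀ y, ‖v y‖ ≤ 1) (hβ : ∀ y, ‖β y‖ ≤ 2)
    (hβd : ∀ y, HasDerivAt β (β' y) y) (hβ' : ∀ y, ‖β' y‖ ≤ 2)
    (hui : Integrable u) (hui₁ : Integrable u₁) (hui₂ : Integrable u₂) (hβc' : Continuous β') :
    ‖∫ y, u y * E y‖ ≤ ∫ y, 57 * (‖u y‖ + ‖u₁ y‖ + ‖u₂ y‖) * ‖v y‖ ^ 2 := by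
  have hvc := continuous_of_hasDerivAt hv
  have huc := continuous_of_hasDerivAt hu
  have huc₁ := continuous_of_hasDerivAt hu₁
  have hβc := continuous_of_hasDerivAt hβd
  set A : ℝ → ℂ := fun y => u₁ y + u y * (1 - β y * (1 - v y)) with hA
  set B : ℝ → ℂ := fun y => -(β y * (1 - v y)) * A y + (u₂ y + u₁ y * (1 - β y * (1 - v y)) +
    u y * (-(β' y * (1 - v y)) + β y * -(β y * (1 - v y) * v y))) with hB
  have h1v : ∀ y, ‖1 - v y‖ ≤ 2 := fun y =>
    (norm_sub_le _ _).trans (by rw [norm_one]; linarith [hv1 y])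
  have hbv : ∀ y, ‖β y * (1 - v y)‖ ≤ 4 := fun y => by
    rw [norm_mul]; nlinarith [hβ y, h1v y, norm_nonneg (1 - v y), norm_nonneg (β y)]
  have hbv' : ∀ y, ‖β' y * (1 - v y)‖ ≤ 4 := fun y => by
    rw [norm_mul]; nlinarith [hβ' y, h1v y, norm_nonneg (1 - v y), norm_nonneg (β' y)]
  have hAb : ∀ y, ‖A y‖ ≤ ‖u₁ y‖ + 5 * ‖u y‖ := fun y => by
    refine (norm_add_le _ _).trans ?_
    rw [norm_mul]
    have := norm_one_sub_mul_le (hβ y) (hv1 y)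
    nlinarith [norm_nonneg (u y)]
  have hBb : ∀ y, ‖B y‖ ≤ ‖u₂ y‖ + 9 * ‖u₁ y‖ + 32 * ‖u y‖ := fun y => by
    have e1 : ‖-(β y * (1 - v y)) * A y‖ ≤ 4 * (‖u₁ y‖ + 5 * ‖u y‖) := by
      rw [norm_mul, norm_neg]
      exact mul_le_mul (hbv y) (hAb y) (norm_nonneg _) (by norm_num)
    have e2 : ‖u₁ y * (1 - β y * (1 - v y))‖ ≤ ‖u₁ y‖ * 5 := by
      rw [norm_mul]; gcongr; exact norm_one_sub_mul_le (hβ y) (hv1 y)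
    have e3 : ‖β y * -(β y * (1 - v y) * v y)‖ ≤ 2 * (4 * 1) := by
      rw [norm_mul, norm_neg, norm_mul]
      exact mul_le_mul (hβ y) (mul_le_mul (hbv y) (hv1 y) (norm_nonneg _) (by norm_num))
        (by positivity) (by norm_num)
    have e4 : ‖u y * (-(β' y * (1 - v y)) + β y * -(β y * (1 - v y) * v y))‖ ≤ ‖u y‖ * 12 := by
      rw [norm_mul]
      gcongr
      refine (norm_add_le _ _).trans ?_
      rw [norm_neg]
      linarith [hbv' y]
    refine (norm_add_le _ _).trans ?_
    have := (norm_add_le (u₂ y + u₁ y * (1 - β y * (1 - v y))) (u y * (-(β' y * (1 - v y)) +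
      β y * -(β y * (1 - v y) * v y)))).trans (add_le_add_left (norm_add_le _ _) _)
    linarith
  have hw : ∀ y, HasDerivAt (fun y => v y * A y) (v y * B y) y := by
    intro y
    have hA' := (hu₁ y).add ((hu y).mul ((hasDerivAt_const y (1 : ℂ)).sub
      ((hβd y).mul ((hasDerivAt_const y (1 : ℂ)).sub (hv y)))))
    refine ((hv y).mul hA').congr_deriv ?_
    simp only [hB, hA, Pi.mul_apply, Pi.sub_apply, Pi.add_apply]
    ring
  have hAi : Integrable A := by
    refine (hui₁.norm.add (hui.norm.const_mul 5)).mono' ?_ (Eventually.of_forall hAb)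
    exact (by fun_prop : Continuous A).aestronglyMeasurable
  have hAm := hAi.aestronglyMeasurable
  have hBm : AEStronglyMeasurable B volume := by
    refine AEStronglyMeasurable.add ?_ ((hui₂.aestronglyMeasurable.add ?_).add ?_)
    · exact (by fun_prop : Continuous fun y => -(β y * (1 - v y))).aestronglyMeasurable.mul hAm
    · exact (by fun_prop : Continuous fun y => u₁ y * (1 - β y * (1 - v y))).aestronglyMeasurable
    · exact (by fun_prop : Continuous fun y => u y * (-(β' y * (1 - v y)) +
        β y * -(β y * (1 - v y) * v y))).aestronglyMeasurable
  have hBi : Integrable B :=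
    ((hui₂.norm.add (hui₁.norm.const_mul 9)).add (hui.norm.const_mul 32)).mono' hBm
      (Eventually.of_forall hBb)
  have hbd : ∀ {w : ℝ → ℂ}, Integrable w → Integrable fun y => v y * w y := fun hw =>
    hw.bdd_mul (c := 1) hvc.aestronglyMeasurable (Eventually.of_forall hv1)
  rw [integral_mul_oscillation hu hE hv hqv hE1 hv1 hβ hβc hui hui₁,
    integral_mul_oscillation hw hE hv hqv hE1 hv1 hβ hβc (hbd hAi) (hbd hBi)]
  refine norm_integral_le_of_norm_le ?_ (Eventually.of_forall fun y => ?_)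
  · refine (((hui.norm.add hui₁.norm).add hui₂.norm).const_mul 57).mul_bdd (c := 1)
      (by fun_prop) (Eventually.of_forall fun y => ?_)
    rw [norm_pow, norm_norm]
    exact pow_le_one₀ (norm_nonneg _) (hv1 y)
  · have e : v y * (v y * B y + v y * A y * (1 - β y * (1 - v y))) * E y =
        (B y + A y * (1 - β y * (1 - v y))) * v y ^ 2 * E y := by ring
    rw [e, norm_mul, norm_mul, norm_pow]
    refine (mul_le_of_le_one_right (by positivity) (hE1 y)).trans ?_
    gcongr
    refine (norm_add_le _ _).trans ?_
    rw [norm_mul]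
    have h5 := norm_one_sub_mul_le (hβ y) (hv1 y)
    have : ‖A y‖ * ‖1 - β y * (1 - v y)‖ ≤ (‖u₁ y‖ + 5 * ‖u y‖) * 5 :=
      mul_le_mul (hAb y) h5 (norm_nonneg _) (by positivity)
    -- The coefficient of |u| is 32 from `B` plus 25 from five times `A`; the other two are smaller.
    linarith [hBb y, norm_nonneg (u y), norm_nonneg (u₁ y), norm_nonneg (u₂ y)]

/-! ### Radial waves in logarithmic coordinates -/

/-- The frequency at `|k| = e^y`. -/
def logFreq (m y : ℝ) : ℝ := √(Real.exp y ^ 2 + m ^ 2)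

theorem logFreq_pos (m y : ℝ) : 0 < logFreq m y :=
  Real.sqrt_pos.2 (by have := Real.exp_pos y; positivity)

theorem logFreq_sq (m y : ℝ) : logFreq m y ^ 2 = Real.exp y ^ 2 + m ^ 2 :=
  Real.sq_sqrt (by positivity)

theorem hasDerivAt_logFreq (m y : ℝ) :
    HasDerivAt (logFreq m) (Real.exp y ^ 2 / logFreq m y) y := by
  have h := (((Real.hasDerivAt_exp y).pow 2).add_const (m ^ 2)).sqrt
    (by have := Real.exp_pos y; simp only [Pi.pow_apply]; positivity)
  refine h.congr_deriv ?_
  have := logFreq_pos m y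
  simp only [Pi.pow_apply, Nat.add_one_sub_one, pow_one, Nat.cast_ofNat]
  rw [← logFreq]
  field_simp

/-- The squared velocity `|k|² / ω²` at `|k| = e^y`. -/
def logVel (m y : ℝ) : ℝ := Real.exp y ^ 2 / logFreq m y ^ 2

theorem logVel_nonneg (m y : ℝ) : 0 ≤ logVel m y := by unfold logVel; positivity

theorem logVel_le_one (m y : ℝ) : logVel m y ≤ 1 := by
  have := logFreq_pos m y
  rw [logVel, div_le_one (by positivity), logFreq_sq]
  nlinarith [sq_nonneg m]

theorem hasDerivAt_logVel (m y : ℝ) :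
    HasDerivAt (logVel m) (2 * logVel m y * (1 - logVel m y)) y := by
  have hω := logFreq_pos m y
  have h := ((Real.hasDerivAt_exp y).pow 2).div ((hasDerivAt_logFreq m y).pow 2)
    (pow_ne_zero 2 hω.ne')
  refine h.congr_deriv ?_
  simp only [logVel, Pi.pow_apply, Nat.add_one_sub_one, pow_one, Nat.cast_ofNat]
  field_simp

/-- The density `|k|³ / ω` at `|k| = e^y`. -/
def logDensity (m y : ℝ) : ℝ := Real.exp y ^ 3 / logFreq m y

theorem logDensity_nonneg (m y : ℝ) : 0 ≤ logDensity m y := by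
  have := logFreq_pos m y
  unfold logDensity; positivity

theorem hasDerivAt_logDensity (m y : ℝ) :
    HasDerivAt (logDensity m) (logDensity m y * (3 - logVel m y)) y := by
  have hω := logFreq_pos m y
  have h := ((Real.hasDerivAt_exp y).pow 3).div (hasDerivAt_logFreq m y) hω.ne'
  refine h.congr_deriv ?_
  simp only [logDensity, logVel, Pi.pow_apply]
  field_simp
  ring

theorem exp_le_logFreq (m y : ℝ) : Real.exp y ≤ logFreq m y :=
  Real.le_sqrt_of_sq_le (by nlinarith [sq_nonneg m])

theorem logDensity_le (m y : ℝ) : logDensity m y ≤ Real.exp y ^ 2 := by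
  have hω := logFreq_pos m y
  have := exp_le_logFreq m y
  rw [logDensity, div_le_iff₀ hω, pow_succ]
  gcongr

/-- The left side is 1/(2 cosh y), the case z = 1 of `inv_sqrt_sinh_le`. -/
theorem exp_div_le (y : ℝ) : Real.exp y / (1 + Real.exp y ^ 2) ≤ 8 / (1 + y ^ 2) := by
  have h := inv_sqrt_sinh_le one_pos y
  rw [one_mul, add_comm, ← Real.cosh_sq, Real.sqrt_sq (Real.cosh_pos y).le, Real.log_one] at h
  have h2 : Real.exp y / (1 + Real.exp y ^ 2) = (Real.cosh y)⁻¹ / 2 := by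
    rw [Real.cosh_eq, Real.exp_neg]
    have := Real.exp_pos y
    field_simp
    ring
  rw [h2]
  have := inv_pos.2 (Real.cosh_pos y)
  have h3 : 8 * (1 + (0 : ℝ) ^ 2) / (1 + y ^ 2) = 8 / (1 + y ^ 2) := by norm_num
  linarith

theorem exp_div_sq_le (y : ℝ) : Real.exp y / (1 + Real.exp y ^ 2) ^ 2 ≤ 8 / (1 + y ^ 2) := by
  refine le_trans ?_ (exp_div_le y)
  have := Real.exp_pos y
  gcongr
  nlinarith [sq_nonneg (Real.exp y)]

theorem logDensity_div_le (m y : ℝ) :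
    logDensity m y / (1 + Real.exp y ^ 2) ^ 2 ≤ 8 / (1 + y ^ 2) := by
  have h0 := Real.exp_pos y
  refine le_trans ?_ (exp_div_le y)
  rw [div_le_div_iff₀ (by positivity) (by positivity)]
  have := logDensity_le m y
  have h1 : Real.exp y ≤ 1 + Real.exp y ^ 2 := by nlinarith [sq_nonneg (Real.exp y - 1)]
  calc logDensity m y * (1 + Real.exp y ^ 2) ≤ Real.exp y ^ 2 * (1 + Real.exp y ^ 2) := by gcongr
    _ = Real.exp y * Real.exp y * (1 + Real.exp y ^ 2) := by ring
    _ ≤ Real.exp y * (1 + Real.exp y ^ 2) * (1 + Real.exp y ^ 2) := by gcongr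
    _ = _ := by ring

theorem continuous_logDensity (m : ℝ) : Continuous (logDensity m) :=
  continuous_iff_continuousAt.2 fun y => (hasDerivAt_logDensity m y).continuousAt

theorem continuous_logFreq (m : ℝ) : Continuous (logFreq m) :=
  continuous_iff_continuousAt.2 fun y => (hasDerivAt_logFreq m y).continuousAt

theorem continuous_logVel (m : ℝ) : Continuous (logVel m) :=
  continuous_iff_continuousAt.2 fun y => (hasDerivAt_logVel m y).continuousAt

/-- A bound for the oscillatory radial integrals. -/
def waveDecay (m s y : ℝ) : ℝ :=
  logDensity m y / (1 + Real.exp y ^ 2) ^ 2 * (1 + (s * (Real.exp y ^ 2 / logFreq m y)) ^ 2)⁻¹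

/-- Here q = is|k|²/ω is the y-derivative of isω, and q' = βq with β = 2 - |k|²/ω² and |β|, |β'| ≤
2. Derivatives of the density are the density times polynomials in the bounded `logVel`, so the
constants do not depend on m. -/
theorem norm_integral_radial_wave_le (m s M : ℝ) {F₀ F₁ F₂ : ℝ → ℂ}
    (h₀ : ∀ y, HasDerivAt F₀ (F₁ y) y) (h₁ : ∀ y, HasDerivAt F₁ (F₂ y) y) (hF₂ : Continuous F₂)
    (hM : ∀ y, ‖F₀ y‖ + ‖F₁ y‖ + ‖F₂ y‖ ≤ M / (1 + Real.exp y ^ 2) ^ 2) :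
    ‖∫ y, (logDensity m y * F₀ y) * Complex.exp (-(Complex.I * s * logFreq m y))‖ ≤
      57 * 20 * M * ∫ y, waveDecay m s y := by
  have hc₀ := continuous_of_hasDerivAt h₀
  have hc₁ := continuous_of_hasDerivAt h₁
  have hμc := continuous_logDensity m
  have hbc := continuous_logVel m
  set u : ℝ → ℂ := fun y => logDensity m y * F₀ y with hu
  set u₁ : ℝ → ℂ := fun y => logDensity m y * ((3 - logVel m y) * F₀ y + F₁ y) with hu₁
  set u₂ : ℝ → ℂ := fun y => logDensity m y * ((3 - logVel m y) * ((3 - logVel m y) * F₀ y + F₁ y) +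
    (-(2 * logVel m y * (1 - logVel m y)) * F₀ y + (3 - logVel m y) * F₁ y + F₂ y)) with hu₂
  set q : ℝ → ℂ := fun y => Complex.I * ((s * (Real.exp y ^ 2 / logFreq m y) : ℝ) : ℂ) with hq
  set v : ℝ → ℂ := fun y => (1 + q y)⁻¹ with hv
  set β : ℝ → ℂ := fun y => ((2 - logVel m y : ℝ) : ℂ) with hβ
  set β' : ℝ → ℂ := fun y => ((-(2 * logVel m y * (1 - logVel m y)) : ℝ) : ℂ) with hβ'
  set E : ℝ → ℂ := fun y => Complex.exp (-(Complex.I * s * logFreq m y)) with hE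
  have hqre : ∀ y, (q y).re = 0 := fun y => by
    simp only [hq, Complex.mul_re, Complex.I_re, Complex.I_im, Complex.ofReal_re,
      Complex.ofReal_im]
    ring
  have hqne : ∀ y, 1 + q y ≠ 0 := fun y => one_add_ne_zero (hqre y).ge
  have hqv : ∀ y, q y * v y = 1 - v y := fun y => by
    have := hqne y
    simp only [hv]
    field_simp
    ring
  have hv1 : ∀ y, ‖v y‖ ≤ 1 := fun y => by
    simp only [hv]
    rw [norm_inv]
    exact inv_le_one_of_one_le₀ (one_le_norm_one_add (hqre y).ge)
  have hv2 : ∀ y, ‖v y‖ ^ 2 = (1 + (s * (Real.exp y ^ 2 / logFreq m y)) ^ 2)⁻¹ := fun y => by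
    simp only [hv]
    rw [norm_inv, inv_pow, Complex.sq_norm, Complex.normSq_apply, hq]
    congr 1
    simp only [Complex.add_re, Complex.add_im, Complex.one_re, Complex.one_im, Complex.mul_re,
      Complex.mul_im, Complex.I_re, Complex.I_im, Complex.ofReal_re, Complex.ofReal_im]
    ring
  have dq : ∀ y, HasDerivAt q (β y * q y) y := fun y => by
    have hω := logFreq_pos m y
    have h := (((((Real.hasDerivAt_exp y).pow 2).div (hasDerivAt_logFreq m y) hω.ne').const_mul
      s).ofReal_comp).const_mul Complex.I
    refine h.congr_deriv ?_
    simp only [hβ, hq, logVel, Pi.pow_apply]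
    rw [mul_left_comm, ← Complex.ofReal_mul]
    congr 2
    field_simp
    ring
  have dv : ∀ y, HasDerivAt v (-(β y * (1 - v y) * v y)) y := fun y => by
    refine (((dq y).const_add 1).inv (hqne y)).congr_deriv ?_
    rw [← hqv y]
    have := hqne y
    simp only [hv]
    field_simp
  have dE : ∀ y, HasDerivAt E (-(q y * E y)) y := fun y => by
    refine ((((hasDerivAt_logFreq m y).ofReal_comp.const_mul (Complex.I * s)).neg).cexp).congr_deriv ?_
    simp only [hE, hq, Pi.neg_apply]
    push_cast
    ring
  have dβ : ∀ y, HasDerivAt β (β' y) y := fun y =>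
    ((hasDerivAt_logVel m y).const_sub 2).ofReal_comp
  have dμ := fun y => (hasDerivAt_logDensity m y).ofReal_comp
  have du : ∀ y, HasDerivAt u (u₁ y) y := fun y => by
    refine ((dμ y).mul (h₀ y)).congr_deriv ?_
    simp only [hu₁]
    push_cast
    ring
  have db := fun y => ((hasDerivAt_logVel m y).const_sub 3).ofReal_comp
  have du₁ : ∀ y, HasDerivAt u₁ (u₂ y) y := fun y => by
    have h := (dμ y).mul (((db y).mul (h₀ y)).add (h₁ y))
    have hfun : u₁ = (fun y => (logDensity m y : ℂ)) *
        ((fun y => ((3 - logVel m y : ℝ) : ℂ)) * F₀ + F₁) := by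
      ext y; simp [hu₁]
    rw [hfun]
    refine h.congr_deriv ?_
    simp only [hu₂, Pi.mul_apply, Pi.add_apply]
    push_cast
    ring
  have hb0 := logVel_nonneg m
  have hb1 := logVel_le_one m
  have hμ0 := logDensity_nonneg m
  have n1 : ∀ y, ‖(3 - logVel m y : ℂ)‖ ≤ 3 := fun y => by
    rw [show (3 - logVel m y : ℂ) = ((3 - logVel m y : ℝ) : ℂ) by push_cast; rfl, Complex.norm_real,
      Real.norm_of_nonneg (by linarith [hb1 y])]
    linarith [hb0 y]
  have n2 : ∀ y, ‖-(2 * logVel m y * (1 - logVel m y) : ℂ)‖ ≤ 2 := fun y => by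
    rw [norm_neg, show (2 * logVel m y * (1 - logVel m y) : ℂ) =
      ((2 * logVel m y * (1 - logVel m y) : ℝ) : ℂ) by push_cast; rfl, Complex.norm_real,
      Real.norm_of_nonneg (mul_nonneg (by linarith [hb0 y]) (by linarith [hb1 y]))]
    nlinarith [hb0 y, hb1 y]
  have nμ : ∀ y, ‖(logDensity m y : ℂ)‖ = logDensity m y := fun y => by
    rw [Complex.norm_real, Real.norm_of_nonneg (hμ0 y)]
  have b0 : ∀ y, ‖u y‖ = logDensity m y * ‖F₀ y‖ := fun y => by
    simp only [hu]; rw [norm_mul, nμ]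
  have a1 : ∀ y, ‖(3 - logVel m y) * F₀ y + F₁ y‖ ≤ 3 * ‖F₀ y‖ + ‖F₁ y‖ := fun y => by
    refine (norm_add_le _ _).trans ?_
    rw [norm_mul]
    gcongr
    exact n1 y
  have b1 : ∀ y, ‖u₁ y‖ ≤ logDensity m y * (3 * ‖F₀ y‖ + ‖F₁ y‖) := fun y => by
    simp only [hu₁]; rw [norm_mul, nμ]
    exact mul_le_mul_of_nonneg_left (a1 y) (hμ0 y)
  have b2 : ∀ y, ‖u₂ y‖ ≤ logDensity m y * (11 * ‖F₀ y‖ + 6 * ‖F₁ y‖ + ‖F₂ y‖) := fun y => by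
    simp only [hu₂]; rw [norm_mul, nμ]
    refine mul_le_mul_of_nonneg_left ?_ (hμ0 y)
    have c1 : ‖(3 - logVel m y : ℂ) * ((3 - logVel m y) * F₀ y + F₁ y)‖ ≤
        3 * (3 * ‖F₀ y‖ + ‖F₁ y‖) := by
      rw [norm_mul]; exact mul_le_mul (n1 y) (a1 y) (norm_nonneg _) (by norm_num)
    have c2 : ‖-(2 * logVel m y * (1 - logVel m y) : ℂ) * F₀ y‖ ≤ 2 * ‖F₀ y‖ := by
      rw [norm_mul]; gcongr; exact n2 y
    have c3 : ‖(3 - logVel m y : ℂ) * F₁ y‖ ≤ 3 * ‖F₁ y‖ := by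
      rw [norm_mul]; gcongr; exact n1 y
    refine (norm_add_le _ _).trans ?_
    have c4 := norm_add_le (-(2 * logVel m y * (1 - logVel m y) : ℂ) * F₀ y +
      (3 - logVel m y) * F₁ y) (F₂ y)
    have c5 := norm_add_le (-(2 * logVel m y * (1 - logVel m y) : ℂ) * F₀ y)
      ((3 - logVel m y) * F₁ y)
    linarith
  -- The coefficients of |F₀|, |F₁|, |F₂| are 1 + 3 + 11, 1 + 6 and 1, all at most 20.
  have hsum : ∀ y, ‖u y‖ + ‖u₁ y‖ + ‖u₂ y‖ ≤
      20 * M * (logDensity m y / (1 + Real.exp y ^ 2) ^ 2) := fun y => by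
    have h1 : logDensity m y * (‖F₀ y‖ + ‖F₁ y‖ + ‖F₂ y‖) ≤
        logDensity m y * (M / (1 + Real.exp y ^ 2) ^ 2) :=
      mul_le_mul_of_nonneg_left (hM y) (hμ0 y)
    have h2 := mul_nonneg (hμ0 y) (norm_nonneg (F₀ y))
    have h3 := mul_nonneg (hμ0 y) (norm_nonneg (F₁ y))
    have h4 := mul_nonneg (hμ0 y) (norm_nonneg (F₂ y))
    calc _ ≤ 20 * (logDensity m y * (‖F₀ y‖ + ‖F₁ y‖ + ‖F₂ y‖)) := by
          rw [b0]; linarith [b1 y, b2 y]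
      _ ≤ 20 * (logDensity m y * (M / (1 + Real.exp y ^ 2) ^ 2)) := by linarith
      _ = _ := by ring
  have hM0 : 0 ≤ M := by
    have := (add_nonneg (add_nonneg (norm_nonneg (F₀ 0)) (norm_nonneg (F₁ 0)))
      (norm_nonneg (F₂ 0))).trans (hM 0)
    by_contra hneg
    exact absurd this (not_le.2 (div_neg_of_neg_of_pos (not_le.1 hneg) (by positivity)))
  have hmaj : ∀ y, ‖u y‖ + ‖u₁ y‖ + ‖u₂ y‖ ≤ 20 * M * 8 / (1 + y ^ 2) := fun y => by
    refine (hsum y).trans ?_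
    rw [mul_div_assoc]
    exact mul_le_mul_of_nonneg_left (logDensity_div_le m y) (by positivity)
  have hint := integrable_inv_one_add_sq_mul (20 * M * 8)
  have cu := continuous_of_hasDerivAt du
  have cu₁ := continuous_of_hasDerivAt du₁
  have cu₂ : Continuous u₂ := by rw [hu₂]; fun_prop
  have i0 : Integrable u := hint.mono' cu.aestronglyMeasurable (Eventually.of_forall fun y => by
    linarith [hmaj y, norm_nonneg (u₁ y), norm_nonneg (u₂ y)])
  have i1 : Integrable u₁ := hint.mono' cu₁.aestronglyMeasurable (Eventually.of_forall fun y => by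
    linarith [hmaj y, norm_nonneg (u y), norm_nonneg (u₂ y)])
  have i2 : Integrable u₂ := hint.mono' cu₂.aestronglyMeasurable (Eventually.of_forall fun y => by
    linarith [hmaj y, norm_nonneg (u y), norm_nonneg (u₁ y)])
  refine (norm_integral_mul_oscillation_le du du₁ dE dv hqv (fun y => ?_) hv1 (fun y => ?_) dβ
    (fun y => ?_) i0 i1 i2 (by rw [hβ']; fun_prop)).trans ?_
  · simp only [hE]; rw [Complex.norm_exp]; simp
  · simp only [hβ]
    rw [Complex.norm_real, Real.norm_of_nonneg (by linarith [hb1 y])]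
    linarith [hb0 y]
  · have := n2 y
    simp only [hβ']
    push_cast
    exact this
  · rw [← integral_const_mul]
    refine integral_mono_of_nonneg (Eventually.of_forall fun y => by positivity) ?_
      (Eventually.of_forall fun y => ?_)
    · refine Integrable.const_mul ?_ _
      refine (integrable_inv_one_add_sq_mul 8).mono' ?_ (Eventually.of_forall fun y => ?_)
      · have hωc := continuous_logFreq m
        refine Measurable.aestronglyMeasurable ?_
        have h1 := hμc.measurable
        have h2 := hωc.measurable
        unfold waveDecay
        fun_prop
      · have h1 := div_nonneg (hμ0 y) (by positivity : 0 ≤ (1 + Real.exp y ^ 2) ^ 2)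
        unfold waveDecay
        rw [Real.norm_of_nonneg (mul_nonneg h1 (by positivity))]
        refine (mul_le_of_le_one_right h1 (inv_le_one_of_one_le₀ ?_)).trans (logDensity_div_le m y)
        nlinarith [sq_nonneg (s * (Real.exp y ^ 2 / logFreq m y))]
    · simp only [hv2]
      unfold waveDecay
      calc _ ≤ 57 * (20 * M * (logDensity m y / (1 + Real.exp y ^ 2) ^ 2)) *
            (1 + (s * (Real.exp y ^ 2 / logFreq m y)) ^ 2)⁻¹ := by
            gcongr
            exact hsum y
        _ = _ := by ring

/-- Integrating over s first gives πω/|k|², which turns the density |k|³/ω into |k|; then |k|/(1 +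
|k|²)² is integrable in y = log|k|. The frequency cancels, so massive and massless fields are
treated alike. -/
theorem integrable_integral_waveDecay (m : ℝ) : Integrable fun s => ∫ y, waveDecay m s y := by
  have hμ0 := logDensity_nonneg m
  have hm : Measurable fun x : ℝ × ℝ => waveDecay m x.1 x.2 := by
    have h1 := (continuous_logDensity m).measurable
    have h2 := (continuous_logFreq m).measurable
    unfold waveDecay
    fun_prop
  have hc : ∀ y, 0 < Real.exp y ^ 2 / logFreq m y := fun y =>
    div_pos (pow_pos (Real.exp_pos y) 2) (logFreq_pos m y)
  have hprod : Integrable (fun x : ℝ × ℝ => waveDecay m x.1 x.2) (volume.prod volume) := by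
    rw [integrable_prod_iff' hm.aestronglyMeasurable]
    refine ⟨Eventually.of_forall fun y => ?_, ?_⟩
    · exact (integrable_inv_one_add_sq.comp_mul_right' (hc y).ne').const_mul
        (logDensity m y / (1 + Real.exp y ^ 2) ^ 2)
    · have hint : ∀ y, ∫ s, ‖waveDecay m s y‖ = Real.pi * (Real.exp y / (1 + Real.exp y ^ 2) ^ 2) := by
        intro y
        have hnn : ∀ s, ‖waveDecay m s y‖ = waveDecay m s y := fun s =>
          Real.norm_of_nonneg (mul_nonneg (div_nonneg (hμ0 y) (by positivity)) (by positivity))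
        simp_rw [hnn]
        unfold waveDecay
        rw [integral_const_mul, Measure.integral_comp_mul_right (fun x => (1 + x ^ 2)⁻¹),
          integral_univ_inv_one_add_sq, abs_of_pos (inv_pos.2 (hc y)), smul_eq_mul, logDensity]
        have := Real.exp_pos y
        have := logFreq_pos m y
        field_simp
      simp_rw [hint]
      refine Integrable.const_mul ?_ _
      refine (integrable_inv_one_add_sq_mul 8).mono' (Measurable.aestronglyMeasurable
        (by fun_prop)) (Eventually.of_forall fun y => ?_)
      rw [Real.norm_of_nonneg (by have := Real.exp_pos y; positivity)]
      exact exp_div_sq_le y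
  exact hprod.integral_prod_left

/-! ### Logarithmic polar coordinates -/

theorem integral_Ioi_eq_integral_exp {F : Type*} [NormedAddCommGroup F] [NormedSpace ℝ F]
    (g : ℝ → F) : ∫ r in Ioi (0 : ℝ), g r = ∫ y, Real.exp y • g (Real.exp y) := by
  have h := integral_image_eq_integral_abs_deriv_smul MeasurableSet.univ
    (fun y _ => (Real.hasDerivAt_exp y).hasDerivWithinAt) Real.exp_injective.injOn g
  simpa [image_univ, Real.range_exp, abs_of_pos (Real.exp_pos _)] using h

theorem integral_volumeIoiPow_two (g : ℝ → ℂ) :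
    ∫ r : Ioi (0 : ℝ), g r ∂(Measure.volumeIoiPow 2) =
      ∫ y : ℝ, ((Real.exp y ^ 3 : ℝ) : ℂ) * g (Real.exp y) := by
  have h1 : ∫ r : Ioi (0 : ℝ), g r ∂(Measure.volumeIoiPow 2) =
      ∫ r in Ioi (0 : ℝ), r ^ 2 • g r := by
    simp only [Measure.volumeIoiPow, ENNReal.ofReal]
    rw [integral_withDensity_eq_integral_smul,
      integral_subtype_comap measurableSet_Ioi fun a ↦ Real.toNNReal (a ^ 2) • g a,
      setIntegral_congr_fun measurableSet_Ioi fun x hx ↦ ?_]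
    · rw [NNReal.smul_def, Real.coe_toNNReal _ (pow_nonneg hx.out.le _)]
    · exact (measurable_subtype_coe.pow_const _).real_toNNReal
  rw [h1, integral_Ioi_eq_integral_exp]
  congr 1; ext y
  rw [smul_smul, Complex.real_smul]
  congr 2
  ring

/-- Polar coordinates on the complement of the origin, with r² dr = e^{3y} dy. -/
theorem integral_logPolar {Φ : Space → ℂ} (hΦ : Integrable Φ) :
    ∫ k, Φ k = ∫ Θ : Metric.sphere (0 : Space) 1,
      (∫ y : ℝ, ((Real.exp y ^ 3 : ℝ) : ℂ) * Φ (Real.exp y • (Θ : Space)))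
        ∂(volume : Measure Space).toSphere := by
  have hmp := (volume : Measure Space).measurePreserving_homeomorphUnitSphereProd
  have hdim : Module.finrank ℝ Space - 1 = 2 := by simp
  rw [hdim] at hmp
  have hemb := (homeomorphUnitSphereProd Space).measurableEmbedding
  set g : Metric.sphere (0 : Space) 1 × Ioi (0 : ℝ) → ℂ := fun p => Φ (p.2.1 • p.1.1) with hg
  have hcomp : ∀ x : ({(0 : Space)}ᶜ : Set Space), g (homeomorphUnitSphereProd Space x) = Φ x := by
    intro x
    have := congrArg Subtype.val ((homeomorphUnitSphereProd Space).symm_apply_apply x)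
    rw [homeomorphUnitSphereProd_symm_apply_coe] at this
    simp only [hg, this]
  have hi : Integrable (fun x : ({(0 : Space)}ᶜ : Set Space) => Φ x)
      ((volume : Measure Space).comap Subtype.val) :=
    (integrableOn_iff_comap_subtypeVal (measurableSet_singleton _).compl).1 hΦ.integrableOn
  have hgi : Integrable g ((volume : Measure Space).toSphere.prod (Measure.volumeIoiPow 2)) := by
    rw [← hmp.integrable_comp_emb hemb]
    exact hi.congr (Eventually.of_forall fun x => (hcomp x).symm)
  calc ∫ k, Φ k = ∫ x : ({(0 : Space)}ᶜ : Set Space), Φ x ∂((volume : Measure Space).comap Subtype.val) := by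
        rw [integral_subtype_comap (measurableSet_singleton _).compl Φ, restrict_compl_singleton]
    _ = ∫ p, g p ∂((volume : Measure Space).toSphere.prod (Measure.volumeIoiPow 2)) := by
        rw [← hmp.integral_comp hemb]
        simp_rw [hcomp]
    _ = _ := by
        rw [integral_prod _ hgi]
        congr 1; ext Θ
        exact integral_volumeIoiPow_two fun r => Φ (r • Θ.1)

/-! ### Schwartz functions along rays -/

/-- The radial derivative `k·∇F`. -/
def radialDeriv (F : 𝓢(Space, ℂ)) : 𝓢(Space, ℂ) :=
  SchwartzMap.bilinLeftCLM (ContinuousLinearMap.id ℝ (Space →L[ℝ] ℂ))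
    (g := fun k : Space => k) (by fun_prop) (SchwartzMap.fderivCLM ℝ Space ℂ F)

/-- In y = log|k| the derivative along a ray is the Euler operator k·∇, which preserves Schwartz
functions; this makes the bounds uniform in the direction. -/
theorem hasDerivAt_ray (F : 𝓢(Space, ℂ)) (Θ : Space) (y : ℝ) :
    HasDerivAt (fun y => F (Real.exp y • Θ)) (radialDeriv F (Real.exp y • Θ)) y := by
  have h := (F.hasFDerivAt (Real.exp y • Θ)).comp_hasDerivAt y
    ((Real.hasDerivAt_exp y).smul_const Θ)
  exact h

theorem exists_schwartz_decay (F : 𝓢(Space, ℂ)) :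
    ∃ M : ℝ, ∀ k, ‖F k‖ ≤ M / (1 + ‖k‖ ^ 2) ^ 2 := by
  refine ⟨2 * (SchwartzMap.seminorm ℝ 0 0 F + SchwartzMap.seminorm ℝ 4 0 F), fun k => ?_⟩
  have h0 := SchwartzMap.norm_pow_mul_le_seminorm ℝ F 0 k
  have h4 := SchwartzMap.norm_pow_mul_le_seminorm ℝ F 4 k
  rw [le_div_iff₀ (by positivity)]
  have : (1 + ‖k‖ ^ 2) ^ 2 ≤ 2 * (1 + ‖k‖ ^ 4) := by nlinarith [sq_nonneg (‖k‖ ^ 2 - 1)]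
  nlinarith [mul_le_mul_of_nonneg_left this (norm_nonneg (F k))]

/-! ### The inertial Wightman function -/

theorem omega_nonneg (m : ℝ) (k : Space) : 0 ≤ omega m k := Real.sqrt_nonneg _

theorem inv_omega_le (m : ℝ) {k : Space} (hk : k ≠ 0) : (omega m k)⁻¹ ≤ ‖k‖⁻¹ := by
  refine inv_anti₀ (norm_pos_iff.2 hk) (Real.le_sqrt_of_sq_le ?_)
  nlinarith [sq_nonneg m]

theorem integrable_radial_space :
    Integrable fun k : Space => ‖k‖⁻¹ / (1 + ‖k‖ ^ 2) ^ 2 := by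
  have h := integrable_fun_norm_addHaar (volume : Measure Space)
    (f := fun r : ℝ => r⁻¹ / (1 + r ^ 2) ^ 2)
  rw [h]
  refine (integrable_inv_one_add_sq_mul 1).integrableOn.mono' ?_ ?_
  · exact Measurable.aestronglyMeasurable (by fun_prop)
  · filter_upwards [ae_restrict_mem measurableSet_Ioi] with r hr
    have hr : 0 < r := hr
    rw [Real.norm_of_nonneg (by positivity)]
    simp only [finrank_euclideanSpace, Fintype.card_fin, smul_eq_mul, Nat.add_one_sub_one]
    rw [mul_div_assoc', div_le_div_iff₀ (by positivity) (by positivity)]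
    have : r ^ 2 * r⁻¹ = r := by field_simp
    rw [this]
    nlinarith [sq_nonneg (r - 1), sq_nonneg r]

theorem integrable_inv_omega_mul (m : ℝ) (F : 𝓢(Space, ℂ)) :
    Integrable fun k => ((omega m k)⁻¹ : ℂ) * F k := by
  obtain ⟨M, hM⟩ := exists_schwartz_decay F
  have hω := (continuous_omega m).measurable
  refine (integrable_radial_space.const_mul M).mono' ?_ ?_
  · exact (Measurable.aestronglyMeasurable (by fun_prop)).mul F.continuous.aestronglyMeasurable
  · have : ∀ᵐ k : Space, k ≠ 0 := by simp [ae_iff]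
    filter_upwards [this] with k hk
    rw [norm_mul, norm_inv, Complex.norm_real, Real.norm_of_nonneg (omega_nonneg m k)]
    refine (mul_le_mul (inv_omega_le m hk) (hM k) (norm_nonneg _) (by positivity)).trans
      (le_of_eq ?_)
    ring

/-- `∫ d³k F(k) exp(-i ω s) / ω`. -/
def waveIntegral (m : ℝ) (F : Space → ℂ) (s : ℝ) : ℂ :=
  ∫ k, Complex.exp (-(Complex.I * s * omega m k)) * (((omega m k)⁻¹ : ℂ) * F k)

theorem integrable_waveIntegrand (m : ℝ) (F : 𝓢(Space, ℂ)) (s : ℝ) :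
    Integrable fun k => Complex.exp (-(Complex.I * s * omega m k)) * (((omega m k)⁻¹ : ℂ) * F k) := by
  have hω := continuous_omega m
  refine (integrable_inv_omega_mul m F).bdd_mul (c := 1)
    (Continuous.aestronglyMeasurable (by fun_prop)) (Eventually.of_forall fun k => ?_)
  rw [Complex.norm_exp]; simp

theorem continuous_waveIntegral (m : ℝ) (F : 𝓢(Space, ℂ)) : Continuous (waveIntegral m F) := by
  refine continuous_of_dominated (bound := fun k => ‖((omega m k)⁻¹ : ℂ) * F k‖)
    (fun s => (integrable_waveIntegrand m F s).aestronglyMeasurable)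
    (fun s => Eventually.of_forall fun k => ?_) (integrable_inv_omega_mul m F).norm
    (Eventually.of_forall fun k => by fun_prop)
  rw [norm_mul, Complex.norm_exp]; simp

/-- The bound on each ray does not depend on the direction, and the unit sphere has finite area. -/
theorem integrable_waveIntegral (m : ℝ) (F : 𝓢(Space, ℂ)) : Integrable (waveIntegral m F) := by
  obtain ⟨M₀, hM₀⟩ := exists_schwartz_decay F
  obtain ⟨M₁, hM₁⟩ := exists_schwartz_decay (radialDeriv F)
  obtain ⟨M₂, hM₂⟩ := exists_schwartz_decay (radialDeriv (radialDeriv F))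
  set A := (volume : Measure Space).toSphere.real univ with hA
  refine ((integrable_integral_waveDecay m).const_mul (57 * 20 * (M₀ + M₁ + M₂) * A)).mono'
    (continuous_waveIntegral m F).aestronglyMeasurable (Eventually.of_forall fun s => ?_)
  rw [waveIntegral, integral_logPolar (integrable_waveIntegrand m F s)]
  refine (norm_integral_le_of_norm_le_const (C := 57 * 20 * (M₀ + M₁ + M₂) * ∫ y, waveDecay m s y)
    (Eventually.of_forall fun Θ => ?_)).trans (le_of_eq (by ring))
  have hn : ∀ y : ℝ, ‖Real.exp y • (Θ : Space)‖ = Real.exp y := fun y => by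
    rw [norm_smul, norm_eq_of_mem_sphere, mul_one, Real.norm_of_nonneg (Real.exp_pos y).le]
  have hω : ∀ y : ℝ, omega m (Real.exp y • (Θ : Space)) = logFreq m y := fun y => by
    rw [omega, hn, logFreq]
  have hwave := norm_integral_radial_wave_le m s (M₀ + M₁ + M₂) (hasDerivAt_ray F Θ)
    (hasDerivAt_ray (radialDeriv F) Θ) (by
      exact (radialDeriv (radialDeriv F)).continuous.comp (by fun_prop)) (fun y => by
      have h0 := hM₀ (Real.exp y • (Θ : Space))
      have h1 := hM₁ (Real.exp y • (Θ : Space))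
      have h2 := hM₂ (Real.exp y • (Θ : Space))
      rw [hn] at h0 h1 h2
      rw [add_div, add_div]
      linarith)
  refine le_trans (le_of_eq ?_) hwave
  congr 2
  ext y
  rw [hω, logDensity]
  push_cast
  ring

/-- The transform `∫ h(x) exp(-i k·x) d³x` as a Schwartz function of `k`. -/
def momentumWindow (h : 𝓢(Space, ℂ)) : 𝓢(Space, ℂ) :=
  SchwartzMap.compCLMOfContinuousLinearEquiv ℝ
    (LinearEquiv.smulOfNeZero ℝ Space (2 * Real.pi)⁻¹
      (inv_ne_zero (mul_ne_zero two_ne_zero Real.pi_ne_zero))).toContinuousLinearEquiv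
    (FourierTransform.fourier h : 𝓢(Space, ℂ))

/-- The dilation by (2π)⁻¹ converts from the kernel e^{-2πi k·x}. -/
theorem momentumWindow_apply (h : 𝓢(Space, ℂ)) (k : Space) :
    momentumWindow h k = ∫ x, h x * Complex.exp (-(Complex.I * (inner ℝ k x : ℝ))) := by
  have h1 : momentumWindow h k = FourierTransform.fourier (h : Space → ℂ) ((2 * Real.pi)⁻¹ • k) := rfl
  rw [h1, Real.fourier_eq']
  congr 1; ext x
  rw [smul_eq_mul, mul_comm, inner_smul_right, real_inner_comm]
  congr 2
  have := Real.pi_ne_zero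
  push_cast
  field_simp

/-- The squared modulus of `momentumWindow`. -/
def momentumWindowSq (h : 𝓢(Space, ℂ)) : 𝓢(Space, ℂ) :=
  SchwartzMap.pairing (ContinuousLinearMap.mul ℝ ℂ)
    (SchwartzMap.postcompCLM (𝕜 := ℝ) (Complex.conjCLE : ℂ →L[ℝ] ℂ) (momentumWindow h))
    (momentumWindow h)

theorem momentumWindowSq_apply (h : 𝓢(Space, ℂ)) (k : Space) :
    momentumWindowSq h k = conj (momentumWindow h k) * momentumWindow h k := rfl

/-! ### Wightman function and rate of the detector at rest -/

section

variable {m : ℝ} {f : Space → ℝ} {h : 𝓢(Space, ℂ)}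
  (hf : ∀ ζ, h ζ = (inertialVol ζ * f ζ : ℝ))

include hf in
theorem integrable_inertial_profile : Integrable fun ζ => inertialVol ζ * f ζ := by
  have := (h.integrable (μ := volume)).re
  refine this.congr (Eventually.of_forall fun ζ => ?_)
  simp [hf]

include hf in
theorem amplitude_inertial (t : ℝ) (k : Space) :
    amplitude m inertialChart inertialVol f t k =
      ((1 / √(2 * (2 * Real.pi) ^ 3 * omega m k) : ℝ) : ℂ) *
        (Complex.exp (Complex.I * t * omega m k) * momentumWindow h k) := by
  rw [amplitude_eq, momentumWindow_apply,
    ← integral_const_mul (Complex.exp (Complex.I * t * omega m k))]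
  congr 2; ext ζ
  rw [hf, mul_left_comm, ← Complex.exp_add]
  congr 2
  simp only [inertialChart]
  push_cast
  ring

theorem continuous_inertialChart (t : ℝ) : Continuous (inertialChart t) := by
  unfold inertialChart; fun_prop

theorem inertial_normalization (m : ℝ) (k : Space) :
    (1 / √(2 * (2 * Real.pi) ^ 3 * omega m k)) ^ 2 =
      1 / (2 * (2 * Real.pi) ^ 3) * (omega m k)⁻¹ := by
  have := Real.pi_pos
  have := omega_nonneg m k
  rw [div_pow, Real.sq_sqrt (by positivity), one_pow, one_div, mul_inv, one_div]

include hf in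
theorem conj_amplitude_inertial_mul (t t' : ℝ) (k : Space) :
    conj (amplitude m inertialChart inertialVol f t k) *
      amplitude m inertialChart inertialVol f t' k =
    ((1 / (2 * (2 * Real.pi) ^ 3) : ℝ) : ℂ) *
      (Complex.exp (-(Complex.I * (t - t' : ℝ) * omega m k)) *
        (((omega m k)⁻¹ : ℂ) * momentumWindowSq h k)) := by
  rw [amplitude_inertial hf, amplitude_inertial hf, momentumWindowSq_apply]
  have e1 := congrArg (fun x : ℝ => (x : ℂ)) (inertial_normalization m k)
  simp only [Complex.ofReal_pow, Complex.ofReal_mul, Complex.ofReal_inv] at e1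
  have e2 : Complex.exp (-(Complex.I * (t - t' : ℝ) * omega m k)) =
      conj (Complex.exp (Complex.I * t * omega m k)) * Complex.exp (Complex.I * t' * omega m k) := by
    rw [← Complex.exp_conj, ← Complex.exp_add]
    congr 1
    simp only [map_mul, Complex.conj_I, Complex.conj_ofReal]
    push_cast
    ring
  rw [e2, map_mul, map_mul, Complex.conj_ofReal]
  linear_combination (conj (Complex.exp (Complex.I * t * omega m k)) *
    Complex.exp (Complex.I * t' * omega m k) * (conj (momentumWindow h k) * momentumWindow h k)) * e1

include hf in
theorem memLp_inertial_amplitude (t : ℝ) :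
    MemLp (amplitude m inertialChart inertialVol f t) 2 volume := by
  rw [memLp_two_iff_integrable_sq_norm (aestronglyMeasurable_amplitude m
    (continuous_inertialChart t) (integrable_inertial_profile hf))]
  refine ((integrable_waveIntegrand m (momentumWindowSq h) (t - t)).const_mul
    ((1 / (2 * (2 * Real.pi) ^ 3) : ℝ) : ℂ)).norm.congr (Eventually.of_forall fun k => ?_)
  simp only
  rw [← conj_amplitude_inertial_mul hf t t k, norm_mul, RCLike.norm_conj, sq]

include hf in
theorem wightman_inertial (t t' : ℝ) :
    wightman m inertialChart inertialVol f t t' =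
      ((1 / (2 * (2 * Real.pi) ^ 3) : ℝ) : ℂ) * waveIntegral m (momentumWindowSq h) (t - t') := by
  rw [wightman_eq, waveIntegral, ← integral_const_mul]
  simp_rw [conj_amplitude_inertial_mul hf]

include hf in
theorem inertial_rate (t Δ : ℝ) :
    IntegrableOn (rateIntegrand m inertialChart inertialVol f t Δ) (Ioi 0) ∧
    transitionRate m inertialChart inertialVol f t Δ =
      (∫ s : ℝ, Complex.exp (-Complex.I * Δ * s) * (((1 / (2 * (2 * Real.pi) ^ 3) : ℝ) : ℂ) *
        waveIntegral m (momentumWindowSq h) s)).re := by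
  refine rate_of_wightman (fun s => ?_) ((integrable_waveIntegral m _).const_mul _) (fun s => ?_) Δ
  · rw [wightman_inertial hf]; congr 2; ring
  · have h1 := wightman_inertial (m := m) hf s 0
    have h2 := wightman_inertial (m := m) hf 0 s
    rw [sub_zero] at h1
    rw [zero_sub] at h2
    rw [← h1, ← h2, conj_wightman]

-- For real f the two sign conventions give complex conjugates.
include hf in
theorem norm_minkowskiWindow (k : Space) : ‖minkowskiWindow f k‖ = ‖momentumWindow h k‖ := by
  have : minkowskiWindow f k = conj (momentumWindow h k) := by
    rw [momentumWindow_apply, minkowskiWindow, ← integral_conj]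
    congr 1; ext x
    rw [map_mul, hf, Complex.conj_ofReal, ← Complex.exp_conj, inertialVol, one_mul]
    congr 2
    simp
  rw [this, RCLike.norm_conj]

end

/-! ### Rotation-invariant frequency distributions -/

theorem integral_radial_space (Φ : ℝ → ℂ) :
    ∫ k : Space, Φ ‖k‖ = 4 * Real.pi * ∫ r in Ioi (0 : ℝ), (r : ℂ) ^ 2 * Φ r := by
  have hvol : (volume : Measure Space).real (Metric.ball 0 1) = Real.pi * 4 / 3 := by
    have := Real.pi_pos
    rw [Measure.real, EuclideanSpace.volume_ball_fin_three]
    simp [ENNReal.toReal_ofReal (show 0 ≤ Real.pi * 4 / 3 by positivity)]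
  rw [integral_fun_norm_addHaar, hvol]
  simp only [finrank_euclideanSpace, Fintype.card_fin, Nat.add_one_sub_one, Complex.real_smul,
    nsmul_eq_mul, Complex.ofReal_pow]
  push_cast
  ring

theorem integrable_radial_space_iff {Φ : ℝ → ℂ} :
    Integrable (fun k : Space => Φ ‖k‖) ↔
      IntegrableOn (fun r : ℝ => (r : ℂ) ^ 2 * Φ r) (Ioi 0) := by
  rw [integrable_fun_norm_addHaar (volume : Measure Space)]
  simp only [finrank_euclideanSpace, Fintype.card_fin, Nat.add_one_sub_one, Complex.real_smul,
    Complex.ofReal_pow]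

theorem image_dispersion {m : ℝ} (hm : 0 ≤ m) :
    (fun r : ℝ => √(r ^ 2 + m ^ 2)) '' Ioi 0 = Ioi m := by
  ext ω
  constructor
  · rintro ⟨r, hr, rfl⟩
    have hr : 0 < r := hr
    exact Real.lt_sqrt_of_sq_lt (by nlinarith)
  · intro hω
    have hω : m < ω := hω
    have h : 0 < ω ^ 2 - m ^ 2 := by nlinarith
    refine ⟨√(ω ^ 2 - m ^ 2), Real.sqrt_pos.2 h, ?_⟩
    simp only
    rw [Real.sq_sqrt h.le, sub_add_cancel, Real.sqrt_sq (hm.trans hω.le)]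

theorem injOn_dispersion (m : ℝ) : InjOn (fun r : ℝ => √(r ^ 2 + m ^ 2)) (Ioi 0) := by
  intro r hr r' hr' h
  have hr : 0 < r := hr
  have hr' : 0 < r' := hr'
  have := (Real.sqrt_inj (by positivity) (by positivity)).1 h
  exact (sq_eq_sq₀ hr.le hr'.le).1 (by linarith)

theorem hasDerivWithinAt_dispersion (m : ℝ) {r : ℝ} (hr : r ∈ Ioi (0 : ℝ)) :
    HasDerivWithinAt (fun r : ℝ => √(r ^ 2 + m ^ 2)) (r / √(r ^ 2 + m ^ 2)) (Ioi 0) r := by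
  have hr : 0 < r := hr
  have h : HasDerivAt (fun r : ℝ => r ^ 2 + m ^ 2) (2 * r) r := by
    simpa using (hasDerivAt_pow 2 r).add_const (m ^ 2)
  have := h.sqrt (by positivity)
  rw [mul_div_mul_left _ _ two_ne_zero] at this
  exact this.hasDerivWithinAt

/-- The density `|k| G(|k|)` as a function of the frequency, extended by zero below the mass. -/
def frequencyDensity (m : ℝ) (G : ℝ → ℂ) (ω : ℝ) : ℂ :=
  (√(max ω m ^ 2 - m ^ 2) : ℂ) * G √(max ω m ^ 2 - m ^ 2)

theorem frequencyDensity_of_le (m : ℝ) (G : ℝ → ℂ) {ω : ℝ} (h : ω ≤ m) :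
    frequencyDensity m G ω = 0 := by
  simp [frequencyDensity, max_eq_right h]

theorem frequencyDensity_dispersion (m : ℝ) (G : ℝ → ℂ) {r : ℝ} (hr : 0 ≤ r) :
    frequencyDensity m G √(r ^ 2 + m ^ 2) = r * G r := by
  have h : m ≤ √(r ^ 2 + m ^ 2) := Real.le_sqrt_of_sq_le (by nlinarith)
  rw [frequencyDensity, max_eq_left h, Real.sq_sqrt (by positivity), add_sub_cancel_right,
    Real.sqrt_sq hr]

/-- The factor √(ω² - m²) vanishes at threshold, so the cut-off through `max` creates no jump;
pointwise Fourier inversion needs this. -/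
theorem continuous_frequencyDensity (m : ℝ) {G : ℝ → ℂ} (hG : Continuous G) :
    Continuous (frequencyDensity m G) := by
  unfold frequencyDensity; fun_prop

theorem dispersion_smul_frequencyDensity (m : ℝ) (G : ℝ → ℂ) (s : ℝ) {r : ℝ}
    (hr : r ∈ Ioi (0 : ℝ)) :
    |r / √(r ^ 2 + m ^ 2)| • (Complex.exp (-(Complex.I * s * (√(r ^ 2 + m ^ 2) : ℝ))) *
      frequencyDensity m G √(r ^ 2 + m ^ 2)) =
    (r : ℂ) ^ 2 * (Complex.exp (-(Complex.I * s * (√(r ^ 2 + m ^ 2) : ℝ))) *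
      (((√(r ^ 2 + m ^ 2) : ℝ) : ℂ)⁻¹ * G r)) := by
  have hr : 0 < r := hr
  rw [frequencyDensity_dispersion m G hr.le, abs_of_nonneg (by positivity), Complex.real_smul]
  push_cast
  ring

/-- On the mass shell r dr = ω dω, so r² dr/ω = r dω, and 4π is the area of the sphere. -/
theorem waveIntegral_radial {m : ℝ} (hm : 0 ≤ m) (G : ℝ → ℂ) (s : ℝ) :
    waveIntegral m (fun k => G ‖k‖) s =
      4 * Real.pi * ∫ ω : ℝ, Complex.exp (-(Complex.I * s * ω)) * frequencyDensity m G ω := by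
  have h1 : ∫ ω : ℝ, Complex.exp (-(Complex.I * s * ω)) * frequencyDensity m G ω =
      ∫ ω in Ioi m, Complex.exp (-(Complex.I * s * ω)) * frequencyDensity m G ω := by
    refine (setIntegral_eq_integral_of_forall_compl_eq_zero fun ω hω => ?_).symm
    rw [frequencyDensity_of_le m G (not_lt.1 hω), mul_zero]
  rw [h1, ← image_dispersion hm, integral_image_eq_integral_abs_deriv_smul measurableSet_Ioi
    (fun r hr => hasDerivWithinAt_dispersion m hr) (injOn_dispersion m),
    setIntegral_congr_fun measurableSet_Ioi
      (fun r hr => dispersion_smul_frequencyDensity m G s hr),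
    ← integral_radial_space fun r => Complex.exp (-(Complex.I * s * (√(r ^ 2 + m ^ 2) : ℝ))) *
      (((√(r ^ 2 + m ^ 2) : ℝ) : ℂ)⁻¹ * G r)]
  rfl

theorem integrable_frequencyDensity {m : ℝ} (hm : 0 ≤ m) {G : ℝ → ℂ}
    (hG : Integrable fun k : Space => ((omega m k)⁻¹ : ℂ) * G ‖k‖) :
    Integrable (frequencyDensity m G) := by
  have h1 := (integrable_radial_space_iff (Φ := fun r => ((√(r ^ 2 + m ^ 2) : ℝ) : ℂ)⁻¹ * G r)).1 hG
  have h2 : IntegrableOn (frequencyDensity m G) (Ioi m) := by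
    rw [← image_dispersion hm, integrableOn_image_iff_integrableOn_abs_deriv_smul
      measurableSet_Ioi (fun r hr => hasDerivWithinAt_dispersion m hr) (injOn_dispersion m)]
    refine h1.congr_fun (fun r hr => ?_) measurableSet_Ioi
    simpa using (dispersion_smul_frequencyDensity m G 0 hr).symm
  refine (integrableOn_iff_integrable_of_support_subset fun ω hω => ?_).1 h2
  by_contra h
  exact hω (frequencyDensity_of_le m G (not_lt.1 h))

theorem fourier_frequencyDensity {m : ℝ} (hm : 0 ≤ m) (G : ℝ → ℂ) (w : ℝ) :
    FourierTransform.fourier (frequencyDensity m G) w =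
      (4 * Real.pi : ℂ)⁻¹ * waveIntegral m (fun k => G ‖k‖) (2 * Real.pi * w) := by
  rw [waveIntegral_radial hm, inv_mul_cancel_left₀ (by simp),
    Real.fourier_real_eq_integral_exp_smul]
  congr 1; ext ω
  rw [smul_eq_mul]
  congr 2
  push_cast
  ring

/-- Fourier inversion holds at every Δ: the density is continuous and integrable, and its transform
is integrable because the Wightman function is. The constant is 4π from the sphere times 2π from the
frequency scaling. -/
theorem integral_waveIntegral_radial {m : ℝ} (hm : 0 ≤ m) {G : ℝ → ℂ} (hGc : Continuous G)
    (hG : Integrable fun k : Space => ((omega m k)⁻¹ : ℂ) * G ‖k‖)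
    (hw : Integrable (waveIntegral m fun k => G ‖k‖)) (Δ : ℝ) :
    ∫ s : ℝ, Complex.exp (-Complex.I * Δ * s) * waveIntegral m (fun k => G ‖k‖) s =
      8 * Real.pi ^ 2 * frequencyDensity m G (-Δ) := by
  have hpi := Real.pi_pos
  have hpi' : (Real.pi : ℂ) ≠ 0 := by exact_mod_cast hpi.ne'
  have hF : FourierTransform.fourier (frequencyDensity m G) = fun w : ℝ =>
      (4 * Real.pi : ℂ)⁻¹ * waveIntegral m (fun k => G ‖k‖) (2 * Real.pi * w) :=
    funext (fourier_frequencyDensity hm G)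
  have hFi : Integrable (FourierTransform.fourier (frequencyDensity m G)) := by
    rw [hF]
    exact (hw.comp_mul_left' (by positivity)).const_mul _
  have hinv := congrFun ((continuous_frequencyDensity m hGc).fourierInv_fourier_eq
    (integrable_frequencyDensity hm hG) hFi) (-Δ)
  rw [← hinv, Real.fourierInv_eq', hF]
  have hsub := Measure.integral_comp_mul_left (fun s : ℝ => Complex.exp (-Complex.I * Δ * s) *
    waveIntegral m (fun k => G ‖k‖) s) (2 * Real.pi)
  have e : ∀ v : ℝ, Complex.exp (((2 * Real.pi * inner ℝ v (-Δ) : ℝ) : ℂ) * Complex.I) •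
      ((4 * Real.pi : ℂ)⁻¹ * waveIntegral m (fun k => G ‖k‖) (2 * Real.pi * v)) =
      (4 * Real.pi : ℂ)⁻¹ * (Complex.exp (-Complex.I * Δ * (2 * Real.pi * v : ℝ)) *
        waveIntegral m (fun k => G ‖k‖) (2 * Real.pi * v)) := by
    intro v
    rw [smul_eq_mul, mul_left_comm]
    congr 3
    rw [real_inner_eq_re_inner ℝ, RCLike.inner_apply]
    simp only [conj_trivial, RCLike.re_to_real]
    push_cast
    ring
  simp_rw [e]
  rw [integral_const_mul, hsub, abs_of_pos (by positivity), Complex.real_smul]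
  push_cast
  field_simp
  ring

section

variable {m : ℝ} {f : Space → ℝ} {h : 𝓢(Space, ℂ)}
  (hf : ∀ ζ, h ζ = (inertialVol ζ * f ζ : ℝ))

include hf in
theorem momentumWindowSq_eq (k : Space) :
    momentumWindowSq h k = ((‖minkowskiWindow f k‖ ^ 2 : ℝ) : ℂ) := by
  rw [momentumWindowSq_apply, norm_minkowskiWindow hf, Complex.conj_mul']
  push_cast; rfl

theorem norm_single_zero {r : ℝ} (hr : 0 ≤ r) :
    ‖(EuclideanSpace.single 0 r : Space)‖ = r := by
  rw [PiLp.norm_single, Real.norm_of_nonneg hr]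

include hf in
theorem inertial_rate_radial (hm : 0 ≤ m)
    (hrad : ∀ k k' : Space, ‖k‖ = ‖k'‖ → minkowskiWindow f k = minkowskiWindow f k') (t Δ : ℝ) :
    transitionRate m inertialChart inertialVol f t Δ =
      1 / (2 * Real.pi) * theta (-Δ - m) *
        (√((-Δ) ^ 2 - m ^ 2) * ‖windowAtFrequency m f (-Δ)‖ ^ 2) := by
  -- By rotation invariance the values on the first axis determine the window.
  set G : ℝ → ℂ := fun r => momentumWindowSq h (EuclideanSpace.single 0 r) with hGdef
  have hGk : (momentumWindowSq h : Space → ℂ) = fun k => G ‖k‖ := by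
    ext k
    simp only [hGdef]
    rw [momentumWindowSq_eq hf, momentumWindowSq_eq hf,
      hrad k _ (norm_single_zero (norm_nonneg k)).symm]
  have hGc : Continuous G := by
    refine (momentumWindowSq h).continuous.comp ?_
    exact (PiLp.continuous_toLp 2 _).comp (continuous_single (A := fun _ : Fin 3 => ℝ) 0)
  have hG := integrable_inv_omega_mul m (momentumWindowSq h)
  have hw := integrable_waveIntegral m (momentumWindowSq h)
  rw [(inertial_rate hf t Δ).2]
  rw [hGk] at hG hw ⊢
  simp_rw [mul_left_comm (Complex.exp _)]
  rw [integral_const_mul, integral_waveIntegral_radial hm hGc hG hw]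
  -- At -Δ = m the square root vanishes, so the value of Θ at 0 does not matter. The constants give
  -- 8π²/(2(2π)³) = 1/(2π).
  rcases le_or_gt m (-Δ) with h | h
  · rw [frequencyDensity, max_eq_left h, hGdef, theta, if_pos (by linarith), windowAtFrequency]
    simp only
    rw [momentumWindowSq_eq hf]
    norm_cast
    have := Real.pi_pos
    field_simp
    norm_num
  · rw [frequencyDensity_of_le m G h.le, theta, if_neg (by linarith)]
    simp

end

theorem IsProfile.exists_complex {w f : Space → ℝ} (h : IsProfile w f) :
    ∃ g : 𝓢(Space, ℂ), ∀ ζ, g ζ = (w ζ * f ζ : ℝ) := by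
  obtain ⟨g, hg⟩ := h
  refine ⟨SchwartzMap.postcompCLM (𝕜 := ℝ) Complex.ofRealCLM g, fun ζ => ?_⟩
  rw [← hg]
  rfl

end UDW

end

open UDW

theorem mainTheorem6 :
    -- inertial trajectory
    (∀ (m : ℝ) (f : Space → ℝ), 0 ≤ m → IsProfile inertialVol f →
      (∀ t : ℝ, IsFockState (smearedField m inertialChart inertialVol f t vacuum)) ∧
      (∀ t Δ : ℝ, IntegrableOn (rateIntegrand m inertialChart inertialVol f t Δ) (Ioi 0)) ∧
      (∀ t t' Δ : ℝ, transitionRate m inertialChart inertialVol f t Δ =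
        transitionRate m inertialChart inertialVol f t' Δ) ∧
      ((∀ k k' : Space, ‖k‖ = ‖k'‖ → minkowskiWindow f k = minkowskiWindow f k') →
        ∀ t Δ : ℝ, transitionRate m inertialChart inertialVol f t Δ =
          1 / (2 * Real.pi) * theta (-Δ - m) *
            (√((-Δ) ^ 2 - m ^ 2) * ‖windowAtFrequency m f (-Δ)‖ ^ 2))) ∧
    -- uniformly accelerated trajectory
    (∀ (m a : ℝ) (f : Space → ℝ), 0 ≤ m → 0 < a → IsProfile (rindlerVol a) f →
      (∀ ρ : ℝ, IsFockState (smearedField m (rindlerChart a) (rindlerVol a) f ρ vacuum)) ∧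
      (∀ ρ Δ : ℝ, IntegrableOn (rateIntegrand m (rindlerChart a) (rindlerVol a) f ρ Δ) (Ioi 0)) ∧
      (∀ ρ ρ' Δ : ℝ, transitionRate m (rindlerChart a) (rindlerVol a) f ρ Δ =
        transitionRate m (rindlerChart a) (rindlerVol a) f ρ' Δ) ∧
      (∀ (Ω : ℝ) (k : Transverse), 0 < kappa m k →
        Integrable (rindlerWindowIntegrand m a f Ω k)) ∧
      (∀ Δ : ℝ, Integrable (rindlerXiIntegrand m a f Δ)) ∧
      (∀ ρ Δ : ℝ, Δ ≠ 0 → transitionRate m (rindlerChart a) (rindlerVol a) f ρ Δ =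
        2 * Real.pi * (1 / (Real.exp (2 * Real.pi * Δ / a) - 1)) * rindlerXi m a f Δ) ∧
      (∀ ρ Δ : ℝ, transitionRate m (rindlerChart a) (rindlerVol a) f ρ Δ =
        Real.exp (-(2 * Real.pi / a) * Δ) *
          transitionRate m (rindlerChart a) (rindlerVol a) f ρ (-Δ))) ∧
    -- Gaussian frequency windows
    (∀ (σ : ℝ) (l : Space), 0 < σ → ∀ k : Space,
      minkowskiWindow (gaussianProfile σ l) k =
        ((Real.exp (-(σ ^ 2 * ‖k - l‖ ^ 2 / 2)) + Real.exp (-(σ ^ 2 * ‖k + l‖ ^ 2 / 2)) : ℝ) : ℂ)) ∧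
    (∀ a σ l : ℝ, 0 < a → 0 < σ → ∀ Ω : ℝ,
      rindlerWindowOne a (gaussianRindlerProfile a σ l) Ω =
        ((Real.exp (-(σ ^ 2 * (l - Ω) ^ 2 / 2)) + Real.exp (-(σ ^ 2 * (l + Ω) ^ 2 / 2)) : ℝ) : ℂ)) := by
  refine ⟨fun m f hm hp => ?_, fun m a f hm ha hp => ?_,
    fun σ l hσ k => minkowskiWindow_gaussianProfile l hσ k,
    fun a σ l _ hσ Ω => rindlerWindowOne_gaussianRindlerProfile a l hσ Ω⟩
  · obtain ⟨h, hf⟩ := hp.exists_complex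
    exact ⟨fun t => isFockState_smearedField_vacuum m inertialChart inertialVol f t
        (memLp_inertial_amplitude hf t),
      fun t Δ => (inertial_rate hf t Δ).1,
      fun t t' Δ => (inertial_rate hf t Δ).2.trans (inertial_rate hf t' Δ).2.symm,
      fun hrad t Δ => inertial_rate_radial hf hm hrad t Δ⟩
  · obtain ⟨h, hf⟩ := hp.exists_complex
    exact ⟨fun ρ => isFockState_smearedField_vacuum m (rindlerChart a) (rindlerVol a) f ρ
        (memLp_rindler_amplitude ha hf ρ),
      fun ρ Δ => (rindler_rate ha hf ρ Δ).1,
      fun ρ ρ' Δ => (rindler_rate ha hf ρ Δ).2.trans (rindler_rate ha hf ρ' Δ).2.symm,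
      fun Ω k hk => integrable_rindlerWindowIntegrand ha hf Ω hk,
      fun Δ => integrable_rindlerXiIntegrand ha hf Δ,
      fun ρ Δ hΔ => rindler_rate_eq_xi ha hf ρ Δ hΔ,
      fun ρ Δ => rindler_kms ha hf ρ Δ⟩
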